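/- **Setting.** Let $k$ be a commutative ring, $R=k[x_1,\dots,x_n]$, $S=k[z_1,\dots,z_m]$, and let $W\in R$, $V\in S$ be potentials: the partial derivatives of $W$ form a quasi-regular sequence, the quotient of $R$ by them is a finitely generated free $k$-module, and their Koszul complex is exact except in degree zero; likewise for $V$. Let $X$ be a finite-rank matrix factorisation of $V-W$ over $k[z,x]$, i.e. a free $\mathbb Z_2$-graded module with finite homogeneous basis $(e_i)$ and dual basis $(e_i^*)$, with an odd operator $d_X$, $d_X^2=(V-W)\cdot 1_X$. Let $\lambda_1,\dots,\lambda_n$ be odd $k[z,x]$-linear endomorphisms of $X$ with $d_X\lambda_i+\lambda_i d_X=\partial_{x_i}W\cdot 1_X$. **Notation.** For a polynomial $f$ in $x$ (and possibly other variables) put $$\partial^{x,x'}_{[i]}f=\frac{f(x'_1,\dots,x'_{i-1},x_i,\dots,x_n)-f(x'_1,\dots,x'_i,x_{i+1},\dots,x_n)}{x_i-x'_i},$$ applied to $d_X$ entrywise in the basis $(e_i)$; similarly $\partial^{z,z'}_{[i]}$. Let $\Delta_W=\bigwedge\big(\bigoplus_{i=1}^n k[x,x']\theta_i\big)$ with differential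 $\sum_i\partial^{x,x'}_{[i]}W\,\theta_i\wedge(-)+\sum_i(x_i-x_i')\theta_i^*$, and define $\Delta_V$ in the same way over $k[z,z']$. Let $X^\vee$ be the dual of $X$, with differential $\nu\mapsto-(-1)^{|\nu|}\nu\circ d_X$, and $X^\dagger=R[n]\otimes_R X^\vee$. Tensor products carry the differential $d\otimes1+1\otimes d$ with Koszul signs. Write $\operatorname{Res}$ for the residue symbol $R\to k$ with denominator $\partial_{x_1}W,\dots,\partial_{x_n}W$, extended linearly. It is determined by the transformation rule $\operatorname{Res}\left[\frac{g\,dx}{f_1,\dots,f_n}\right]=\operatorname{Res}\left[\frac{\det(C)\,g\,dx}{p_1(x_1),\dots,p_n(x_n)}\right]$ whenever $p_i(x_i)=\sum_jC_{ij}f_j$ with monic $p_i$, and by the rule that $\operatorname{Res}\left[\frac{x^s\,dx}{p_1(x_1),\dots,p_n(x_n)}\right]$ is the product over $i$ of the coefficient of $t^{\deg p_i-1}$ in the remainder of $t^{s_i}$ modulo $p_i$. Consider the following maps. * The unit actions $\rho:X\otimes_R\Delta_W\to X$ and $\lambda:\Delta_V\otimes_SX\to X$, which project to $\theta$-degree $0$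 and identify the two sets of variables of $\Delta$. * $\rho^{-1}:X\to X\otimes_R\Delta_W$, $$\rho^{-1}(e_i)=\sum_{b_1<\dots<b_l}\sum_j(-1)^{\binom l2+l|e_i|}\,e_j\otimes\{\partial^{x,x'}_{[b_1]}d_X\cdots\partial^{x,x'}_{[b_l]}d_X\}_{ji}\,\theta_{b_1}\cdots\theta_{b_l}.$$ * $\widetilde{\mathrm{coev}}_X:\Delta_W\to X^\dagger\otimes_SX$, $$\widetilde{\mathrm{coev}}_X(\gamma)=\sum_{i,j}(-1)^{(l+1)|e_j|+s}\{\partial^{x,x'}_{[b_l]}d_X\cdots\partial^{x,x'}_{[b_1]}d_X\}_{ji}\,e_i^*\otimes e_j$$ for a monomial $\gamma$ in the $\theta_i$, where $b_1<\dots<b_l$ and $s$ are determined by $\gamma\wedge\theta_{b_1}\cdots\theta_{b_l}=(-1)^s\theta_1\cdots\theta_n$. * $\widetilde{\mathrm{ev}}_X:X\otimes_RX^\dagger\to\Delta_V$, for $g\in R$, $$\widetilde{\mathrm{ev}}_X(g\,e_i\otimes e_j^*)=\sum_{b_1<\dots<b_l}(-1)^{l+(n+1)|e_i|}\,\theta_{b_1}\cdots\theta_{b_l}\operatorname{Res}\left[\frac{\{\partial^{z,z'}_{[b_l]}d_X\cdots\partial^{z,z'}_{[b_1]}d_X\,\lambda_1\cdots\lambda_n\}_{ji}\,g\,dx}{\partial_{x_1}W,\dots,\partial_{x_n}W}\right].$$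 **Proposition.** The maps $\rho^{-1}$, $\widetilde{\mathrm{coev}}_X$, $\widetilde{\mathrm{ev}}_X$ are morphisms of linear factorisations (linear over $k[z,x]$, $k[x,x']$, $k[z,z']$ respectively), $\rho^{-1}$ is inverse to $\rho$ up to homotopy, and the Zorro map $$\mathcal Z=\lambda\circ(\widetilde{\mathrm{ev}}_X\otimes1)\circ(1\otimes\widetilde{\mathrm{coev}}_X)\circ\rho^{-1}:X\to X$$ is homotopic to $1_X$. -/

import Mathlib

open MvPolynomial
open scoped Kronecker

namespace LG

/-! ### Koszul signs, exterior algebra on `θ₁, …, θₙ`, potentials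

The exterior algebra `⋀ (⨁ B θᵢ)` is the free `B`-module on the monomials
`θ_b = θ_{b₁} ⋯ θ_{b_l}` with `b = {b₁ < ⋯ < b_l} ⊆ {1, …, n}`, so its elements are functions
`Finset (Fin n) → B`, and operators on it are matrices indexed by `Finset (Fin n)`; the entry
`M b c` is the coefficient of `θ_b` in `M θ_c`. -/

section Koszul

variable {n : ℕ} (B : Type*) [CommRing B]

/-- The Koszul sign of moving `θᵢ` past the `θⱼ`, `j ∈ c`, `j < i`. -/
def koszulSign (i : Fin n) (c : Finset (Fin n)) : B := (-1) ^ (c.filter (· < i)).card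

/-- `θᵢ ∧ (-)`. -/
def wedge (i : Fin n) : Matrix (Finset (Fin n)) (Finset (Fin n)) B :=
  Matrix.of fun b c => if i ∉ c ∧ b = insert i c then koszulSign B i c else 0

/-- The contraction `θᵢ^*`. -/
def contract (i : Fin n) : Matrix (Finset (Fin n)) (Finset (Fin n)) B :=
  Matrix.of fun b c => if i ∈ c ∧ b = c.erase i then koszulSign B i c else 0

variable {B}

/-- The differential `∑ fᵢ θᵢ^*` of the Koszul complex of `f₁, …, fₙ` (all degrees together). -/
def koszulDiff (f : Fin n → B) : Matrix (Finset (Fin n)) (Finset (Fin n)) B :=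
  ∑ i, f i • contract B i

/-- The Koszul complex of `f` is exact except in degree zero: every cycle without component in
degree zero is a boundary. -/
def KoszulExact (f : Fin n → B) : Prop :=
  ∀ c : Finset (Fin n) → B, c ∅ = 0 → (koszulDiff f).mulVec c = 0 →
    ∃ c' : Finset (Fin n) → B, (koszulDiff f).mulVec c' = c

/-- `f₁, …, fₙ` is quasi-regular: with `I = (f₁, …, fₙ)` the canonical surjection
`(B/I)[T₁, …, Tₙ] → gr_I B` is injective. -/
def IsQuasiRegular (f : Fin n → B) : Prop :=
  ∀ (e : ℕ) (F : MvPolynomial (Fin n) B), F.IsHomogeneous e →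
    aeval f F ∈ Ideal.span (Set.range f) ^ (e + 1) →
    ∀ s, F.coeff s ∈ Ideal.span (Set.range f)

end Koszul

/-- `W ∈ k[x₁, …, xₙ]` is a potential. -/
structure IsPotential {k : Type*} [CommRing k] {n : ℕ} (W : MvPolynomial (Fin n) k) : Prop where
  quasiRegular : IsQuasiRegular fun i => pderiv i W
  free : Module.Free k
    (MvPolynomial (Fin n) k ⧸ Ideal.span (Set.range fun i => pderiv i W))
  finite : Module.Finite k
    (MvPolynomial (Fin n) k ⧸ Ideal.span (Set.range fun i => pderiv i W))
  koszulExact : KoszulExact fun i => pderiv i W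

/-! ### Divided differences -/

section DiffQuot

variable {k σ B : Type*} [CommRing k] [Fintype σ] [DecidableEq σ] [CommRing B] [Algebra k B]

/-- The divided difference `(f(p; a ↦ u) - f(p; a ↦ v)) / (u - v)` of a polynomial `f` in the
variable `a`, all other variables being evaluated at `p`. On a monomial it is written out as
`(u^s - v^s) / (u - v) = ∑_{r < s} u^r v^(s-1-r)`, see `sub_mul_diffQuot`. -/
noncomputable def diffQuot (p : σ → B) (a : σ) (u v : B) : MvPolynomial σ k →ₗ[k] B :=
  (basisMonomials σ k).constr k fun s =>
    (∑ r ∈ Finset.range (s a), u ^ r * v ^ (s a - 1 - r)) *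
      ∏ c ∈ Finset.univ.erase a, p c ^ s c

theorem sub_mul_diffQuot (p : σ → B) (a : σ) (u v : B) (f : MvPolynomial σ k) :
    (u - v) * diffQuot p a u v f =
      aeval (Function.update p a u) f - aeval (Function.update p a v) f := by
  have key : (LinearMap.mulLeft k (u - v)) ∘ₗ diffQuot p a u v =
      (aeval (Function.update p a u)).toLinearMap
        - (aeval (Function.update p a v)).toLinearMap (R := k) := by
    refine (basisMonomials σ k).ext fun s => ?_
    have h : ∀ w : B, aeval (Function.update p a w) (monomial s (1 : k)) =
        w ^ s a * ∏ c ∈ Finset.univ.erase a, p c ^ s c := by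
      intro w
      rw [aeval_monomial, map_one, one_mul, Finsupp.prod_fintype _ _ (fun i => pow_zero _),
        ← Finset.mul_prod_erase _ _ (Finset.mem_univ a), Function.update_self]
      congr 1
      refine Finset.prod_congr rfl fun c hc => ?_
      rw [Function.update_of_ne (Finset.ne_of_mem_erase hc)]
    have hg := (Commute.all u v).geom_sum₂_mul (s a)
    have hd : diffQuot p a u v (monomial s (1 : k)) =
        (∑ r ∈ Finset.range (s a), u ^ r * v ^ (s a - 1 - r)) *
          ∏ c ∈ Finset.univ.erase a, p c ^ s c := by
      have := (basisMonomials σ k).constr_basis k (fun s : σ →₀ ℕ =>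
        (∑ r ∈ Finset.range (s a), u ^ r * v ^ (s a - 1 - r)) *
          ∏ c ∈ Finset.univ.erase a, p c ^ s c) s
      rwa [coe_basisMonomials] at this
    simp only [LinearMap.comp_apply, LinearMap.sub_apply,
      LinearMap.mulLeft_apply, coe_basisMonomials, AlgHom.toLinearMap_apply, h, hd]
    rw [← sub_mul, ← hg]
    ring
  simpa using LinearMap.congr_fun key f

/-- The point `(x'₁, …, x'_{i-1}, xᵢ, …, xₙ)`. -/
def hybrid {n : ℕ} (x x' : Fin n → B) (i : Fin n) : Fin n → B :=
  fun j => if j < i then x' j else x j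

end DiffQuot

/-! ### Residues -/

section Residue

variable {k : Type*} [CommRing k] {n : ℕ}

/-- The residue symbol `Res [g dx / (p₁(x₁), …, pₙ(xₙ))]` for monic polynomials `pᵢ` in one
variable each. On `x^s` it is the product of the one-variable residues of `t^(s i) / pᵢ(t)`, and
the latter is the coefficient of `t^(deg pᵢ - 1)` in the remainder of `t^(s i)` modulo `pᵢ`
(for `pᵢ = t^a` it is `1` if `s i = a - 1`, and `0` otherwise). -/
noncomputable def sepResidue (p : Fin n → Polynomial k) : MvPolynomial (Fin n) k →ₗ[k] k :=
  (basisMonomials (Fin n) k).constr k fun s =>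
    ∏ i, ((Polynomial.X ^ s i : Polynomial k).modByMonic (p i)).coeff ((p i).natDegree - 1)

/-- Data for the transformation rule: `pᵢ(xᵢ) = ∑ⱼ Cᵢⱼ fⱼ` with monic `pᵢ`. -/
def IsSeparation (f : Fin n → MvPolynomial (Fin n) k)
    (q : (Fin n → Polynomial k) × Matrix (Fin n) (Fin n) (MvPolynomial (Fin n) k)) : Prop :=
  (∀ i, (q.1 i).Monic) ∧ ∀ i, Polynomial.aeval (X i) (q.1 i) = ∑ j, q.2 i j * f j

open Classical in
/-- The residue symbol `g ↦ Res_{k[x]/k} [g dx / (f₁, …, fₙ)]`, computed by the transformation rule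
`Res [g dx / (f₁, …, fₙ)] = Res [det(C) g dx / (p₁(x₁), …, pₙ(xₙ))]`, `pᵢ(xᵢ) = ∑ⱼ Cᵢⱼ fⱼ`.
Such `p` and `C` exist as soon as `k[x]/(f₁, …, fₙ)` is a finitely generated `k`-module. -/
noncomputable def residue (f : Fin n → MvPolynomial (Fin n) k) : MvPolynomial (Fin n) k →ₗ[k] k :=
  if h : ∃ q, IsSeparation f q then
    sepResidue h.choose.1 ∘ₗ LinearMap.mulLeft k h.choose.2.det
  else 0

/-- The `B`-linear extension `B[x] → B` of the residue symbol, for a `k`-algebra `B`. -/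
noncomputable def residueExt (B : Type*) [CommRing B] [Algebra k B]
    (f : Fin n → MvPolynomial (Fin n) k) : MvPolynomial (Fin n) B →ₗ[B] B :=
  (basisMonomials (Fin n) B).constr B fun s => algebraMap k B (residue f (monomial s 1))

end Residue

/-! ### Factorisations with a homogeneous basis -/

/-- The sign `(-1)^a` of a parity `a`. -/
def sgn (B : Type*) [CommRing B] (a : ZMod 2) : B := (-1) ^ a.val

/-- A free `ℤ/2`-graded `B`-module with homogeneous basis `(e_i)_{i ∈ κ}`, `|e_i| = par i`, and an
operator `d e_j = ∑ᵢ D i j • e_i`. The elements of the module are the functions `κ → B`. -/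
structure Based (κ B : Type*) where
  par : κ → ZMod 2
  D : Matrix κ κ B

/-- A matrix of odd degree. -/
def IsOdd {κ B : Type*} [CommRing B] (par : κ → ZMod 2) (M : Matrix κ κ B) : Prop :=
  ∀ i j, M i j ≠ 0 → par i = par j + 1

namespace Based

variable {κ κ' B : Type*} [CommRing B]

/-- The operator is odd with square `w`. For finite `κ` this is a finite-rank matrix factorisation
of `w`. -/
structure IsFactorisation [Fintype κ] [DecidableEq κ] (M : Based κ B) (w : B) : Prop where
  odd : IsOdd M.par M.D
  sq : M.D * M.D = w • (1 : Matrix κ κ B)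

/-- Extension of scalars. -/
def map {B' : Type*} (φ : B → B') (M : Based κ B) : Based κ B' := ⟨M.par, M.D.map φ⟩

/-- The dual, with the dual basis and `d ν = -(-1)^|ν| ν ∘ d`. -/
def dual (M : Based κ B) : Based κ B :=
  ⟨M.par, Matrix.of fun i j => -(sgn B (M.par j) * M.D j i)⟩

/-- The shift `M[n]`. -/
def shift (n : ℕ) (M : Based κ B) : Based κ B :=
  ⟨fun i => M.par i + n, (-1 : B) ^ n • M.D⟩

/-- The tensor product over `B`, with basis `e_i ⊗ e_j` and
`d (e_i ⊗ e_j) = d e_i ⊗ e_j + (-1)^|e_i| e_i ⊗ d e_j`. -/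
def tensor [DecidableEq κ] [DecidableEq κ'] (M : Based κ B) (N : Based κ' B) :
    Based (κ × κ') B :=
  ⟨fun p => M.par p.1 + N.par p.2,
    M.D ⊗ₖ (1 : Matrix κ' κ' B) + Matrix.diagonal (fun i => sgn B (M.par i)) ⊗ₖ N.D⟩

end Based

section Morphisms

variable {A B B' : Type*} {κ κ' : Type*} [CommRing A] [CommRing B] [CommRing B']
  [Algebra A B] [Algebra A B'] [Fintype κ] [Fintype κ']

/-- The `A`-linear map `φ : M → N` has degree `g`. -/
def HasDegree (M : Based κ B) (N : Based κ' B') (g : ZMod 2) (φ : (κ → B) →ₗ[A] (κ' → B')) : Prop :=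
  ∀ (e : ZMod 2) (v : κ → B), (∀ i, v i ≠ 0 → M.par i = e) →
    ∀ j, φ v j ≠ 0 → N.par j = e + g

/-- `φ : M → N` is an `A`-linear morphism: even and compatible with the differentials. -/
def IsMorphism (M : Based κ B) (N : Based κ' B') (φ : (κ → B) →ₗ[A] (κ' → B')) : Prop :=
  HasDegree M N 0 φ ∧ ∀ v, N.D.mulVec (φ v) = φ (M.D.mulVec v)

/-- `φ` and `ψ` are homotopic: `ψ - φ = d h + h d` for an odd `A`-linear map `h`. -/
def Homotopic (M : Based κ B) (N : Based κ' B') (φ ψ : (κ → B) →ₗ[A] (κ' → B')) : Prop :=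
  ∃ h : (κ → B) →ₗ[A] (κ' → B'), HasDegree M N 1 h ∧
    ∀ v, N.D.mulVec (h v) + h (M.D.mulVec v) = ψ v - φ v

end Morphisms

section LinearMaps

/-- The `A`-linear map `e_i ↦ ∑ⱼ M j i • e_j` from a free `A`-module to a free `B`-module. -/
noncomputable def ofMatrix (A : Type*) {B κ κ' : Type*} [CommRing A] [CommRing B] [Algebra A B] [Fintype κ]
    (M : Matrix κ' κ B) : (κ → A) →ₗ[A] (κ' → B) :=
  (M.mulVecLin.restrictScalars A) ∘ₗ (Algebra.linearMap A B).compLeft κ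

/-- `1 ⊗ φ`, `e_i ⊗ y ↦ e_i ⊗ φ y`, where the first factor has the basis `(e_i)_{i ∈ ι}`. -/
def idTensor (A ι : Type*) {B B' κ κ' : Type*} [CommRing A] [CommRing B] [CommRing B']
    [Algebra A B] [Algebra B B'] [Algebra A B'] [IsScalarTower A B B']
    (φ : (κ → B) →ₗ[B] (κ' → B')) : (ι × κ → B) →ₗ[A] (ι × κ' → B') :=
  LinearMap.pi fun p =>
    LinearMap.proj p.2 ∘ₗ φ.restrictScalars A ∘ₗ LinearMap.funLeft A B fun a => (p.1, a)

/-- `φ ⊗ 1`, `x ⊗ e_i ↦ φ x ⊗ e_i`, where the second factor has the basis `(e_i)_{i ∈ ι}`. -/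
def tensorId (A ι : Type*) {B B' κ κ' : Type*} [CommRing A] [CommRing B] [CommRing B']
    [Algebra A B] [Algebra B B'] [Algebra A B'] [IsScalarTower A B B']
    (φ : (κ → B') →ₗ[B] (κ' → B)) : (κ × ι → B') →ₗ[A] (κ' × ι → B) :=
  LinearMap.pi fun p =>
    LinearMap.proj p.1 ∘ₗ φ.restrictScalars A ∘ₗ LinearMap.funLeft A B' fun a => (a, p.2)

end LinearMaps

/-! ### The unit, the unit actions, evaluation and coevaluation

`R = k[x]`, `S = k[z]`, and `X` is a factorisation over `k[z, x]`. A tensor product over an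
intermediate ring, such as `X ⊗_R Δ_W`, is a free module over the polynomial ring in all
variables, which is written as `A[y]` with `A` the polynomial ring in the outer variables (over
which the tensor product is regarded as a factorisation) and `y` the inner variables. So, e.g.,
`X ⊗_R Δ_W` is free over `A[x]` with `A = k[z, x']`.

To have `f ⊗ 1` and `1 ⊗ f` available, each object is defined for an arbitrary `k`-algebra `B` and
points with coordinates in `B` in place of the outer variables. -/

section Objects

variable {k : Type*} [CommRing k] {n m : ℕ} {ι : Type*} [Fintype ι] [DecidableEq ι]

/-- `k[z, x]`. -/
abbrev ZX (k : Type*) [CommRing k] (m n : ℕ) : Type _ := MvPolynomial (Fin m ⊕ Fin n) k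

/-- `k[x, x']`. -/
abbrev Env (k : Type*) [CommRing k] (n : ℕ) : Type _ := MvPolynomial (Fin n ⊕ Fin n) k

/-- `V - W` in `k[z, x]`. -/
noncomputable def difference (W : MvPolynomial (Fin n) k) (V : MvPolynomial (Fin m) k) : ZX k m n :=
  rename Sum.inl V - rename Sum.inr W

section AtPoints

variable {B : Type*} [CommRing B] [Algebra k B]

/-- The unit `Δ_W` over `B`, with `d = ∑ᵢ ∂_{[i]}^{x,x'} W θᵢ ∧ (-) + ∑ᵢ (xᵢ - x'ᵢ) θᵢ^*`. -/
noncomputable def unitAt (W : MvPolynomial (Fin n) k) (x x' : Fin n → B) :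
    Based (Finset (Fin n)) B where
  par b := b.card
  D := ∑ i, (diffQuot (hybrid x x' i) i (x i) (x' i) W • wedge B i
    + (x i - x' i) • contract B i)

/-- `X` with its variables named `z, x`. -/
noncomputable def atPoint (X : Based ι (ZX k m n)) (z : Fin m → B) (x : Fin n → B) : Based ι B :=
  X.map (aeval (Sum.elim z x))

/-- `X^† = R[n] ⊗_R X^∨` with its variables named `z, x`. -/
noncomputable def daggerAt (X : Based ι (ZX k m n)) (z : Fin m → B) (x : Fin n → B) : Based ι B :=
  (atPoint X z x).dual.shift n

/-- The matrix `∂_{[i]}^{x,x'} d_X` over `k[z, x, x']`. -/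
noncomputable def diffX (X : Based ι (ZX k m n)) (z : Fin m → B) (x x' : Fin n → B) (i : Fin n) :
    Matrix ι ι B :=
  X.D.map (diffQuot (Sum.elim z (hybrid x x' i)) (Sum.inr i) (x i) (x' i))

/-- The matrix `∂_{[i]}^{z,z'} d_X` over `k[z, z', x]`. -/
noncomputable def diffZ (X : Based ι (ZX k m n)) (z z' : Fin m → B) (x : Fin n → B) (i : Fin m) :
    Matrix ι ι B :=
  X.D.map (diffQuot (Sum.elim (hybrid z z' i) x) (Sum.inl i) (z i) (z' i))

end AtPoints

/-- `M_{b₁} ⋯ M_{b_l}` for `b = {b₁ < ⋯ < b_l}`. -/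
def ascProd {B : Type*} [CommRing B] {r : ℕ} (b : Finset (Fin r)) (M : Fin r → Matrix ι ι B) :
    Matrix ι ι B :=
  (b.sort.map M).prod

/-- `M_{b_l} ⋯ M_{b₁}` for `b = {b₁ < ⋯ < b_l}`. -/
def descProd {B : Type*} [CommRing B] {r : ℕ} (b : Finset (Fin r)) (M : Fin r → Matrix ι ι B) :
    Matrix ι ι B :=
  (b.sort.reverse.map M).prod

/-- The exponent `s` in `θ_a ∧ θ_b = (-1)^s θ₁ ⋯ θₙ`, where `b` is the complement of `a`. -/
def shuffleInv {r : ℕ} (a : Finset (Fin r)) : ℕ :=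
  ((a ×ˢ aᶜ).filter fun p => p.2 < p.1).card

/-- `λ` is a family of null-homotopies on `X` for the actions of `∂W/∂x₁, …, ∂W/∂xₙ`. -/
def IsNullHomotopy (W : MvPolynomial (Fin n) k) (X : Based ι (ZX k m n))
    (lam : Fin n → Matrix ι ι (ZX k m n)) : Prop :=
  ∀ i, IsOdd X.par (lam i) ∧
    X.D * lam i + lam i * X.D = (rename Sum.inr (pderiv i W) : ZX k m n) • (1 : Matrix ι ι _)

/-- The variables `z` of `k[z, x]`. -/
noncomputable def zVar (k : Type*) [CommRing k] (m n : ℕ) (j : Fin m) : ZX k m n :=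
  MvPolynomial.X (Sum.inl j)

/-- The variables `x` of `k[z, x]`. -/
noncomputable def xVar (k : Type*) [CommRing k] (m n : ℕ) (j : Fin n) : ZX k m n :=
  MvPolynomial.X (Sum.inr j)

/-- The variables `x` of `k[x, x']`. -/
noncomputable def leftVar (k : Type*) [CommRing k] (n : ℕ) (j : Fin n) : Env k n :=
  MvPolynomial.X (Sum.inl j)

/-- The variables `x'` of `k[x, x']`. -/
noncomputable def rightVar (k : Type*) [CommRing k] (n : ℕ) (j : Fin n) : Env k n :=
  MvPolynomial.X (Sum.inr j)

/-- `X ⊗_R Δ_W` over `k[z, x']`, with inner variables `x`. -/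
noncomputable def tensorUnit (W : MvPolynomial (Fin n) k) (X : Based ι (ZX k m n)) :
    Based (ι × Finset (Fin n)) (MvPolynomial (Fin n) (ZX k m n)) :=
  (atPoint X (fun j => C (zVar k m n j)) MvPolynomial.X).tensor
    (unitAt W MvPolynomial.X fun j => C (xVar k m n j))

/-- `Δ_W` over `k[x, x']`. -/
noncomputable def unit (W : MvPolynomial (Fin n) k) : Based (Finset (Fin n)) (Env k n) :=
  unitAt W (leftVar k n) (rightVar k n)

/-- `X^† ⊗_S X` over `k[x, x']`, with inner variables `z`. -/
noncomputable def daggerTensor (X : Based ι (ZX k m n)) :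
    Based (ι × ι) (MvPolynomial (Fin m) (Env k n)) :=
  (daggerAt X MvPolynomial.X fun j => C (leftVar k n j)).tensor
    (atPoint X MvPolynomial.X fun j => C (rightVar k n j))

/-- `X ⊗_R X^†` over `k[z, z']`, with inner variables `x`. -/
noncomputable def tensorDagger (X : Based ι (ZX k m n)) :
    Based (ι × ι) (MvPolynomial (Fin n) (Env k m)) :=
  (atPoint X (fun j => C (leftVar k m j)) MvPolynomial.X).tensor
    (daggerAt X (fun j => C (rightVar k m j)) MvPolynomial.X)

/-- The right unit action `ρ : X ⊗_R Δ_W → X`, `e_i ⊗ g θ_b ↦ g|_{x = x'} e_i` for `b = ∅` and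
`↦ 0` for `b ≠ ∅`. -/
noncomputable def rho (k : Type*) [CommRing k] (m n : ℕ) (ι : Type*) :
    (ι × Finset (Fin n) → MvPolynomial (Fin n) (ZX k m n)) →ₗ[ZX k m n] (ι → ZX k m n) :=
  LinearMap.pi fun i =>
    (aeval (xVar k m n)).toLinearMap ∘ₗ
      LinearMap.proj (i, ∅)

/-- `ρ⁻¹ : X → X ⊗_R Δ_W`,
`e_i ↦ ∑_{b = {b₁ < ⋯ < b_l}} ∑ⱼ (-1)^(l(l-1)/2 + l|e_i|)
  e_j ⊗ {∂_{[b₁]} d_X ⋯ ∂_{[b_l]} d_X}_{ji} θ_{b₁} ⋯ θ_{b_l}`. -/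
noncomputable def rhoInv (X : Based ι (ZX k m n)) :
    (ι → ZX k m n) →ₗ[ZX k m n] (ι × Finset (Fin n) → MvPolynomial (Fin n) (ZX k m n)) :=
  ofMatrix (ZX k m n) <| Matrix.of fun p i =>
    (-1) ^ (p.2.card.choose 2 + p.2.card * (X.par i).val) *
      ascProd p.2 (diffX X (fun j => C (zVar k m n j)) MvPolynomial.X
        fun j => C (xVar k m n j)) p.1 i

/-- The left unit action `λ : Δ_V ⊗_S X → X`, where `Δ_V ⊗_S X` is regarded over `k[z, x']` and
the inner variables `z'` are replaced by `z`. -/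
noncomputable def lambda (k : Type*) [CommRing k] (m n : ℕ) (ι : Type*) :
    (Finset (Fin m) × ι → MvPolynomial (Fin m) (ZX k m n)) →ₗ[ZX k m n] (ι → ZX k m n) :=
  LinearMap.pi fun i =>
    (aeval (zVar k m n)).toLinearMap ∘ₗ
      LinearMap.proj (∅, i)

/-- The coevaluation `Δ_W → X^† ⊗_S X` over a `k`-algebra `B` with coordinates `x, x'`:
`θ_a ↦ ∑_{i,j} (-1)^((l+1)|e_j| + s) {∂_{[b_l]} d_X ⋯ ∂_{[b₁]} d_X}_{ji} e_i^* ⊗ e_j`, where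
`b = {b₁ < ⋯ < b_l}` is the complement of `a` and `θ_a θ_b = (-1)^s θ₁ ⋯ θₙ`. -/
noncomputable def coevAt {B : Type*} [CommRing B] [Algebra k B] (X : Based ι (ZX k m n))
    (x x' : Fin n → B) :
    (Finset (Fin n) → B) →ₗ[B] (ι × ι → MvPolynomial (Fin m) B) :=
  ofMatrix B <| Matrix.of fun p a =>
    (-1) ^ ((aᶜ.card + 1) * (X.par p.2).val + shuffleInv a) *
      descProd aᶜ (diffX X MvPolynomial.X (fun j => C (x j)) fun j => C (x' j)) p.2 p.1

/-- The evaluation `X ⊗_R X^† → Δ_V` over a `k`-algebra `B` with coordinates `z, z'`: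
`g e_i ⊗ e_j^* ↦ ∑_{b = {b₁ < ⋯ < b_l}} (-1)^(l + (n+1)|e_i|) θ_{b₁} ⋯ θ_{b_l}
  Res [{∂_{[b_l]} d_X ⋯ ∂_{[b₁]} d_X λ₁ ⋯ λₙ}_{ji} g dx / (∂W/∂x₁, …, ∂W/∂xₙ)]`. -/
noncomputable def evAt {B : Type*} [CommRing B] [Algebra k B] (W : MvPolynomial (Fin n) k)
    (X : Based ι (ZX k m n)) (lam : Fin n → Matrix ι ι (ZX k m n)) (z z' : Fin m → B) :
    (ι × ι → MvPolynomial (Fin n) B) →ₗ[B] (Finset (Fin m) → B) :=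
  LinearMap.pi fun b => ∑ p : ι × ι,
    residueExt B (fun i => pderiv i W) ∘ₗ
      LinearMap.mulLeft B
        ((-1) ^ (b.card + (n + 1) * (X.par p.1).val) *
          (descProd b (diffZ X (fun j => C (z j)) (fun j => C (z' j)) MvPolynomial.X) *
            (List.ofFn lam).prod.map
              (aeval (Sum.elim (fun j => C (z j)) MvPolynomial.X))) p.2 p.1) ∘ₗ
      LinearMap.proj p

/-- The coevaluation `Δ_W → X^† ⊗_S X`. -/
noncomputable def coev (X : Based ι (ZX k m n)) :
    (Finset (Fin n) → Env k n) →ₗ[Env k n] (ι × ι → MvPolynomial (Fin m) (Env k n)) :=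
  coevAt X (leftVar k n) (rightVar k n)

/-- The evaluation `X ⊗_R X^† → Δ_V`. -/
noncomputable def ev (W : MvPolynomial (Fin n) k) (X : Based ι (ZX k m n))
    (lam : Fin n → Matrix ι ι (ZX k m n)) :
    (ι × ι → MvPolynomial (Fin n) (Env k m)) →ₗ[Env k m] (Finset (Fin m) → Env k m) :=
  evAt W X lam (leftVar k m) (rightVar k m)

/-- `1 ⊗ coev : X ⊗_R Δ_W → X ⊗_R (X^† ⊗_S X)`; the new inner variables are the `z'`. -/
noncomputable def idTensorCoev (X : Based ι (ZX k m n)) :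
    (ι × Finset (Fin n) → MvPolynomial (Fin n) (ZX k m n)) →ₗ[ZX k m n]
      (ι × (ι × ι) → MvPolynomial (Fin m) (MvPolynomial (Fin n) (ZX k m n))) :=
  idTensor (ZX k m n) ι (coevAt X MvPolynomial.X fun j => C (xVar k m n j))

/-- `X ⊗_R (X^† ⊗_S X) → (X ⊗_R X^†) ⊗_S X`. -/
noncomputable def assoc (k : Type*) [CommRing k] (m n : ℕ) (ι : Type*) :
    (ι × (ι × ι) → MvPolynomial (Fin m) (MvPolynomial (Fin n) (ZX k m n))) →ₗ[ZX k m n]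
      ((ι × ι) × ι → MvPolynomial (Fin n) (MvPolynomial (Fin m) (ZX k m n))) :=
  (commAlgEquiv (ZX k m n) (Fin m) (Fin n)).toLinearMap.compLeft ((ι × ι) × ι) ∘ₗ
    LinearMap.funLeft (ZX k m n) _ fun p => (p.1.1, (p.1.2, p.2))

/-- `ev ⊗ 1 : (X ⊗_R X^†) ⊗_S X → Δ_V ⊗_S X`. -/
noncomputable def evTensorId (W : MvPolynomial (Fin n) k) (X : Based ι (ZX k m n))
    (lam : Fin n → Matrix ι ι (ZX k m n)) :
    ((ι × ι) × ι → MvPolynomial (Fin n) (MvPolynomial (Fin m) (ZX k m n))) →ₗ[ZX k m n]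
      (Finset (Fin m) × ι → MvPolynomial (Fin m) (ZX k m n)) :=
  tensorId (ZX k m n) ι
    (evAt W X lam (fun j => C (zVar k m n j)) MvPolynomial.X)

/-- The Zorro map `λ ∘ (ev ⊗ 1) ∘ (1 ⊗ coev) ∘ ρ⁻¹ : X → X`. -/
noncomputable def zorro (W : MvPolynomial (Fin n) k) (X : Based ι (ZX k m n))
    (lam : Fin n → Matrix ι ι (ZX k m n)) : (ι → ZX k m n) →ₗ[ZX k m n] (ι → ZX k m n) :=
  lambda k m n ι ∘ₗ evTensorId W X lam ∘ₗ assoc k m n ι ∘ₗ idTensorCoev X ∘ₗ rhoInv X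

end Objects

end LG

set_option linter.unusedSectionVars false

/-! Count variables from 0. Let `D t` be $d_X$ at the point
$(x'_0,\dots,x'_{t-1},x_t,\dots,x_{n-1})$ and $T_i=\partial_{[i]}d_X$. Two relations drive the
proof: $D_i-D_{i+1}=(x_i-x'_i)T_i$, and, by the Leibniz rule for divided differences applied to
$d_X^2=V-W$, $D_iT_i+T_iD_{i+1}=-\partial_{[i]}W$.

Morphisms. Moving $D$ through an ordered product of the $T_i$ gives a telescoping sum. Each of its
terms either deletes a factor, with coefficient $\partial_{[i]}W$ up to sign, or inserts one, with
coefficient $x_i-x'_i$. These are the two halves of the differential of $\Delta_W$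
(`ascProd_telescope`, `descProd_telescope`). Thus $\rho^{-1}$ and the coevaluation are morphisms up
to a check of signs. The evaluation uses the same argument in the variables $z$, together with the
fact that $d_X$ commutes in the graded sense with $\lambda_1\cdots\lambda_n$ modulo the ideal of the
$\partial_iW$, which the residue kills (`residueExt_sum_commutator_eq_zero`).

Inverse of $\rho$. The composition $\rho\rho^{-1}$ is the identity on the nose. For the other
composition, the Koszul complex of $x_i-x'_i$ has an explicit contraction
(`koszulDiff_koszulHomotopy_nonempty`), and the rest of the differential does not lower the
$\theta$-degree. The homotopy is corrected one $\theta$-degree at a time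
(`exists_partial_homotopy`).

Zorro map. The action $\lambda$ keeps only $\theta$-degree 0 of the evaluation and sets $z'=z$. What
remains is the residue of a signed sum of products $T\cdots T\,\lambda_1\cdots\lambda_n\,T\cdots T$,
which is the expansion of $[T_{n-1},\dots,[T_0,\lambda_1\cdots\lambda_n]]$ (`iterSuperAd_eq_sum`,
`zorroKernel_eq`). Choose monic $p_i(x_i)=\sum_jC_{ij}\partial_jW$. Multiplying numerator and
denominators by the $x_i-x'_i$ replaces $T_i$ by $D_i-D_{i+1}$. Moreover
$\det(C)\lambda_1\cdots\lambda_n$ is the image of the wedge $v_0\wedge\dots\wedge v_{n-1}$ of the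
rows of $C$ under $\theta_b\mapsto\lambda_b$.

The commutators are then removed from the inside out (`exists_mapMatrix_adWord_ordered`). In
$[D_r-D_{r+1},F]$, the part with $D_{r+1}$ passes through the outer commutators, because each
$D_t^2$ is a scalar, and emerges as a commutator with $D_n=d_X(z,x')$, which is null-homotopic. In
the other part $D_r$ may be replaced by $D_0$, since the variables before $x_r$ are already
evaluated at $x'$. As $[D_0,\lambda_i]=\partial_iW$, that part acts as a Koszul differential and
turns $v_r\wedge\cdots$ into $p_r\,v_{r+1}\wedge\cdots$ plus multiples of $p_j$, $j>r$, which the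
residue kills. The factor $p_r$ cancels in the denominator $(x_r-x'_r)p_r$, so the residue in $x_r$
becomes evaluation at $x'_r$. After $n$ steps the identity is left. -/

namespace LG

/-! ### Parities and signs of matrices -/

section Parity

variable {κ B : Type*} [CommRing B]

/-- A matrix of degree `g`. -/
def HasParity (par : κ → ZMod 2) (g : ZMod 2) (M : Matrix κ κ B) : Prop :=
  ∀ i j, M i j ≠ 0 → par i = par j + g

variable {par : κ → ZMod 2} {g g' : ZMod 2} {M N : Matrix κ κ B}

theorem HasParity.zero : HasParity par g (0 : Matrix κ κ B) := fun _ _ h => (h rfl).elim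

theorem HasParity.add (hM : HasParity par g M) (hN : HasParity par g N) :
    HasParity par g (M + N) := fun i j h => by
  by_cases h1 : M i j = 0
  · refine hN i j fun h2 => h ?_
    simp [h1, h2]
  · exact hM i j h1

theorem HasParity.neg (hM : HasParity par g M) : HasParity par g (-M) := fun i j h =>
  hM i j fun h1 => h (by simp [h1])

theorem HasParity.sub (hM : HasParity par g M) (hN : HasParity par g N) :
    HasParity par g (M - N) := by
  rw [sub_eq_add_neg]; exact hM.add hN.neg

theorem HasParity.smul {R : Type*} [SMulZeroClass R B] (c : R) (hM : HasParity par g M) :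
    HasParity par g (c • M) := fun i j h =>
  hM i j fun h1 => h (by simp [h1])

theorem HasParity.sum {α : Type*} (s : Finset α) (f : α → Matrix κ κ B)
    (h : ∀ a ∈ s, HasParity par g (f a)) : HasParity par g (∑ a ∈ s, f a) := by
  classical
  induction s using Finset.induction_on with
  | empty => simpa using HasParity.zero
  | insert a s ha ih =>
    rw [Finset.sum_insert ha]
    exact (h a (Finset.mem_insert_self a s)).add
      (ih fun b hb => h b (Finset.mem_insert_of_mem hb))

theorem HasParity.map {B' : Type*} [CommRing B'] (φ : B → B') (hφ : φ 0 = 0)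
    (hM : HasParity par g M) : HasParity par g (M.map φ) := fun i j h =>
  hM i j fun h1 => h (by simp [h1, hφ])

variable [Fintype κ]

theorem HasParity.mul (hM : HasParity par g M) (hN : HasParity par g' N) :
    HasParity par (g + g') (M * N) := fun i j h => by
  rw [Matrix.mul_apply] at h
  obtain ⟨a, -, ha⟩ := Finset.exists_ne_zero_of_sum_ne_zero h
  rw [hM i a (left_ne_zero_of_mul ha), hN a j (right_ne_zero_of_mul ha)]
  ring

variable [DecidableEq κ]

theorem HasParity.one : HasParity par 0 (1 : Matrix κ κ B) := fun i j h => by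
  by_cases hij : i = j
  · simp [hij]
  · exact (h (Matrix.one_apply_ne hij)).elim

theorem HasParity.cast {g'' : ZMod 2} (hM : HasParity par g M) (h : g = g'') :
    HasParity par g'' M := h ▸ hM

theorem sgn_add (B : Type*) [CommRing B] (a b : ZMod 2) : sgn B (a + b) = sgn B a * sgn B b := by
  unfold sgn
  rw [ZMod.val_add, ← pow_add, neg_one_pow_eq_pow_mod_two (n := a.val + b.val)]

theorem sgn_mul_self (B : Type*) [CommRing B] (a : ZMod 2) : sgn B a * sgn B a = 1 := by
  unfold sgn
  rw [← pow_add, ← two_mul, pow_mul]; simp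

theorem sgn_natCast (B : Type*) [CommRing B] (a : ℕ) : sgn B (a : ZMod 2) = (-1) ^ a := by
  unfold sgn
  rw [ZMod.val_natCast, ← neg_one_pow_eq_pow_mod_two]

theorem sgn_one (B : Type*) [CommRing B] : sgn B 1 = -1 := by
  have := sgn_natCast B 1
  simpa using this

theorem sgn_zero (B : Type*) [CommRing B] : sgn B 0 = 1 := by
  have := sgn_natCast B 0
  simpa using this

/-- The grading operator `e_i ↦ (-1)^|e_i| e_i`. -/
def sgnMat (B : Type*) [CommRing B] (par : κ → ZMod 2) : Matrix κ κ B :=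
  Matrix.diagonal fun i => sgn B (par i)

theorem sgnMat_mul_self : sgnMat B par * sgnMat B par = 1 := by
  simp [sgnMat, Matrix.diagonal_mul_diagonal, sgn_mul_self]

theorem sgnMat_mul_sgnMat_mul (M : Matrix κ κ B) : sgnMat B par * (sgnMat B par * M) = M := by
  rw [← Matrix.mul_assoc, sgnMat_mul_self, Matrix.one_mul]

theorem HasParity.sgnMat : HasParity par 0 (sgnMat B par) := fun i j h => by
  by_cases hij : i = j
  · simp [hij]
  · exact (h (Matrix.diagonal_apply_ne _ hij)).elim

theorem HasParity.sgnMat_mul (hM : HasParity par g M) :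
    LG.sgnMat B par * M = sgn B g • (M * LG.sgnMat B par) := by
  ext i j
  simp only [LG.sgnMat, Matrix.diagonal_mul, Matrix.smul_apply, Matrix.mul_diagonal, smul_eq_mul]
  by_cases h : M i j = 0
  · simp [h]
  · rw [hM i j h, sgn_add]; ring

theorem HasParity.mul_sgnMat (hM : HasParity par g M) :
    M * LG.sgnMat B par = sgn B g • (LG.sgnMat B par * M) := by
  rw [hM.sgnMat_mul, smul_smul, sgn_mul_self, one_smul]

theorem HasParity.sgnMat_mul_mul_sgnMat (hM : HasParity par g M) :
    LG.sgnMat B par * M * LG.sgnMat B par = sgn B g • M := by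
  rw [hM.sgnMat_mul, Matrix.smul_mul, Matrix.mul_assoc, sgnMat_mul_self, Matrix.mul_one]

/-- Lets the signs $(-1)^{l|e_i|}$ in the formulas for the three maps be written as powers of the
grading operator, so that sign checks become commutations of matrices. -/
theorem sgnMat_pow_mul_apply (l : ℕ) (M : Matrix κ κ B) (i j : κ) :
    (sgnMat B par ^ l * M) i j = (-1) ^ (l * (par i).val) * M i j := by
  rw [sgnMat, Matrix.diagonal_pow, Matrix.diagonal_mul, Pi.pow_apply, sgn, ← pow_mul,
    mul_comm (par i).val]

theorem mul_sgnMat_pow_apply (l : ℕ) (M : Matrix κ κ B) (i j : κ) :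
    (M * sgnMat B par ^ l) i j = (-1) ^ (l * (par j).val) * M i j := by
  rw [sgnMat, Matrix.diagonal_pow, Matrix.mul_diagonal, Pi.pow_apply, sgn, ← pow_mul,
    mul_comm (par j).val, mul_comm]

end Parity

/-! ### Ordered products -/

section OrderedProducts

theorem prod_map_filter_eq {α Q : Type*} [Monoid Q] (p : α → Prop) [DecidablePred p] (f : α → Q)
    (l : List α) : ((l.filter p).map f).prod = (l.map fun i => if p i then f i else 1).prod := by
  induction l with
  | nil => simp
  | cons a l ih => by_cases h : p a <;> simp [h, ih]

variable {Q : Type*} [Monoid Q] {r : ℕ}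

theorem sort_eq_filter_finRange (c : Finset (Fin r)) :
    c.sort = (List.finRange r).filter (· ∈ c) := by
  have hn : ((List.finRange r).filter (· ∈ c)).Nodup := (List.nodup_finRange r).filter _
  have h := (List.toFinset_sort (· ≤ ·) hn).2
    (((List.pairwise_lt_finRange r).filter _).imp fun h => le_of_lt h)
  rw [← h]
  congr 1
  ext i
  simp

/-- Padding with identities makes the number of factors independent of `c`; erasing or inserting an
index then alters a single factor. -/
theorem prod_map_sort (c : Finset (Fin r)) (M : Fin r → Q) :
    (c.sort.map M).prod = (List.ofFn fun i => if i ∈ c then M i else 1).prod := by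
  rw [sort_eq_filter_finRange, prod_map_filter_eq, List.ofFn_eq_map]

/-- `G₀ ⋯ G_{t-1}`. -/
def prefixProd (G : Fin r → Q) (t : ℕ) : Q := ((List.ofFn G).take t).prod

/-- `G_t ⋯ G_{r-1}`. -/
def suffixProd (G : Fin r → Q) (t : ℕ) : Q := ((List.ofFn G).drop t).prod

theorem prefixProd_zero (G : Fin r → Q) : prefixProd G 0 = 1 := by simp [prefixProd]

theorem prefixProd_self (G : Fin r → Q) : prefixProd G r = (List.ofFn G).prod := by
  rw [prefixProd, List.take_of_length_le (by simp)]

theorem suffixProd_zero (G : Fin r → Q) : suffixProd G 0 = (List.ofFn G).prod := by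
  simp [suffixProd]

theorem suffixProd_self (G : Fin r → Q) : suffixProd G r = 1 := by
  rw [suffixProd, List.drop_of_length_le (by simp), List.prod_nil]

theorem prefixProd_succ (G : Fin r → Q) (i : Fin r) :
    prefixProd G (i + 1) = prefixProd G i * G i := by
  rw [prefixProd, prefixProd, List.take_add_one]
  simp

theorem suffixProd_eq_mul (G : Fin r → Q) (i : Fin r) :
    suffixProd G i = G i * suffixProd G (i + 1) := by
  rw [suffixProd, suffixProd, List.drop_eq_getElem_cons (by simp)]
  simp

theorem prefixProd_mul_suffixProd (G : Fin r → Q) (t : ℕ) :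
    prefixProd G t * suffixProd G t = (List.ofFn G).prod := by
  rw [prefixProd, suffixProd, List.prod_take_mul_prod_drop]

theorem prefixProd_congr {G G' : Fin r → Q} {t : ℕ} (h : ∀ j : Fin r, (j : ℕ) < t → G j = G' j) :
    prefixProd G t = prefixProd G' t := by
  unfold prefixProd
  congr 1
  apply List.ext_getElem
  · simp
  · intro i h1 h2
    simp only [List.getElem_take, List.getElem_ofFn]
    exact h _ (by simp at h1; exact h1.1)

theorem suffixProd_congr {G G' : Fin r → Q} {t : ℕ} (h : ∀ j : Fin r, t ≤ (j : ℕ) → G j = G' j) :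
    suffixProd G t = suffixProd G' t := by
  unfold suffixProd
  congr 1
  apply List.ext_getElem
  · simp
  · intro i h1 h2
    simp only [List.getElem_drop, List.getElem_ofFn]
    exact h _ (by simp)

/-- The factors of the ordered product over `c`. -/
def factors (c : Finset (Fin r)) (M : Fin r → Q) (i : Fin r) : Q := if i ∈ c then M i else 1

/-- Also valid for `i ∉ c`, where it splits the product over `c` at `i`; `ascProd_insert_max` uses
it that way. -/
theorem prod_map_sort_erase (c : Finset (Fin r)) (M : Fin r → Q) (i : Fin r) :
    ((c.erase i).sort.map M).prod =
      prefixProd (factors c M) i * suffixProd (factors c M) (i + 1) := by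
  rw [prod_map_sort, ← prefixProd_mul_suffixProd _ (i : ℕ), suffixProd_eq_mul]
  rw [if_neg (by simp), one_mul]
  congr 1
  · refine prefixProd_congr fun j hj => ?_
    have : j ≠ i := fun h => by subst h; exact lt_irrefl _ hj
    simp [factors, this]
  · refine suffixProd_congr fun j hj => ?_
    have : j ≠ i := fun h => by subst h; omega
    simp [factors, this]

theorem prod_map_sort_insert (c : Finset (Fin r)) (M : Fin r → Q) (i : Fin r) :
    ((insert i c).sort.map M).prod =
      prefixProd (factors c M) i * (M i * suffixProd (factors c M) (i + 1)) := by
  rw [prod_map_sort, ← prefixProd_mul_suffixProd _ (i : ℕ), suffixProd_eq_mul]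
  rw [if_pos (by simp)]
  congr 1
  · refine prefixProd_congr fun j hj => ?_
    have : j ≠ i := fun h => by subst h; exact lt_irrefl _ hj
    simp [factors, this]
  · congr 1
    refine suffixProd_congr fun j hj => ?_
    have : j ≠ i := fun h => by subst h; omega
    simp [factors, this]

end OrderedProducts

/-! ### Telescoping formulas for ordered products of odd operators. -/

section Telescope

variable {ι B : Type*} [Fintype ι] [DecidableEq ι] [CommRing B] {r : ℕ}

theorem ascProd_empty (M : Fin r → Matrix ι ι B) : ascProd ∅ M = 1 := by simp [ascProd]

theorem descProd_empty (M : Fin r → Matrix ι ι B) : descProd ∅ M = 1 := by simp [descProd]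

theorem ascProd_univ (M : Fin r → Matrix ι ι B) : ascProd Finset.univ M = (List.ofFn M).prod := by
  simp [ascProd, prod_map_sort]

/-- Transposition reverses products, so results on descending products are read off from ascending
ones. -/
theorem descProd_eq_transpose (c : Finset (Fin r)) (M : Fin r → Matrix ι ι B) :
    descProd c M = (ascProd c fun i => (M i).transpose).transpose := by
  rw [descProd, ascProd, Matrix.transpose_list_prod, List.map_map]
  simp [Function.comp_def]

theorem filter_lt_succ_of_mem {c : Finset (Fin r)} {i : Fin r} (hi : i ∈ c) :
    (c.filter fun j : Fin r => (j : ℕ) < i + 1).card = (c.filter (· < i)).card + 1 := by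
  have : (c.filter fun j : Fin r => (j : ℕ) < i + 1) = insert i (c.filter (· < i)) := by
    ext j
    simp only [Finset.mem_filter, Finset.mem_insert, Fin.lt_def, Fin.ext_iff]
    constructor
    · rintro ⟨h1, h2⟩
      by_cases h : (j : ℕ) = i
      · exact Or.inl h
      · exact Or.inr ⟨h1, by omega⟩
    · rintro (h | ⟨h1, h2⟩)
      · exact ⟨by rwa [Fin.ext h], by omega⟩
      · exact ⟨h1, by omega⟩
  rw [this, Finset.card_insert_of_notMem (by simp)]

theorem filter_lt_succ_of_notMem {c : Finset (Fin r)} {i : Fin r} (hi : i ∉ c) :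
    (c.filter fun j : Fin r => (j : ℕ) < i + 1).card = (c.filter (· < i)).card := by
  congr 1
  ext j
  simp only [Finset.mem_filter, Fin.lt_def]
  refine and_congr_right fun hj => ?_
  have : (j : ℕ) ≠ i := fun h => hi (by rwa [← Fin.ext h])
  omega

/-- The graded commutator of an ordered product with a sequence of odd operators. -/
theorem ascProd_telescope (D : ℕ → Matrix ι ι B) (T : Fin r → Matrix ι ι B) (w u : Fin r → B)
    (hw : ∀ i : Fin r, D i * T i + T i * D (i + 1) = w i • (1 : Matrix ι ι B))
    (hu : ∀ i : Fin r, D i - D (i + 1) = u i • T i) (c : Finset (Fin r)) :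
    D 0 * ascProd c T - (-1 : B) ^ c.card • (ascProd c T * D r) =
      ∑ i, koszulSign B i c •
        if i ∈ c then w i • ascProd (c.erase i) T else u i • ascProd (insert i c) T := by
  set G := factors c T with hG
  -- `Y t` is the product with `D t` inserted before the `t`-th factor, signed by the number of
  -- genuine factors it has passed. The two ends of the claim are `Y 0` and `Y r`.
  let Y : ℕ → Matrix ι ι B := fun t =>
    (-1 : B) ^ (c.filter fun j : Fin r => (j : ℕ) < t).card • (prefixProd G t * D t * suffixProd G t)
  have hc : ascProd c T = (List.ofFn G).prod := prod_map_sort c T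
  have h0 : Y 0 = D 0 * ascProd c T := by
    simp only [Y, prefixProd_zero, suffixProd_zero, hc]
    simp
  have hr : Y r = (-1 : B) ^ c.card • (ascProd c T * D r) := by
    simp only [Y, prefixProd_self, suffixProd_self, hc]
    rw [Finset.filter_true_of_mem fun j _ => j.2]
    simp
  rw [← h0, ← hr, ← Finset.sum_range_sub' Y r, Finset.sum_range]
  refine Finset.sum_congr rfl fun i _ => ?_
  simp only [Y]
  rw [prefixProd_succ, suffixProd_eq_mul]
  have hk : (c.filter fun j : Fin r => (j : ℕ) < i) = c.filter (· < i) := by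
    ext j; simp only [Finset.mem_filter, Fin.lt_def]
  rw [hk]
  -- If `i ∈ c`, the sign flips between `Y i` and `Y (i + 1)`, and the difference is an
  -- anticommutator at position `i`, hence a scalar. If `i ∉ c`, the sign is constant, and `D i - D
  -- (i + 1)` puts the missing factor `T i` into the gap.
  by_cases hi : i ∈ c
  · rw [if_pos hi, filter_lt_succ_of_mem hi, pow_succ, mul_neg_one, neg_smul, sub_neg_eq_add,
      ← smul_add]
    have hGi : G i = T i := by simp [hG, factors, hi]
    change _ = koszulSign B i c • w i • ((c.erase i).sort.map T).prod
    rw [prod_map_sort_erase, ← hG, hGi, koszulSign]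
    congr 1
    have : prefixProd G i * D i * (T i * suffixProd G (i + 1)) +
        prefixProd G i * T i * D (i + 1) * suffixProd G (i + 1) =
        prefixProd G i * (D i * T i + T i * D (i + 1)) * suffixProd G (i + 1) := by
      noncomm_ring
    rw [this, hw]
    simp
  · rw [if_neg hi, filter_lt_succ_of_notMem hi, ← smul_sub]
    have hGi : G i = 1 := by simp [hG, factors, hi]
    change _ = koszulSign B i c • u i • ((insert i c).sort.map T).prod
    rw [prod_map_sort_insert, ← hG, hGi, koszulSign]
    congr 1
    have : prefixProd G i * D i * (1 * suffixProd G (i + 1)) -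
        prefixProd G i * 1 * D (i + 1) * suffixProd G (i + 1) =
        prefixProd G i * (D i - D (i + 1)) * suffixProd G (i + 1) := by
      noncomm_ring
    rw [this, hu]
    simp [Matrix.mul_assoc]

theorem descProd_telescope (D : ℕ → Matrix ι ι B) (T : Fin r → Matrix ι ι B) (w u : Fin r → B)
    (hw : ∀ i : Fin r, D (i + 1) * T i + T i * D i = w i • (1 : Matrix ι ι B))
    (hu : ∀ i : Fin r, D i - D (i + 1) = u i • T i) (c : Finset (Fin r)) :
    descProd c T * D 0 - (-1 : B) ^ c.card • (D r * descProd c T) =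
      ∑ i, koszulSign B i c •
        if i ∈ c then w i • descProd (c.erase i) T else u i • descProd (insert i c) T := by
  have h := ascProd_telescope (fun t => (D t).transpose) (fun i => (T i).transpose) w u
    (fun i => by
      rw [← Matrix.transpose_mul, ← Matrix.transpose_mul, ← Matrix.transpose_add, add_comm, hw]
      simp)
    (fun i => by rw [← Matrix.transpose_sub, hu, Matrix.transpose_smul]) c
  have h2 := congrArg Matrix.transpose h
  simp only [Matrix.transpose_sub, Matrix.transpose_smul, Matrix.transpose_mul,
    Matrix.transpose_transpose, Matrix.transpose_sum, ← descProd_eq_transpose, apply_ite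
    Matrix.transpose] at h2
  exact h2

theorem HasParity.list_prod {par : ι → ZMod 2} (l : List (Matrix ι ι B))
    (h : ∀ M ∈ l, HasParity par 1 M) : HasParity par l.length l.prod := by
  induction l with
  | nil => simpa using HasParity.one
  | cons a l ih =>
    rw [List.prod_cons, List.length_cons]
    exact ((h a (by simp)).mul (ih fun M hM => h M (by simp [hM]))).cast (by push_cast; ring)

theorem HasParity.ascProd {par : ι → ZMod 2} {T : Fin r → Matrix ι ι B}
    (h : ∀ i, HasParity par 1 (T i)) (c : Finset (Fin r)) :
    HasParity par c.card (LG.ascProd c T) := by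
  have := HasParity.list_prod (par := par) (c.sort.map T) (by simp; exact fun i _ => h i)
  simpa [LG.ascProd] using this

theorem HasParity.descProd {par : ι → ZMod 2} {T : Fin r → Matrix ι ι B}
    (h : ∀ i, HasParity par 1 (T i)) (c : Finset (Fin r)) :
    HasParity par c.card (LG.descProd c T) := by
  have := HasParity.list_prod (par := par) (c.sort.reverse.map T) (by simp; exact fun i _ => h i)
  simpa [LG.descProd] using this

end Telescope

/-! ### Rules for divided differences -/

section DiffQuotRules

variable {k σ B : Type*} [CommRing k] [Fintype σ] [DecidableEq σ] [CommRing B] [Algebra k B]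

theorem diffQuot_monomial (p : σ → B) (a : σ) (u v : B) (s : σ →₀ ℕ) (c : k) :
    diffQuot p a u v (monomial s c) =
      algebraMap k B c * ((∑ r ∈ Finset.range (s a), u ^ r * v ^ (s a - 1 - r)) *
        ∏ i ∈ Finset.univ.erase a, p i ^ s i) := by
  have h := (basisMonomials σ k).constr_basis k (fun s : σ →₀ ℕ =>
    (∑ r ∈ Finset.range (s a), u ^ r * v ^ (s a - 1 - r)) *
      ∏ c ∈ Finset.univ.erase a, p c ^ s c) s
  rw [coe_basisMonomials] at h
  rw [show monomial s c = c • monomial s (1 : k) by rw [smul_monomial]; simp, map_smul,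
    Algebra.smul_def]
  congr 1

theorem aeval_update_monomial (p : σ → B) (a : σ) (u : B) (s : σ →₀ ℕ) (c : k) :
    aeval (Function.update p a u) (monomial s c) =
      algebraMap k B c * (u ^ s a * ∏ i ∈ Finset.univ.erase a, p i ^ s i) := by
  rw [aeval_monomial, Finsupp.prod_fintype _ _ (fun i => pow_zero _),
    ← Finset.mul_prod_erase _ _ (Finset.mem_univ a), Function.update_self]
  congr 2
  refine Finset.prod_congr rfl fun c hc => ?_
  rw [Function.update_of_ne (Finset.ne_of_mem_erase hc)]

/-- The Leibniz rule for divided differences on powers of one variable. The general rule is reduced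
to it because `u - v` may be a zero divisor, so that `sub_mul_diffQuot` does not determine the
divided difference. -/
theorem geom_sum_add (u v : B) (s t : ℕ) :
    ∑ r ∈ Finset.range (s + t), u ^ r * v ^ (s + t - 1 - r) =
      u ^ s * (∑ r ∈ Finset.range t, u ^ r * v ^ (t - 1 - r)) +
        (∑ r ∈ Finset.range s, u ^ r * v ^ (s - 1 - r)) * v ^ t := by
  rw [Finset.sum_range_add, add_comm, Finset.mul_sum, Finset.sum_mul]
  congr 1
  · refine Finset.sum_congr rfl fun r hr => ?_
    rw [pow_add, mul_assoc]
    congr 3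
    omega
  · refine Finset.sum_congr rfl fun r hr => ?_
    rw [mul_assoc, ← pow_add]
    congr 2
    have := Finset.mem_range.1 hr
    omega

theorem diffQuot_mul (p : σ → B) (a : σ) (u v : B) (f g : MvPolynomial σ k) :
    diffQuot p a u v (f * g) =
      aeval (Function.update p a u) f * diffQuot p a u v g +
        diffQuot p a u v f * aeval (Function.update p a v) g := by
  induction f using MvPolynomial.induction_on' with
  | add f f' hf hf' => rw [add_mul, map_add, hf, hf', map_add, map_add]; ring
  | monomial s c =>
    induction g using MvPolynomial.induction_on' with
    | add g g' hg hg' => rw [mul_add, map_add, hg, hg', map_add, map_add]; ring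
    | monomial t c' =>
      rw [monomial_mul, diffQuot_monomial, diffQuot_monomial, diffQuot_monomial,
        aeval_update_monomial, aeval_update_monomial, Finsupp.add_apply, geom_sum_add, map_mul]
      simp only [Finsupp.add_apply, pow_add, Finset.prod_mul_distrib]
      ring

/-- Both forms of the Leibniz rule occur: ascending products need $D_iT_i+T_iD_{i+1}$, descending
ones $D_{i+1}T_i+T_iD_i$. -/
theorem diffQuot_mul' (p : σ → B) (a : σ) (u v : B) (f g : MvPolynomial σ k) :
    diffQuot p a u v (f * g) =
      aeval (Function.update p a v) f * diffQuot p a u v g +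
        diffQuot p a u v f * aeval (Function.update p a u) g := by
  rw [mul_comm f, diffQuot_mul]; ring

theorem map_diffQuot {B' : Type*} [CommRing B'] [Algebra k B'] (φ : B →ₐ[k] B') (p : σ → B) (a : σ)
    (u v : B) (f : MvPolynomial σ k) :
    φ (diffQuot p a u v f) = diffQuot (fun i => φ (p i)) a (φ u) (φ v) f := by
  induction f using MvPolynomial.induction_on' with
  | add f f' hf hf' => rw [map_add, map_add, map_add, hf, hf']
  | monomial s c =>
    simp [diffQuot_monomial]

theorem diffQuot_X_self (p : σ → B) (a : σ) (u v : B) :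
    diffQuot p a u v (X a : MvPolynomial σ k) = 1 := by
  rw [X, diffQuot_monomial]
  simp only [Finsupp.single_eq_same, map_one]
  rw [Finset.prod_eq_one]
  · simp
  · intro i hi
    rw [Finsupp.single_eq_of_ne (Finset.ne_of_mem_erase hi), pow_zero]

theorem diffQuot_X_of_ne (p : σ → B) {a c : σ} (h : c ≠ a) (u v : B) :
    diffQuot p a u v (X c : MvPolynomial σ k) = 0 := by
  rw [X, diffQuot_monomial, Finsupp.single_eq_of_ne h.symm]
  simp

theorem diffQuot_C (p : σ → B) (a : σ) (u v : B) (c : k) :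
    diffQuot p a u v (C c : MvPolynomial σ k) = 0 := by
  rw [C_apply, diffQuot_monomial]
  simp

section Sum

variable {τ : Type*} [Fintype τ] [DecidableEq τ]

theorem diffQuot_inr_rename_inl (p : σ ⊕ τ → B) (a : τ) (u v : B) (f : MvPolynomial σ k) :
    diffQuot p (Sum.inr a) u v (rename Sum.inl f) = 0 := by
  induction f using MvPolynomial.induction_on' with
  | add f f' hf hf' => rw [map_add, map_add, hf, hf', add_zero]
  | monomial s c =>
    rw [rename_monomial, diffQuot_monomial, Finsupp.mapDomain_of_notMem_range _ _ (by simp)]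
    simp

theorem diffQuot_inl_rename_inr (p : σ ⊕ τ → B) (a : σ) (u v : B) (f : MvPolynomial τ k) :
    diffQuot p (Sum.inl a) u v (rename Sum.inr f) = 0 := by
  induction f using MvPolynomial.induction_on' with
  | add f f' hf hf' => rw [map_add, map_add, hf, hf', add_zero]
  | monomial s c =>
    rw [rename_monomial, diffQuot_monomial, Finsupp.mapDomain_of_notMem_range _ _ (by simp)]
    simp

theorem diffQuot_rename {f : MvPolynomial σ k} (e : σ → τ) (he : Function.Injective e)
    (p : τ → B) (a : σ) (u v : B) :
    diffQuot p (e a) u v (rename e f) = diffQuot (p ∘ e) a u v f := by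
  induction f using MvPolynomial.induction_on' with
  | add f f' hf hf' => rw [map_add, map_add, map_add, hf, hf']
  | monomial s c =>
    rw [rename_monomial, diffQuot_monomial, diffQuot_monomial, Finsupp.mapDomain_apply he]
    congr 2
    rw [← Finset.prod_subset
        (show (Finset.univ.erase a).image e ⊆ Finset.univ.erase (e a) from ?_),
      Finset.prod_image he.injOn]
    · refine Finset.prod_congr rfl fun i _ => ?_
      rw [Finsupp.mapDomain_apply he]; rfl
    · intro j hj hj'
      rw [Finsupp.mapDomain_of_notMem_range, pow_zero]
      rintro ⟨i, rfl⟩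
      refine hj' (Finset.mem_image_of_mem _ (Finset.mem_erase.2 ⟨fun h => ?_, Finset.mem_univ _⟩))
      subst h
      simp at hj
    · intro j hj
      obtain ⟨i, hi, rfl⟩ := Finset.mem_image.1 hj
      exact Finset.mem_erase.2 ⟨fun h => (Finset.ne_of_mem_erase hi) (he h), Finset.mem_univ _⟩

end Sum

end DiffQuotRules

/-! ### The sequence of operators interpolating between `d_X(x)` and `d_X(x')` -/

section Interpolation

/-- The point `(x'₁, …, x'_t, x_{t+1}, …, xₙ)`. -/
def mixed {B : Type*} {n : ℕ} (x x' : Fin n → B) (t : ℕ) : Fin n → B :=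
  fun j => if (j : ℕ) < t then x' j else x j

section Mixed

variable {B : Type*} {n : ℕ} (x x' : Fin n → B)

theorem mixed_zero : mixed x x' 0 = x := by ext j; simp [mixed]

theorem mixed_self : mixed x x' n = x' := by ext j; simp [mixed]

theorem hybrid_eq_mixed (i : Fin n) : hybrid x x' i = mixed x x' i := rfl

theorem update_mixed_left (i : Fin n) : Function.update (mixed x x' i) i (x i) = mixed x x' i := by
  refine Function.update_eq_self_iff.2 ?_
  simp [mixed]

theorem update_mixed_right (i : Fin n) :
    Function.update (mixed x x' i) i (x' i) = mixed x x' (i + 1) := by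
  ext j
  by_cases h : j = i
  · subst h; simp [mixed]
  · have : (j : ℕ) ≠ i := fun h' => h (Fin.ext h')
    rw [Function.update_of_ne h]
    simp only [mixed]
    congr 1
    simp; omega

end Mixed

variable {k : Type*} [CommRing k] {n m : ℕ} {ι : Type*} [Fintype ι] [DecidableEq ι]
  {B : Type*} [CommRing B] [Algebra k B]

/-- The matrix `d_X` with the coordinates `z, x`. -/
noncomputable def evalD (X : Based ι (ZX k m n)) (z : Fin m → B) (x : Fin n → B) : Matrix ι ι B :=
  X.D.map (aeval (Sum.elim z x))

variable {X : Based ι (ZX k m n)} {W : MvPolynomial (Fin n) k} {V : MvPolynomial (Fin m) k}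

theorem hasParity_evalD (hX : X.IsFactorisation (difference W V)) (z : Fin m → B) (x : Fin n → B) :
    HasParity X.par 1 (evalD X z x) :=
  HasParity.map _ (map_zero _) hX.odd

theorem hasParity_diffX (hX : X.IsFactorisation (difference W V)) (z : Fin m → B)
    (x x' : Fin n → B) (i : Fin n) : HasParity X.par 1 (diffX X z x x' i) :=
  HasParity.map _ (map_zero _) hX.odd

theorem hasParity_diffZ (hX : X.IsFactorisation (difference W V)) (z z' : Fin m → B)
    (x : Fin n → B) (i : Fin m) : HasParity X.par 1 (diffZ X z z' x i) :=
  HasParity.map _ (map_zero _) hX.odd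

theorem evalD_mul_evalD (hX : X.IsFactorisation (difference W V)) (z : Fin m → B)
    (x : Fin n → B) :
    evalD X z x * evalD X z x = (aeval z V - aeval x W) • (1 : Matrix ι ι B) := by
  have h := congrArg (fun M => M.map (aeval (Sum.elim z x) : ZX k m n →ₐ[k] B)) hX.sq
  simp only [Matrix.map_mul] at h
  rw [evalD, h]
  ext i j
  rw [Matrix.map_apply, Matrix.smul_apply, Matrix.smul_apply, smul_eq_mul, smul_eq_mul, map_mul,
    difference, map_sub, aeval_rename, aeval_rename, Sum.elim_comp_inl, Sum.elim_comp_inr,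
    Matrix.one_apply, Matrix.one_apply]
  split_ifs <;> simp

theorem map_diffQuot_mul {σ : Type*} [Fintype σ] [DecidableEq σ] (p : σ → B) (a : σ) (u v : B)
    (M N : Matrix ι ι (MvPolynomial σ k)) :
    (M * N).map (diffQuot p a u v) =
      M.map (aeval (Function.update p a u)) * N.map (diffQuot p a u v) +
        M.map (diffQuot p a u v) * N.map (aeval (Function.update p a v)) := by
  ext i j
  simp [Matrix.mul_apply, map_sum, diffQuot_mul, Finset.sum_add_distrib]

theorem map_diffQuot_mul' {σ : Type*} [Fintype σ] [DecidableEq σ] (p : σ → B) (a : σ) (u v : B)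
    (M N : Matrix ι ι (MvPolynomial σ k)) :
    (M * N).map (diffQuot p a u v) =
      M.map (aeval (Function.update p a v)) * N.map (diffQuot p a u v) +
        M.map (diffQuot p a u v) * N.map (aeval (Function.update p a u)) := by
  ext i j
  simp [Matrix.mul_apply, map_sum, diffQuot_mul', Finset.sum_add_distrib]

theorem map_diffQuot_smul_one {σ : Type*} [Fintype σ] [DecidableEq σ] (p : σ → B) (a : σ) (u v : B)
    (f : MvPolynomial σ k) :
    (f • (1 : Matrix ι ι (MvPolynomial σ k))).map (diffQuot p a u v) =
      diffQuot p a u v f • (1 : Matrix ι ι B) := by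
  ext i j
  simp only [Matrix.map_apply, Matrix.smul_apply, Matrix.one_apply]
  split_ifs <;> simp

section X

variable (z : Fin m → B) (x x' : Fin n → B)

theorem evalD_sub_evalD_x (X : Based ι (ZX k m n)) (i : Fin n) :
    evalD X z (mixed x x' i) - evalD X z (mixed x x' (i + 1)) =
      (x i - x' i) • diffX X z x x' i := by
  ext a b
  simp only [evalD, diffX, Matrix.sub_apply, Matrix.map_apply, Matrix.smul_apply, smul_eq_mul,
    sub_mul_diffQuot, Sum.update_elim_inr, hybrid_eq_mixed, update_mixed_left, update_mixed_right]

theorem diffX_D_aux (hX : X.IsFactorisation (difference W V)) (i : Fin n) :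
    (X.D * X.D).map (diffQuot (Sum.elim z (hybrid x x' i)) (Sum.inr i) (x i) (x' i)) =
      (-diffQuot (hybrid x x' i) i (x i) (x' i) W) • (1 : Matrix ι ι B) := by
  rw [hX.sq, map_diffQuot_smul_one, difference, map_sub, diffQuot_inr_rename_inl, zero_sub,
    diffQuot_rename _ Sum.inr_injective, Sum.elim_comp_inr]

/-- The divided difference of $d_X^2=V-W$ in $x_i$, expanded by the Leibniz rule; $V$ does not
involve $x_i$ and drops out. -/
theorem evalD_mul_diffX (hX : X.IsFactorisation (difference W V)) (i : Fin n) :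
    evalD X z (mixed x x' i) * diffX X z x x' i + diffX X z x x' i * evalD X z (mixed x x' (i + 1)) =
      (-diffQuot (hybrid x x' i) i (x i) (x' i) W) • (1 : Matrix ι ι B) := by
  rw [← diffX_D_aux z x x' hX, map_diffQuot_mul, Sum.update_elim_inr, Sum.update_elim_inr, hybrid_eq_mixed,
    update_mixed_left, update_mixed_right]
  rfl

theorem evalD_succ_mul_diffX (hX : X.IsFactorisation (difference W V)) (i : Fin n) :
    evalD X z (mixed x x' (i + 1)) * diffX X z x x' i + diffX X z x x' i * evalD X z (mixed x x' i) =
      (-diffQuot (hybrid x x' i) i (x i) (x' i) W) • (1 : Matrix ι ι B) := by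
  rw [← diffX_D_aux z x x' hX, map_diffQuot_mul', Sum.update_elim_inr, Sum.update_elim_inr, hybrid_eq_mixed,
    update_mixed_left, update_mixed_right]
  rfl

end X

section Z

variable (z z' : Fin m → B) (x : Fin n → B)

theorem evalD_sub_evalD_z (X : Based ι (ZX k m n)) (i : Fin m) :
    evalD X (mixed z z' i) x - evalD X (mixed z z' (i + 1)) x =
      (z i - z' i) • diffZ X z z' x i := by
  ext a b
  simp only [evalD, diffZ, Matrix.sub_apply, Matrix.map_apply, Matrix.smul_apply, smul_eq_mul,
    sub_mul_diffQuot, Sum.update_elim_inl, hybrid_eq_mixed, update_mixed_left, update_mixed_right]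

theorem evalD_succ_mul_diffZ (hX : X.IsFactorisation (difference W V)) (i : Fin m) :
    evalD X (mixed z z' (i + 1)) x * diffZ X z z' x i + diffZ X z z' x i * evalD X (mixed z z' i) x =
      diffQuot (hybrid z z' i) i (z i) (z' i) V • (1 : Matrix ι ι B) := by
  have : (X.D * X.D).map (diffQuot (Sum.elim (hybrid z z' i) x) (Sum.inl i) (z i) (z' i)) =
      diffQuot (hybrid z z' i) i (z i) (z' i) V • (1 : Matrix ι ι B) := by
    rw [hX.sq, map_diffQuot_smul_one, difference, map_sub, diffQuot_inl_rename_inr, sub_zero,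
      diffQuot_rename _ Sum.inl_injective, Sum.elim_comp_inl]
  rw [← this, map_diffQuot_mul', Sum.update_elim_inl, Sum.update_elim_inl, hybrid_eq_mixed,
    update_mixed_left, update_mixed_right]
  rfl

end Z

end Interpolation

/-! ### The differentials of the unit and of tensor products -/

section Differentials

variable {n : ℕ} {B : Type*} [CommRing B]

theorem koszulSign_erase (i : Fin n) (c : Finset (Fin n)) :
    koszulSign B i (c.erase i) = koszulSign B i c := by
  unfold koszulSign
  congr 2
  ext j
  simp only [Finset.mem_filter, Finset.mem_erase]
  exact ⟨fun h => ⟨h.1.2, h.2⟩, fun h => ⟨⟨h.2.ne, h.1⟩, h.2⟩⟩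

theorem koszulSign_insert (i : Fin n) (c : Finset (Fin n)) :
    koszulSign B i (insert i c) = koszulSign B i c := by
  rw [← koszulSign_erase i (insert i c), ← koszulSign_erase i c, Finset.erase_insert_eq_erase]

theorem koszulSign_mul_self (i : Fin n) (c : Finset (Fin n)) :
    koszulSign B i c * koszulSign B i c = 1 := by
  unfold koszulSign
  rw [← pow_add, ← two_mul, pow_mul]; simp

theorem wedge_mulVec (i : Fin n) (f : Finset (Fin n) → B) (b : Finset (Fin n)) :
    (wedge B i).mulVec f b = if i ∈ b then koszulSign B i b * f (b.erase i) else 0 := by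
  rw [Matrix.mulVec, dotProduct]
  simp only [wedge, Matrix.of_apply, ite_mul, zero_mul]
  split_ifs with h
  · rw [Finset.sum_eq_single (b.erase i)]
    · rw [if_pos ⟨by simp, by rw [Finset.insert_erase h]⟩, koszulSign_erase]
    · rintro c - hc
      refine if_neg ?_
      rintro ⟨h1, rfl⟩
      exact hc (by rw [Finset.erase_insert h1])
    · simp
  · refine Finset.sum_eq_zero fun c _ => if_neg ?_
    rintro ⟨h1, rfl⟩
    exact h (by simp)

theorem contract_mulVec (i : Fin n) (f : Finset (Fin n) → B) (b : Finset (Fin n)) :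
    (contract B i).mulVec f b = if i ∈ b then 0 else koszulSign B i b * f (insert i b) := by
  rw [Matrix.mulVec, dotProduct]
  simp only [contract, Matrix.of_apply, ite_mul, zero_mul]
  split_ifs with h
  · refine Finset.sum_eq_zero fun c _ => if_neg ?_
    rintro ⟨h1, rfl⟩
    exact absurd h (by simp)
  · rw [Finset.sum_eq_single (insert i b)]
    · rw [if_pos ⟨by simp, by rw [Finset.erase_insert h]⟩, koszulSign_insert]
    · rintro c - hc
      refine if_neg ?_
      rintro ⟨h1, rfl⟩
      exact hc (by rw [Finset.insert_erase h1])
    · simp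

theorem unitAt_mulVec {k : Type*} [CommRing k] [Algebra k B] (W : MvPolynomial (Fin n) k)
    (x x' : Fin n → B) (f : Finset (Fin n) → B) (b : Finset (Fin n)) :
    (unitAt W x x').D.mulVec f b = ∑ i, koszulSign B i b *
      if i ∈ b then diffQuot (hybrid x x' i) i (x i) (x' i) W * f (b.erase i)
      else (x i - x' i) * f (insert i b) := by
  rw [unitAt, Matrix.sum_mulVec, Finset.sum_apply]
  refine Finset.sum_congr rfl fun i _ => ?_
  rw [Matrix.add_mulVec, Matrix.smul_mulVec, Matrix.smul_mulVec, Pi.add_apply, Pi.smul_apply,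
    Pi.smul_apply, wedge_mulVec, contract_mulVec]
  split_ifs <;> simp [smul_eq_mul] <;> ring

theorem tensor_mulVec {κ κ' : Type*} [Fintype κ] [Fintype κ'] [DecidableEq κ] [DecidableEq κ']
    (M : Based κ B) (N : Based κ' B) (v : κ × κ' → B) (i : κ) (b : κ') :
    (M.tensor N).D.mulVec v (i, b) =
      M.D.mulVec (fun j => v (j, b)) i + sgn B (M.par i) * N.D.mulVec (fun c => v (i, c)) b := by
  simp only [Based.tensor, Matrix.add_mulVec, Pi.add_apply]
  congr 1
  · simp only [Matrix.mulVec, dotProduct, Fintype.sum_prod_type, Matrix.kronecker_apply]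
    refine Finset.sum_congr rfl fun j _ => ?_
    rw [Finset.sum_eq_single b]
    · simp
    · intro c _ hc; simp [hc.symm]
    · simp
  · simp only [Matrix.mulVec, dotProduct, Fintype.sum_prod_type, Matrix.kronecker_apply]
    rw [Finset.sum_eq_single i]
    · rw [Finset.mul_sum]
      refine Finset.sum_congr rfl fun j _ => ?_
      rw [Matrix.diagonal_apply_eq, mul_assoc]
    · intro c _ hc; simp [Matrix.diagonal_apply_ne _ hc.symm]
    · simp

theorem ofMatrix_apply {A κ κ' : Type*} [CommRing A] [Algebra A B] [Fintype κ]
    (M : Matrix κ' κ B) (v : κ → A) :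
    ofMatrix A M v = M.mulVec fun i => algebraMap A B (v i) := rfl

theorem hasDegree_ofMatrix {A κ κ' : Type*} [CommRing A] [Algebra A B] [Fintype κ] [Fintype κ']
    (M : Based κ A) (N : Based κ' B) (g : ZMod 2) (P : Matrix κ' κ B)
    (h : ∀ p i, P p i ≠ 0 → N.par p = M.par i + g) : HasDegree M N g (ofMatrix A P) := by
  intro e v hv p hp
  rw [ofMatrix_apply, Matrix.mulVec, dotProduct] at hp
  obtain ⟨i, -, hi⟩ := Finset.exists_ne_zero_of_sum_ne_zero hp
  rw [h p i (left_ne_zero_of_mul hi), hv i]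
  intro h0
  exact right_ne_zero_of_mul hi (by rw [h0, map_zero])

end Differentials

/-- The products `M_{b₁} ⋯ M_{b_l}` with the signs of `ρ⁻¹`. -/
def signedAscProd {ι B : Type*} [Fintype ι] [DecidableEq ι] [CommRing B] {r : ℕ} (par : ι → ZMod 2)
    (T : Fin r → Matrix ι ι B) (c : Finset (Fin r)) : Matrix ι ι B :=
  (-1 : B) ^ c.card.choose 2 • (ascProd c T * sgnMat B par ^ c.card)

/-! ### The telescoping formula with the signs of $\rho^{-1}$. -/

section SignedAscProd

variable {ι B : Type*} [Fintype ι] [DecidableEq ι] [CommRing B] {r : ℕ} {par : ι → ZMod 2}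
  {T : Fin r → Matrix ι ι B}

theorem HasParity.sgnMat_pow_mul {M : Matrix ι ι B} (hM : HasParity par 1 M) (l : ℕ) :
    LG.sgnMat B par ^ l * M = (-1 : B) ^ l • (M * LG.sgnMat B par ^ l) := by
  induction l with
  | zero => simp
  | succ l ih =>
    rw [pow_succ', Matrix.mul_assoc, ih, Matrix.mul_smul, ← Matrix.mul_assoc,
      hM.sgnMat_mul, sgn_one, Matrix.smul_mul, smul_smul, pow_succ, Matrix.mul_assoc]

/-- This is where the sign $\binom l2$ comes from: moving the grading operator past $l$ odd factors
costs $(-1)^l$, and $\binom{l+1}2=\binom l2+l$. -/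
theorem sgnMat_mul_signedAscProd_erase (hT : ∀ i, HasParity par 1 (T i)) {c : Finset (Fin r)}
    {i : Fin r} (hi : i ∈ c) :
    sgnMat B par * signedAscProd par T (c.erase i) =
      (-1 : B) ^ c.card.choose 2 • (ascProd (c.erase i) T * sgnMat B par ^ c.card) := by
  obtain ⟨l, hl⟩ : ∃ l, c.card = l + 1 := ⟨c.card - 1, by
    have := Finset.card_pos.2 ⟨i, hi⟩; omega⟩
  have hl' : (c.erase i).card = l := by rw [Finset.card_erase_of_mem hi, hl]; rfl
  have hp := ((HasParity.ascProd hT (c.erase i))).sgnMat_mul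
  rw [sgn_natCast, hl'] at hp
  rw [signedAscProd, hl', hl, Matrix.mul_smul, ← Matrix.mul_assoc, hp, Matrix.smul_mul,
    Matrix.mul_assoc _ (sgnMat B par), ← pow_succ', Nat.choose_succ_succ' l 1, Nat.choose_one_right,
    smul_smul]
  congr 1
  ring

theorem sgnMat_mul_signedAscProd_insert (hT : ∀ i, HasParity par 1 (T i)) {c : Finset (Fin r)}
    {i : Fin r} (hi : i ∉ c) :
    sgnMat B par * signedAscProd par T (insert i c) =
      -((-1 : B) ^ c.card.choose 2 • (ascProd (insert i c) T * sgnMat B par ^ c.card)) := by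
  have hl' : (insert i c).card = c.card + 1 := Finset.card_insert_of_notMem hi
  have hp := ((HasParity.ascProd hT (insert i c))).sgnMat_mul
  rw [sgn_natCast, hl'] at hp
  have hS : sgnMat B par * sgnMat B par ^ (c.card + 1) = sgnMat B par ^ c.card := by
    rw [pow_succ', sgnMat_mul_sgnMat_mul]
  rw [signedAscProd, hl', Matrix.mul_smul, ← Matrix.mul_assoc, hp, Matrix.smul_mul,
    Matrix.mul_assoc _ (sgnMat B par), hS, Nat.choose_succ_succ' c.card 1, Nat.choose_one_right,
    smul_smul, ← neg_smul]
  congr 1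
  have : ((-1 : B) ^ c.card) * (-1) ^ c.card = 1 := by
    rw [← pow_add, ← two_mul, pow_mul]; simp
  rw [pow_add, pow_succ (-1 : B) c.card]
  linear_combination (-(-1) ^ c.card.choose 2) * this

/-- The $\theta_c$-component of the statement that $\rho^{-1}$ commutes with the differentials. It
is `ascProd_telescope` after all grading operators have been moved to the right. -/
theorem signedAscProd_identity (D : ℕ → Matrix ι ι B) (w u : Fin r → B)
    (hD : HasParity par 1 (D r)) (hT : ∀ i, HasParity par 1 (T i))
    (hw : ∀ i : Fin r, D i * T i + T i * D (i + 1) = (-w i) • (1 : Matrix ι ι B))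
    (hu : ∀ i : Fin r, D i - D (i + 1) = u i • T i) (c : Finset (Fin r)) :
    D 0 * signedAscProd par T c + sgnMat B par * ∑ i, koszulSign B i c •
        (if i ∈ c then w i • signedAscProd par T (c.erase i)
          else u i • signedAscProd par T (insert i c)) =
      signedAscProd par T c * D r := by
  have key := ascProd_telescope D T _ u hw hu c
  have hsum : ∀ i, sgnMat B par * (koszulSign B i c • (if i ∈ c then
      w i • signedAscProd par T (c.erase i) else u i • signedAscProd par T (insert i c))) =
      -((-1 : B) ^ c.card.choose 2 • ((koszulSign B i c • (if i ∈ c then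
        (-w i) • ascProd (c.erase i) T else u i • ascProd (insert i c) T)) *
          sgnMat B par ^ c.card)) := by
    intro i
    rw [Matrix.mul_smul]
    split_ifs with hi
    · rw [Matrix.mul_smul, sgnMat_mul_signedAscProd_erase hT hi]
      simp only [Matrix.smul_mul, smul_smul, ← neg_smul]
      congr 1; ring
    · rw [Matrix.mul_smul, sgnMat_mul_signedAscProd_insert hT hi]
      simp only [Matrix.smul_mul, smul_smul, ← neg_smul]
      congr 1; ring
  rw [Matrix.mul_sum, Finset.sum_congr rfl fun i _ => hsum i, Finset.sum_neg_distrib,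
    ← Finset.smul_sum, ← Matrix.sum_mul, ← key, signedAscProd, Matrix.smul_mul,
    Matrix.mul_assoc _ _ (D r), hD.sgnMat_pow_mul, Matrix.mul_smul, Matrix.mul_smul, ← smul_neg,
    ← smul_add]
  congr 1
  rw [Matrix.sub_mul, Matrix.smul_mul]
  simp only [Matrix.mul_assoc]
  abel

end SignedAscProd

/-! ### The inverse of the right unit action -/

section RhoInv

variable {k : Type*} [CommRing k] {n m : ℕ} {ι : Type*} [Fintype ι] [DecidableEq ι]

theorem aeval_elim_C_C {A : Type*} [CommRing A] [Algebra (ZX k m n) A] [Algebra k A]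
    [IsScalarTower k (ZX k m n) A] (f : ZX k m n) :
    aeval (Sum.elim (fun j => algebraMap (ZX k m n) A (zVar k m n j))
      fun j => algebraMap (ZX k m n) A (xVar k m n j)) f = algebraMap (ZX k m n) A f := by
  have : aeval (Sum.elim (fun j => algebraMap (ZX k m n) A (zVar k m n j))
      fun j => algebraMap (ZX k m n) A (xVar k m n j)) = IsScalarTower.toAlgHom k (ZX k m n) A := by
    ext (j | j) <;> simp [zVar, xVar]
  rw [this]; rfl

variable (X : Based ι (ZX k m n)) {W : MvPolynomial (Fin n) k} {V : MvPolynomial (Fin m) k}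

/-- The coefficients of `ρ⁻¹`. -/
noncomputable def rhoInvCoeff (c : Finset (Fin n)) : Matrix ι ι (MvPolynomial (Fin n) (ZX k m n)) :=
  signedAscProd X.par (diffX X (fun j => C (zVar k m n j)) MvPolynomial.X
    fun j => C (xVar k m n j)) c

theorem rhoInv_apply (v : ι → ZX k m n) (i : ι) (c : Finset (Fin n)) :
    rhoInv X v (i, c) = (rhoInvCoeff X c).mulVec (fun j => C (v j)) i := by
  rw [rhoInv, ofMatrix_apply]
  simp only [Matrix.mulVec, dotProduct, Matrix.of_apply, rhoInvCoeff, signedAscProd, Matrix.smul_apply,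
    mul_sgnMat_pow_apply, smul_eq_mul, algebraMap_eq, pow_add, mul_assoc]

variable {X}

theorem rhoInvCoeff_identity (hX : X.IsFactorisation (difference W V)) (c : Finset (Fin n)) :
    evalD X (fun j => C (zVar k m n j)) MvPolynomial.X * rhoInvCoeff X c +
      sgnMat _ X.par * ∑ i, koszulSign (MvPolynomial (Fin n) (ZX k m n)) i c •
        (if i ∈ c then diffQuot (hybrid MvPolynomial.X (fun j => C (xVar k m n j)) i) i
            (MvPolynomial.X i) (C (xVar k m n i)) W • rhoInvCoeff X (c.erase i)
          else (MvPolynomial.X i - C (xVar k m n i)) • rhoInvCoeff X (insert i c)) =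
      rhoInvCoeff X c * evalD X (fun j => C (zVar k m n j)) fun j => C (xVar k m n j) := by
  have key := signedAscProd_identity (par := X.par)
    (fun t => evalD X (fun j => C (zVar k m n j))
      (mixed MvPolynomial.X (fun j => C (xVar k m n j)) t)) _ _
    (hasParity_evalD hX _ _) (hasParity_diffX hX _ _ _) (evalD_mul_diffX _ _ _ hX)
    (evalD_sub_evalD_x _ _ _ X) c
  simp only [mixed_zero, mixed_self] at key
  exact key

theorem isMorphism_rhoInv (hX : X.IsFactorisation (difference W V)) :
    IsMorphism X (tensorUnit W X) (rhoInv X) := by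
  constructor
  · refine hasDegree_ofMatrix _ _ _ _ fun p i h => ?_
    have h1 := (HasParity.ascProd (hasParity_diffX hX (fun j => C (zVar k m n j)) MvPolynomial.X
      fun j => C (xVar k m n j)) p.2) p.1 i (right_ne_zero_of_mul h)
    change X.par p.1 + (p.2.card : ZMod 2) = _
    rw [h1, add_zero, add_assoc, CharTwo.add_self_eq_zero, add_zero]
  · intro v
    ext1 ⟨i, c⟩
    have hv : (fun j => C (X.D.mulVec v j)) = (evalD X (fun j => C (zVar k m n j))
        fun j => C (xVar k m n j)).mulVec
          (fun j => (C (v j) : MvPolynomial (Fin n) (ZX k m n))) := by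
      ext1 j
      simp only [Matrix.mulVec, dotProduct, map_sum, map_mul, evalD, Matrix.map_apply]
      refine Finset.sum_congr rfl fun a _ => ?_
      congr 1
      exact (aeval_elim_C_C (A := MvPolynomial (Fin n) (ZX k m n)) (X.D j a)).symm
    have key := congrArg (fun M => M.mulVec
      (fun j => (C (v j) : MvPolynomial (Fin n) (ZX k m n))) i) (rhoInvCoeff_identity hX c)
    simp only [Matrix.add_mulVec, Pi.add_apply, ← Matrix.mulVec_mulVec] at key
    refine Eq.trans ?_ (key.trans ?_)
    · rw [tensorUnit, tensor_mulVec, unitAt_mulVec, sgnMat, Matrix.mulVec_diagonal,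
        Matrix.sum_mulVec, Finset.sum_apply]
      refine congrArg₂ (· + ·) ?_ (congrArg₂ (· * ·) rfl ?_)
      · refine congrArg (fun f => Matrix.mulVec _ f i) (funext fun j => ?_)
        exact rhoInv_apply X v j c
      · refine Finset.sum_congr rfl fun a _ => ?_
        rw [Matrix.smul_mulVec, Pi.smul_apply, smul_eq_mul]
        refine congrArg₂ (· * ·) rfl ?_
        split_ifs
        · rw [rhoInv_apply, Matrix.smul_mulVec, Pi.smul_apply, smul_eq_mul]
        · rw [rhoInv_apply, Matrix.smul_mulVec, Pi.smul_apply, smul_eq_mul]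
    · rw [rhoInv_apply, hv]

/-- Only $b=\emptyset$ survives the projection, and there the ordered product is empty; the equality
is therefore strict. -/
theorem rho_rhoInv (v : ι → ZX k m n) : rho k m n ι (rhoInv X v) = v := by
  ext1 i
  simp only [rho, LinearMap.pi_apply, LinearMap.comp_apply, LinearMap.proj_apply, rhoInv_apply]
  simp [rhoInvCoeff, signedAscProd, ascProd_empty]

end RhoInv

/-! ### Relations in the exterior algebra -/

section CAR

variable {n : ℕ} {B : Type*} [CommRing B]

theorem koszulSign_erase_of_mem {i j : Fin n} {b : Finset (Fin n)} (hj : j ∈ b) :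
    koszulSign B i (b.erase j) = if j < i then -koszulSign B i b else koszulSign B i b := by
  unfold koszulSign
  split_ifs with h
  · have hm : j ∈ b.filter (· < i) := by simp [hj, h]
    rw [Finset.filter_erase]
    have := Finset.card_erase_add_one hm
    rw [← this, pow_succ]
    ring
  · rw [Finset.filter_erase, Finset.erase_eq_of_notMem (by simp [h])]

theorem koszulSign_insert_of_notMem {i j : Fin n} {b : Finset (Fin n)} (hj : j ∉ b) :
    koszulSign B i (insert j b) = if j < i then -koszulSign B i b else koszulSign B i b := by
  have := koszulSign_erase_of_mem (B := B) (i := i) (Finset.mem_insert_self j b)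
  rw [Finset.erase_insert hj] at this
  rw [this]
  split_ifs <;> simp

/-- Gives the relations among contractions from those among the $\theta_i$. -/
theorem contract_eq_transpose (i : Fin n) : contract B i = (wedge B i).transpose := by
  ext b c
  simp only [contract, wedge, Matrix.transpose_apply, Matrix.of_apply]
  by_cases h : i ∈ c ∧ b = c.erase i
  · obtain ⟨h1, rfl⟩ := h
    rw [if_pos ⟨h1, rfl⟩, if_pos ⟨by simp, by rw [Finset.insert_erase h1]⟩, koszulSign_erase]
  · rw [if_neg h, if_neg]
    rintro ⟨h1, rfl⟩
    exact h ⟨by simp, by rw [Finset.erase_insert h1]⟩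

theorem wedge_mul_self (i : Fin n) : wedge B i * wedge B i = 0 := by
  refine Matrix.ext_of_mulVec_single fun c => funext fun b => ?_
  rw [← Matrix.mulVec_mulVec, wedge_mulVec, wedge_mulVec]
  simp

theorem wedge_mul_wedge {i j : Fin n} (h : i ≠ j) :
    wedge B i * wedge B j + wedge B j * wedge B i = 0 := by
  refine Matrix.ext_of_mulVec_single fun c => funext fun b => ?_
  rw [Matrix.add_mulVec, Pi.add_apply, ← Matrix.mulVec_mulVec, ← Matrix.mulVec_mulVec]
  simp only [wedge_mulVec, Finset.mem_erase, Matrix.zero_mulVec, Pi.zero_apply]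
  by_cases hi : i ∈ b
  · by_cases hj : j ∈ b
    · simp only [hi, hj, h, h.symm, if_true, ne_eq, not_false_eq_true, and_self,
        Finset.erase_right_comm (a := i) (b := j), koszulSign_erase_of_mem hi,
        koszulSign_erase_of_mem hj]
      rcases lt_or_gt_of_ne h with h' | h' <;> simp [h', h'.not_gt] <;> ring
    · simp [hi, hj]
  · simp [hi]

theorem contract_mul_self (i : Fin n) : contract B i * contract B i = 0 := by
  rw [contract_eq_transpose, ← Matrix.transpose_mul, wedge_mul_self, Matrix.transpose_zero]

theorem contract_mul_contract {i j : Fin n} (h : i ≠ j) :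
    contract B i * contract B j + contract B j * contract B i = 0 := by
  rw [contract_eq_transpose, contract_eq_transpose, ← Matrix.transpose_mul, ← Matrix.transpose_mul,
    ← Matrix.transpose_add, add_comm, wedge_mul_wedge h, Matrix.transpose_zero]

theorem wedge_mul_contract_self (i : Fin n) :
    wedge B i * contract B i + contract B i * wedge B i = 1 := by
  refine Matrix.ext_of_mulVec_single fun c => funext fun b => ?_
  rw [Matrix.add_mulVec, Pi.add_apply, ← Matrix.mulVec_mulVec, ← Matrix.mulVec_mulVec]
  simp only [wedge_mulVec, contract_mulVec, Matrix.one_mulVec]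
  by_cases hi : i ∈ b
  · simp only [hi, if_true, Finset.notMem_erase, if_false, koszulSign_erase,
      Finset.insert_erase hi, add_zero, ← mul_assoc, koszulSign_mul_self, one_mul]
  · simp only [hi, if_false, Finset.mem_insert_self, if_true, koszulSign_insert,
      Finset.erase_insert hi, zero_add, ← mul_assoc, koszulSign_mul_self, one_mul]

theorem wedge_mul_contract {i j : Fin n} (h : i ≠ j) :
    wedge B i * contract B j + contract B j * wedge B i = 0 := by
  refine Matrix.ext_of_mulVec_single fun c => funext fun b => ?_
  rw [Matrix.add_mulVec, Pi.add_apply, ← Matrix.mulVec_mulVec, ← Matrix.mulVec_mulVec]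
  simp only [wedge_mulVec, contract_mulVec, Finset.mem_erase, Finset.mem_insert,
    Matrix.zero_mulVec, Pi.zero_apply]
  by_cases hi : i ∈ b
  · by_cases hj : j ∈ b
    · simp [hi, hj, h.symm]
    · simp only [hi, hj, h, if_true, and_false, or_true, if_false, koszulSign_erase_of_mem hi,
        koszulSign_insert_of_notMem hj, Finset.erase_insert_of_ne h.symm]
      rcases lt_or_gt_of_ne h with h' | h' <;> simp [h', h'.not_gt] <;> ring
  · simp [hi, h]

theorem sum_mul_sum_of_anticommute {α Q : Type*} [Ring Q] (s : Finset α) (d : α → Q)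
    (h : ∀ i j, i ≠ j → d i * d j + d j * d i = 0) :
    (∑ i ∈ s, d i) * (∑ i ∈ s, d i) = ∑ i ∈ s, d i * d i := by
  classical
  induction s using Finset.induction_on with
  | empty => simp
  | insert a s ha ih =>
    rw [Finset.sum_insert ha, Finset.sum_insert ha, ← ih]
    have : d a * ∑ i ∈ s, d i + (∑ i ∈ s, d i) * d a = 0 := by
      rw [Finset.mul_sum, Finset.sum_mul, ← Finset.sum_add_distrib]
      exact Finset.sum_eq_zero fun i hi => h _ _ fun h' => ha (h' ▸ hi)
    have hadd : ∀ x y z t : Q, x + y + (z + t) = x + t + (y + z) := fun x y z t => by abel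
    rw [add_mul, mul_add, mul_add, hadd, this, add_zero]

theorem smul_wedge_add_smul_contract_mul_self (i : Fin n) (w u : B) :
    (w • wedge B i + u • contract B i) * (w • wedge B i + u • contract B i) =
      (w * u) • (1 : Matrix (Finset (Fin n)) (Finset (Fin n)) B) := by
  rw [← wedge_mul_contract_self i, add_mul, mul_add, mul_add]
  simp only [Matrix.smul_mul, Matrix.mul_smul, wedge_mul_self, contract_mul_self, smul_zero,
    smul_smul, zero_add, add_zero, smul_add, mul_comm u w]

theorem smul_wedge_add_smul_contract_mul {i j : Fin n} (h : i ≠ j) (w u w' u' : B) :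
    (w • wedge B i + u • contract B i) * (w' • wedge B j + u' • contract B j) +
      (w' • wedge B j + u' • contract B j) * (w • wedge B i + u • contract B i) = 0 := by
  have h1 := wedge_mul_wedge (B := B) h
  have h2 := contract_mul_contract (B := B) h
  have h3 := wedge_mul_contract (B := B) h
  have h4 := wedge_mul_contract (B := B) h.symm
  calc _ = (w * w') • (wedge B i * wedge B j + wedge B j * wedge B i) +
        (u * u') • (contract B i * contract B j + contract B j * contract B i) +
        (w * u') • (wedge B i * contract B j + contract B j * wedge B i) +
        (w' * u) • (wedge B j * contract B i + contract B i * wedge B j) := by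
        simp only [add_mul, mul_add, Matrix.smul_mul, Matrix.mul_smul, smul_smul, smul_add,
          mul_comm w' w, mul_comm u' u, mul_comm u w', mul_comm u' w]
        abel
    _ = 0 := by rw [h1, h2, h3, h4]; simp

variable {k : Type*} [CommRing k] [Algebra k B]

/-- The summands for different $i$ anticommute and the $i$-th one squares to
$(x_i-x'_i)\,\partial_{[i]}W$; these scalars telescope from $W(x)$ to $W(x')$. -/
theorem unitAt_mul_self (W : MvPolynomial (Fin n) k) (x x' : Fin n → B) :
    (unitAt W x x').D * (unitAt W x x').D = (aeval x W - aeval x' W) •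
      (1 : Matrix (Finset (Fin n)) (Finset (Fin n)) B) := by
  rw [unitAt, sum_mul_sum_of_anticommute _ _ fun i j h => smul_wedge_add_smul_contract_mul h _ _ _ _]
  simp only [smul_wedge_add_smul_contract_mul_self]
  rw [← Finset.sum_smul]
  congr 1
  have : ∀ i : Fin n, diffQuot (hybrid x x' i) i (x i) (x' i) W * (x i - x' i) =
      aeval (mixed x x' i) W - aeval (mixed x x' (i + 1)) W := fun i => by
    rw [mul_comm, sub_mul_diffQuot, hybrid_eq_mixed, update_mixed_left, update_mixed_right]
  rw [Finset.sum_congr rfl fun i _ => this i,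
    ← Finset.sum_range fun i => aeval (mixed x x' i) W - aeval (mixed x x' (i + 1)) W,
    Finset.sum_range_sub' (fun i => aeval (mixed x x' i) W), mixed_zero, mixed_self]

theorem tensor_mul_self {κ κ' : Type*} [Fintype κ] [Fintype κ'] [DecidableEq κ] [DecidableEq κ']
    (M : Based κ B) (N : Based κ' B) (w w' : B) (hM : HasParity M.par 1 M.D)
    (hw : M.D * M.D = w • (1 : Matrix κ κ B)) (hw' : N.D * N.D = w' • (1 : Matrix κ' κ' B)) :
    (M.tensor N).D * (M.tensor N).D = (w + w') • (1 : Matrix (κ × κ') (κ × κ') B) := by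
  change (M.D ⊗ₖ (1 : Matrix κ' κ' B) + sgnMat B M.par ⊗ₖ N.D) *
    (M.D ⊗ₖ (1 : Matrix κ' κ' B) + sgnMat B M.par ⊗ₖ N.D) = _
  rw [add_mul, mul_add, mul_add, ← Matrix.mul_kronecker_mul, ← Matrix.mul_kronecker_mul,
    ← Matrix.mul_kronecker_mul, ← Matrix.mul_kronecker_mul, hw, hw', sgnMat_mul_self,
    hM.sgnMat_mul, sgn_one, Matrix.smul_kronecker, Matrix.smul_kronecker, Matrix.kronecker_smul,
    Matrix.one_mul, Matrix.one_mul, Matrix.mul_one, Matrix.one_kronecker_one, neg_one_smul, add_smul]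
  abel

end CAR

/-! ### The contraction of the Koszul complex of `x₁ - a₁, …, xₙ - aₙ` -/

section KoszulHomotopy

variable {n : ℕ} {A : Type*} [CommRing A] (a : Fin n → A)

/-- The divided difference in the `i`-th variable between `(a₁, …, a_{i-1}, xᵢ, …, xₙ)` and
`(a₁, …, aᵢ, x_{i+1}, …, xₙ)`. -/
noncomputable def shiftQuot (i : Fin n) : MvPolynomial (Fin n) A →ₗ[A] MvPolynomial (Fin n) A :=
  diffQuot (hybrid X (fun j => C (a j)) i) i (X i) (C (a i))

/-- Substitution of `a₁, …, a_t` for the first `t` variables. -/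
noncomputable def partialEval (t : ℕ) : MvPolynomial (Fin n) A →ₐ[A] MvPolynomial (Fin n) A :=
  aeval (mixed X (fun j => C (a j)) t)

theorem partialEval_zero (f : MvPolynomial (Fin n) A) : partialEval a 0 f = f := by
  rw [partialEval, mixed_zero, aeval_X_left_apply]

theorem partialEval_self (f : MvPolynomial (Fin n) A) : partialEval a n f = C (aeval a f) := by
  rw [partialEval, mixed_self]
  have : aeval (fun j => (C (a j) : MvPolynomial (Fin n) A)) =
      (Algebra.ofId A (MvPolynomial (Fin n) A)).comp (aeval a) := by
    ext j; simp [Algebra.ofId_apply]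
  rw [this]; rfl

theorem mul_shiftQuot (i : Fin n) (f : MvPolynomial (Fin n) A) :
    (X i - C (a i)) * shiftQuot a i f = partialEval a i f - partialEval a (i + 1) f := by
  rw [shiftQuot, sub_mul_diffQuot, hybrid_eq_mixed, update_mixed_left,
    update_mixed_right X (fun j => C (a j))]
  rfl

theorem shiftQuot_mul (i : Fin n) (f g : MvPolynomial (Fin n) A) :
    shiftQuot a i (f * g) =
      partialEval a (i + 1) f * shiftQuot a i g + shiftQuot a i f * partialEval a i g := by
  rw [shiftQuot, diffQuot_mul', hybrid_eq_mixed, update_mixed_left,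
    update_mixed_right X (fun j => C (a j))]
  rfl

/-- Together with the cases $j<i$ and $j>i$ below, this says how the divided difference in $x_i$
interacts with the coefficients $x_j-a_j$ of the Koszul differential; the contraction needs nothing
else. -/
theorem shiftQuot_self (i : Fin n) (g : MvPolynomial (Fin n) A) :
    shiftQuot a i ((X i - C (a i)) * g) = partialEval a i g := by
  rw [shiftQuot_mul, map_sub, map_sub, shiftQuot, diffQuot_X_self, diffQuot_C]
  simp [partialEval, mixed]

theorem shiftQuot_of_lt {i j : Fin n} (h : j < i) (g : MvPolynomial (Fin n) A) :
    shiftQuot a i ((X j - C (a j)) * g) = 0 := by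
  rw [shiftQuot_mul, map_sub, map_sub, shiftQuot, diffQuot_X_of_ne _ h.ne, diffQuot_C]
  have : (j : ℕ) < i + 1 := by have := Fin.lt_def.1 h; omega
  simp [partialEval, mixed, this]

theorem shiftQuot_of_gt {i j : Fin n} (h : i < j) (g : MvPolynomial (Fin n) A) :
    shiftQuot a i ((X j - C (a j)) * g) = (X j - C (a j)) * shiftQuot a i g := by
  rw [shiftQuot_mul, map_sub, map_sub, shiftQuot, diffQuot_X_of_ne _ h.ne', diffQuot_C]
  have : ¬ (j : ℕ) < i + 1 := by have := Fin.lt_def.1 h; omega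
  simp [partialEval, mixed, this]

/-- `g θ_b ↦ ∑_{i < min b} ∂_{[i]} g θᵢ θ_b`. -/
noncomputable def koszulHomotopy : (Finset (Fin n) → MvPolynomial (Fin n) A) →ₗ[A]
    (Finset (Fin n) → MvPolynomial (Fin n) A) :=
  LinearMap.pi fun b => if h : b.Nonempty then
    shiftQuot a (b.min' h) ∘ₗ LinearMap.proj (b.erase (b.min' h)) else 0

theorem koszulHomotopy_empty (f : Finset (Fin n) → MvPolynomial (Fin n) A) :
    koszulHomotopy a f ∅ = 0 := by simp [koszulHomotopy]

theorem koszulHomotopy_nonempty (f : Finset (Fin n) → MvPolynomial (Fin n) A) {b : Finset (Fin n)}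
    (h : b.Nonempty) : koszulHomotopy a f b = shiftQuot a (b.min' h) (f (b.erase (b.min' h))) := by
  simp [koszulHomotopy, h]

theorem koszulHomotopy_insert (f : Finset (Fin n) → MvPolynomial (Fin n) A) {b : Finset (Fin n)}
    {i : Fin n} (h : ∀ j ∈ b, i < j) : koszulHomotopy a f (insert i b) = shiftQuot a i (f b) := by
  have hm : (insert i b).min' (Finset.insert_nonempty i b) = i := by
    refine le_antisymm (Finset.min'_le _ _ (by simp)) (Finset.le_min' _ _ _ fun j hj => ?_)
    rcases Finset.mem_insert.1 hj with rfl | hj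
    · exact le_rfl
    · exact (h j hj).le
  rw [koszulHomotopy_nonempty a f (Finset.insert_nonempty i b), hm,
    Finset.erase_insert fun hi => lt_irrefl _ (h i hi)]

theorem koszulDiff_mulVec {B : Type*} [CommRing B] (u : Fin n → B) (f : Finset (Fin n) → B)
    (b : Finset (Fin n)) : (koszulDiff u).mulVec f b =
      ∑ i, if i ∈ b then 0 else koszulSign B i b * u i * f (insert i b) := by
  rw [koszulDiff, Matrix.sum_mulVec, Finset.sum_apply]
  refine Finset.sum_congr rfl fun i _ => ?_
  rw [Matrix.smul_mulVec, Pi.smul_apply, contract_mulVec]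
  split_ifs <;> simp; ring

theorem koszulSign_of_lt {B : Type*} [CommRing B] {b : Finset (Fin n)} {i : Fin n}
    (h : ∀ j ∈ b, i ≤ j) : koszulSign B i b = 1 := by
  rw [koszulSign, Finset.filter_false_of_mem fun j hj => (h j hj).not_gt]; simp

theorem koszulDiff_koszulHomotopy_empty (f : Finset (Fin n) → MvPolynomial (Fin n) A) :
    (koszulDiff fun i => X i - C (a i)).mulVec (koszulHomotopy a f) ∅ =
      f ∅ - C (aeval a (f ∅)) := by
  rw [koszulDiff_mulVec]
  have : ∀ i : Fin n, (if i ∈ (∅ : Finset (Fin n)) then 0 else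
      koszulSign (MvPolynomial (Fin n) A) i ∅ * (X i - C (a i)) *
        koszulHomotopy a f (insert i ∅)) =
      partialEval a i (f ∅) - partialEval a (i + 1) (f ∅) := fun i => by
    rw [if_neg (by simp), koszulSign_of_lt (by simp), one_mul, koszulHomotopy_insert a f (by simp),
      mul_shiftQuot]
  rw [Finset.sum_congr rfl fun i _ => this i,
    ← Finset.sum_range fun i => partialEval a i (f ∅) - partialEval a (i + 1) (f ∅),
    Finset.sum_range_sub' (fun i => partialEval a i (f ∅)), partialEval_zero, partialEval_self]

/-- Write $b=\{m\}\cup c$ with $m$ minimal. Indices $i>m$ cancel, since $\theta_m$ changes the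
Koszul sign and the divided difference in $x_m$ commutes with $x_i-a_i$. Indices $i<m$ contribute
successive substitutions $x_i\mapsto a_i$ in $f_b$, and $i=m$ contributes the last one. -/
theorem koszulDiff_koszulHomotopy_nonempty (f : Finset (Fin n) → MvPolynomial (Fin n) A)
    {b : Finset (Fin n)} (hb : b.Nonempty) :
    (koszulDiff fun i => X i - C (a i)).mulVec (koszulHomotopy a f) b +
      koszulHomotopy a ((koszulDiff fun i => X i - C (a i)).mulVec f) b = f b := by
  obtain ⟨m, c, hm, rfl⟩ : ∃ m c, (∀ j ∈ c, m < j) ∧ b = insert m c :=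
    ⟨b.min' hb, b.erase (b.min' hb), fun j hj => lt_of_le_of_ne
      (Finset.min'_le _ _ (Finset.mem_of_mem_erase hj)) (Finset.ne_of_mem_erase hj).symm,
      (Finset.insert_erase (Finset.min'_mem b hb)).symm⟩
  have hmc : m ∉ c := fun h => lt_irrefl _ (hm m h)
  rw [koszulHomotopy_insert _ _ hm, koszulDiff_mulVec, koszulDiff_mulVec, map_sum,
    ← Finset.sum_add_distrib]
  -- The sum telescopes to `Y 0 - Y n`. The cutoff at `m` makes the term at `i = m` a full
  -- `partialEval` and those beyond it zero.
  let Y : ℕ → MvPolynomial (Fin n) A := fun t =>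
    if t ≤ m then partialEval a t (f (insert m c)) else 0
  have hY : ∀ i : Fin n, ((if i ∈ insert m c then 0 else
      koszulSign (MvPolynomial (Fin n) A) i (insert m c) * (X i - C (a i)) *
        koszulHomotopy a f (insert i (insert m c))) +
      shiftQuot a m (if i ∈ c then 0 else
        koszulSign (MvPolynomial (Fin n) A) i c * (X i - C (a i)) * f (insert i c))) =
      Y i - Y (i + 1) := by
    intro i
    rcases lt_trichotomy i m with h | h | h
    · have h1 : ∀ j ∈ insert m c, i < j := fun j hj => by
        rcases Finset.mem_insert.1 hj with rfl | hj
        · exact h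
        · exact h.trans (hm j hj)
      have hv := Fin.lt_def.1 h
      have h2 : ∀ j ∈ c, i ≤ j := fun j hj => (h1 j (Finset.mem_insert_of_mem hj)).le
      rw [if_neg fun hi => lt_irrefl _ (h1 i hi), koszulSign_of_lt fun j hj => (h1 j hj).le,
        koszulHomotopy_insert _ _ h1, one_mul, mul_shiftQuot, if_neg fun hi => lt_irrefl _
        (h1 i (Finset.mem_insert_of_mem hi)), koszulSign_of_lt h2, one_mul, shiftQuot_of_lt a h]
      simp only [Y]
      rw [if_pos hv.le, if_pos (by omega), add_zero]
    · subst h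
      rw [if_pos (Finset.mem_insert_self _ _), if_neg hmc, koszulSign_of_lt fun j hj => (hm j hj).le,
        one_mul, shiftQuot_self]
      simp [Y]
    · have hv := Fin.lt_def.1 h
      have hYi : Y i - Y (i + 1) = 0 := by
        simp only [Y]
        rw [if_neg (by omega), if_neg (by omega), sub_zero]
      rw [hYi]
      by_cases hi : i ∈ c
      · rw [if_pos (Finset.mem_insert_of_mem hi), if_pos hi, map_zero, add_zero]
      · have hi' : i ∉ insert m c := by simp [hi, h.ne']
        rw [if_neg hi', if_neg hi, Finset.insert_comm, koszulHomotopy_insert a f (i := m),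
          koszulSign_insert_of_notMem hmc, if_pos h]
        · have hk : ∃ e : A, koszulSign (MvPolynomial (Fin n) A) i c = C e :=
            ⟨koszulSign A i c, by simp [koszulSign]⟩
          obtain ⟨e, he⟩ := hk
          rw [he, mul_assoc (C e), ← smul_eq_C_mul (_ * _) e, map_smul, shiftQuot_of_gt a h,
            smul_eq_C_mul]
          ring
        · intro j hj
          rcases Finset.mem_insert.1 hj with rfl | hj
          · exact h
          · exact hm j hj
  rw [Finset.sum_congr rfl fun i _ => hY i, ← Finset.sum_range fun i => Y i - Y (i + 1),
    Finset.sum_range_sub' Y]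
  simp only [Y]
  rw [if_pos (Nat.zero_le _), if_neg (by have := m.2; omega), partialEval_zero, sub_zero]

end KoszulHomotopy

/-! ### Degrees of linear maps -/

section Degree

variable {A B B' B'' : Type*} {κ κ' κ'' : Type*} [CommRing A] [CommRing B] [CommRing B']
  [CommRing B''] [Algebra A B] [Algebra A B'] [Algebra A B''] [Fintype κ] [Fintype κ']
  [Fintype κ''] {M : Based κ B} {N : Based κ' B'} {P : Based κ'' B''} {g g' : ZMod 2}

theorem HasDegree.comp {φ : (κ → B) →ₗ[A] (κ' → B')} {ψ : (κ' → B') →ₗ[A] (κ'' → B'')}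
    (hψ : HasDegree N P g' ψ) (hφ : HasDegree M N g φ) : HasDegree M P (g + g') (ψ ∘ₗ φ) :=
  fun e v hv j hj => by
    rw [← add_assoc]
    exact hψ (e + g) (φ v) (hφ e v hv) j hj

theorem HasDegree.add {φ ψ : (κ → B) →ₗ[A] (κ' → B')}
    (hφ : HasDegree M N g φ) (hψ : HasDegree M N g ψ) : HasDegree M N g (φ + ψ) :=
  fun e v hv j hj => by
    by_cases h : φ v j = 0
    · refine hψ e v hv j fun h' => hj ?_
      rw [LinearMap.add_apply, Pi.add_apply, h, h', add_zero]
    · exact hφ e v hv j h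

theorem HasDegree.sub {φ ψ : (κ → B) →ₗ[A] (κ' → B')}
    (hφ : HasDegree M N g φ) (hψ : HasDegree M N g ψ) : HasDegree M N g (φ - ψ) :=
  fun e v hv j hj => by
    by_cases h : φ v j = 0
    · refine hψ e v hv j fun h' => hj ?_
      rw [LinearMap.sub_apply, Pi.sub_apply, h, h', sub_zero]
    · exact hφ e v hv j h

theorem HasDegree.zero : HasDegree M N g (0 : (κ → B) →ₗ[A] (κ' → B')) :=
  fun _ _ _ _ hj => (hj rfl).elim

theorem HasDegree.id : HasDegree M M 0 (LinearMap.id : (κ → B) →ₗ[A] (κ → B)) :=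
  fun e v hv j hj => by rw [hv j hj, add_zero]

theorem HasDegree.cast {φ : (κ → B) →ₗ[A] (κ' → B')} (h : HasDegree M N g φ) (hg : g = g') :
    HasDegree M N g' φ := hg ▸ h

/-- The differential as a linear map. -/
def Based.diff (A : Type*) [CommRing A] [Algebra A B] (M : Based κ B) : (κ → B) →ₗ[A] (κ → B) :=
  M.D.mulVecLin.restrictScalars A

theorem Based.diff_apply (M : Based κ B) (v : κ → B) : M.diff A v = M.D.mulVec v := rfl

theorem hasDegree_diff (hM : HasParity M.par 1 M.D) : HasDegree M M 1 (M.diff A) :=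
  fun e v hv j hj => by
    rw [Based.diff_apply, Matrix.mulVec, dotProduct] at hj
    obtain ⟨i, -, hi⟩ := Finset.exists_ne_zero_of_sum_ne_zero hj
    rw [hM j i (left_ne_zero_of_mul hi), hv i (right_ne_zero_of_mul hi)]

theorem hasParity_tensor {κ κ' : Type*} [DecidableEq κ] [DecidableEq κ'] {M : Based κ B}
    {N : Based κ' B} (hM : HasParity M.par 1 M.D) (hN : HasParity N.par 1 N.D) :
    HasParity (M.tensor N).par 1 (M.tensor N).D := by
  rintro ⟨i, b⟩ ⟨j, c⟩ h
  simp only [Based.tensor, Matrix.add_apply, Matrix.kronecker_apply] at h ⊢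
  by_cases h1 : M.D i j * (1 : Matrix κ' κ' B) b c = 0
  · rw [h1, zero_add] at h
    rw [hN b c (right_ne_zero_of_mul h)]
    by_cases hij : i = j
    · subst hij; ring
    · rw [Matrix.diagonal_apply_ne _ hij, zero_mul] at h
      exact (h rfl).elim
  · rw [hM i j (left_ne_zero_of_mul h1)]
    by_cases hbc : b = c
    · subst hbc; ring
    · rw [Matrix.one_apply_ne hbc, mul_zero] at h1
      exact (h1 rfl).elim

theorem hasParity_unitAt {k : Type*} [CommRing k] [Algebra k B] {n : ℕ} (W : MvPolynomial (Fin n) k)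
    (x x' : Fin n → B) : HasParity (unitAt W x x').par 1 (unitAt W x x').D := by
  change HasParity (unitAt W x x').par 1 (∑ i, (diffQuot (hybrid x x' i) i (x i) (x' i) W • wedge B i
    + (x i - x' i) • contract B i))
  refine HasParity.sum _ _ fun i _ => HasParity.add (HasParity.smul _ ?_) (HasParity.smul _ ?_)
  · intro b c h
    simp only [wedge, Matrix.of_apply] at h
    split_ifs at h with h'
    · obtain ⟨hi, rfl⟩ := h'
      simp [unitAt, Finset.card_insert_of_notMem hi]
    · exact (h rfl).elim
  · intro b c h
    simp only [contract, Matrix.of_apply] at h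
    split_ifs at h with h'
    · obtain ⟨hi, rfl⟩ := h'
      simp only [unitAt]
      rw [← Finset.card_erase_add_one hi]
      push_cast
      rw [add_assoc, CharTwo.add_self_eq_zero, add_zero]
    · exact (h rfl).elim

end Degree

/-! ### `ρ⁻¹ ∘ ρ` is homotopic to the identity -/

section RhoHomotopy

variable {k : Type*} [CommRing k] {n m : ℕ} {ι : Type*} [Fintype ι] [DecidableEq ι]
  (X : Based ι (ZX k m n)) {W : MvPolynomial (Fin n) k} {V : MvPolynomial (Fin m) k}

theorem tensorUnit_mulVec (v : ι × Finset (Fin n) → MvPolynomial (Fin n) (ZX k m n)) (i : ι)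
    (b : Finset (Fin n)) : (tensorUnit W X).D.mulVec v (i, b) =
      (evalD X (fun j => C (zVar k m n j)) MvPolynomial.X).mulVec (fun j => v (j, b)) i +
        sgn _ (X.par i) * ∑ a, koszulSign _ a b *
          if a ∈ b then diffQuot (hybrid MvPolynomial.X (fun j => C (xVar k m n j)) a) a
            (MvPolynomial.X a) (C (xVar k m n a)) W * v (i, b.erase a)
          else (MvPolynomial.X a - C (xVar k m n a)) * v (i, insert a b) := by
  rw [tensorUnit, tensor_mulVec, unitAt_mulVec]
  rfl

variable {X}

theorem hasParity_tensorUnit (hX : X.IsFactorisation (difference W V)) :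
    HasParity (tensorUnit W X).par 1 (tensorUnit W X).D :=
  hasParity_tensor (hasParity_evalD hX _ _) (hasParity_unitAt W _ _)

theorem tensorUnit_mul_self (hX : X.IsFactorisation (difference W V)) :
    (tensorUnit W X).D * (tensorUnit W X).D =
      (C (difference W V) : MvPolynomial (Fin n) (ZX k m n)) • 1 := by
  rw [tensorUnit, tensor_mul_self _ _ _ _ (hasParity_evalD hX _ _) (evalD_mul_evalD hX _ _)
    (unitAt_mul_self _ _ _)]
  congr 1
  rw [← algebraMap_eq, ← aeval_elim_C_C, difference, map_sub, aeval_rename, aeval_rename,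
    Sum.elim_comp_inl, Sum.elim_comp_inr]
  simp only [algebraMap_eq]
  ring

variable (X W)

theorem rho_apply (v : ι × Finset (Fin n) → MvPolynomial (Fin n) (ZX k m n)) (i : ι) :
    rho k m n ι v i = aeval (xVar k m n) (v (i, ∅)) := rfl

theorem rho_tensorUnit (v : ι × Finset (Fin n) → MvPolynomial (Fin n) (ZX k m n)) :
    rho k m n ι ((tensorUnit W X).D.mulVec v) = X.D.mulVec (rho k m n ι v) := by
  ext1 i
  rw [rho_apply, tensorUnit_mulVec, map_add, map_mul, map_sum, Finset.sum_eq_zero, mul_zero,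
    add_zero]
  · simp only [Matrix.mulVec, dotProduct, map_sum, map_mul, rho_apply]
    refine Finset.sum_congr rfl fun j _ => ?_
    congr 1
    have : ((aeval (xVar k m n) : MvPolynomial (Fin n) (ZX k m n) →ₐ[ZX k m n] _).restrictScalars
        k).comp (aeval (Sum.elim (fun j => C (zVar k m n j)) MvPolynomial.X)) =
        AlgHom.id k (ZX k m n) := by
      ext (j | j) <;> simp [zVar, xVar]
    exact DFunLike.congr_fun this (X.D i j)
  · intro a _
    rw [if_neg (by simp), map_mul, map_mul, map_sub, aeval_X, aeval_C]
    simp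

theorem hasDegree_rho : HasDegree (tensorUnit W X) X 0 (rho k m n ι) := by
  intro e v hv i hi
  have := hv (i, ∅) fun h => hi (by rw [rho_apply, h, map_zero])
  simpa [tensorUnit, Based.tensor, unitAt, atPoint, Based.map] using this

/-- The contraction of `X ⊗ Δ_W` for the Koszul part of the differential. -/
noncomputable def unitContraction : (ι × Finset (Fin n) → MvPolynomial (Fin n) (ZX k m n))
    →ₗ[ZX k m n] (ι × Finset (Fin n) → MvPolynomial (Fin n) (ZX k m n)) :=
  -- The differential of the second tensor factor carries $(-1)^{|e_i|}$; the same sign here cancels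
  -- it.
  LinearMap.pi fun p => LinearMap.mulLeft (ZX k m n) (sgn _ (X.par p.1)) ∘ₗ LinearMap.proj p.2 ∘ₗ
    koszulHomotopy (xVar k m n) ∘ₗ LinearMap.funLeft (ZX k m n) _ fun c => (p.1, c)

theorem unitContraction_apply (v : ι × Finset (Fin n) → MvPolynomial (Fin n) (ZX k m n)) (i : ι)
    (b : Finset (Fin n)) : unitContraction X v (i, b) =
      sgn _ (X.par i) * koszulHomotopy (xVar k m n) (fun c => v (i, c)) b := rfl

theorem rho_unitContraction (v : ι × Finset (Fin n) → MvPolynomial (Fin n) (ZX k m n)) :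
    rho k m n ι (unitContraction X v) = 0 := by
  ext1 i
  rw [rho_apply, unitContraction_apply, koszulHomotopy_empty]
  simp

theorem hasDegree_unitContraction :
    HasDegree (tensorUnit W X) (tensorUnit W X) 1 (unitContraction X) := by
  rintro e v hv ⟨i, b⟩ h
  rw [unitContraction_apply] at h
  have h := right_ne_zero_of_mul h
  by_cases hb : b.Nonempty
  · rw [koszulHomotopy_nonempty _ _ hb] at h
    have := hv (i, b.erase (b.min' hb)) fun h' => h (by rw [h', map_zero])
    simp only [tensorUnit, Based.tensor, unitAt] at this ⊢
    rw [← this, ← Finset.card_erase_add_one (Finset.min'_mem b hb)]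
    push_cast
    ring
  · rw [Finset.not_nonempty_iff_eq_empty] at hb
    subst hb
    rw [koszulHomotopy_empty] at h
    exact (h rfl).elim

/-- The elements of `θ`-degree at least `p`. -/
def IsDeep (p : ℕ) (v : ι × Finset (Fin n) → MvPolynomial (Fin n) (ZX k m n)) : Prop :=
  ∀ i b, b.card < p → v (i, b) = 0

theorem koszulHomotopy_eq_zero {A : Type*} [CommRing A] (a : Fin n → A) {p : ℕ}
    {f : Finset (Fin n) → MvPolynomial (Fin n) A} (hf : ∀ b, b.card < p → f b = 0)
    {b : Finset (Fin n)} (hb : b.card < p + 1) : koszulHomotopy a f b = 0 := by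
  rcases b.eq_empty_or_nonempty with rfl | h
  · exact koszulHomotopy_empty a f
  · rw [koszulHomotopy_nonempty a f h, hf, map_zero]
    rw [Finset.card_erase_of_mem (Finset.min'_mem b h)]
    have := Finset.card_pos.2 h
    omega

theorem koszulHomotopy_congr {A : Type*} [CommRing A] (a : Fin n → A) {p : ℕ}
    {f g : Finset (Fin n) → MvPolynomial (Fin n) A} (hf : ∀ b, b.card < p → f b = g b)
    {b : Finset (Fin n)} (hb : b.card < p + 1) : koszulHomotopy a f b = koszulHomotopy a g b := by
  rw [← sub_eq_zero, ← Pi.sub_apply, ← map_sub]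
  exact koszulHomotopy_eq_zero a (fun c hc => by rw [Pi.sub_apply, hf c hc, sub_self]) hb

/-- Of the three parts of the differential, $d_X\otimes1$ preserves the $\theta$-degree and the
wedge part raises it. Below degree $p$ only the Koszul part is visible. -/
theorem tensorUnit_mulVec_of_card_lt {p : ℕ}
    {v : ι × Finset (Fin n) → MvPolynomial (Fin n) (ZX k m n)} (hv : IsDeep p v) (i : ι)
    {b : Finset (Fin n)} (hb : b.card < p) : (tensorUnit W X).D.mulVec v (i, b) =
      sgn _ (X.par i) * (koszulDiff fun a => MvPolynomial.X a - C (xVar k m n a)).mulVec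
        (fun c => v (i, c)) b := by
  rw [tensorUnit_mulVec, koszulDiff_mulVec]
  have h1 : (fun j => v (j, b)) = 0 := funext fun j => hv j b hb
  rw [h1, Matrix.mulVec_zero, Pi.zero_apply, zero_add]
  congr 1
  refine Finset.sum_congr rfl fun a _ => ?_
  split_ifs with ha
  · rw [hv _ _ ((Finset.card_erase_le).trans_lt hb)]; ring
  · ring

/-- One step of the perturbation argument: up to $\theta$-degree $p$ the differential acts as the
Koszul differential, which `unitContraction` contracts. In $\theta$-degree 0 the contraction misses
the value at $x=x'$, which is zero because $\rho v=0$. -/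
theorem isDeep_contraction_sub {p : ℕ}
    {v : ι × Finset (Fin n) → MvPolynomial (Fin n) (ZX k m n)} (hv : IsDeep p v)
    (hρ : rho k m n ι v = 0) :
    IsDeep (p + 1) (v - ((tensorUnit W X).D.mulVec (unitContraction X v) +
      unitContraction X ((tensorUnit W X).D.mulVec v))) := by
  intro i b hb
  have hdeep : IsDeep (p + 1) (unitContraction X v) := fun j c hc => by
    rw [unitContraction_apply, koszulHomotopy_eq_zero _ (fun c hc => hv j c hc) hc, mul_zero]
  have hs := sgn_mul_self (MvPolynomial (Fin n) (ZX k m n)) (X.par i)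
  rw [Pi.sub_apply, Pi.add_apply, tensorUnit_mulVec_of_card_lt X W hdeep i hb,
    unitContraction_apply]
  have h1 : koszulHomotopy (xVar k m n) (fun c => (tensorUnit W X).D.mulVec v (i, c)) b =
      sgn _ (X.par i) * koszulHomotopy (xVar k m n)
        ((koszulDiff fun a => MvPolynomial.X a - C (xVar k m n a)).mulVec fun c => v (i, c)) b := by
    have hC : sgn (MvPolynomial (Fin n) (ZX k m n)) (X.par i) = C (sgn _ (X.par i)) := by
      simp [sgn]
    rw [hC, ← smul_eq_C_mul, ← Pi.smul_apply, ← map_smul]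
    refine koszulHomotopy_congr _ (fun c hc => ?_) hb
    rw [tensorUnit_mulVec_of_card_lt X W hv i hc, hC, Pi.smul_apply, smul_eq_C_mul]
  have h2 : (fun c => unitContraction X v (i, c)) =
      sgn (MvPolynomial (Fin n) (ZX k m n)) (X.par i) •
        koszulHomotopy (xVar k m n) fun c => v (i, c) := rfl
  rw [h1, h2, Matrix.mulVec_smul, Pi.smul_apply, smul_eq_mul, ← mul_assoc, ← mul_assoc, hs,
    one_mul, one_mul]
  rcases b.eq_empty_or_nonempty with rfl | hne
  · have := congrFun hρ i
    rw [rho_apply] at this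
    rw [koszulDiff_koszulHomotopy_empty, koszulHomotopy_empty, this]
    simp
  · rw [koszulDiff_koszulHomotopy_nonempty _ _ hne, sub_self]

variable {X W}

theorem exists_partial_homotopy (hX : X.IsFactorisation (difference W V)) (p : ℕ) :
    ∃ h : (ι × Finset (Fin n) → MvPolynomial (Fin n) (ZX k m n)) →ₗ[ZX k m n]
        (ι × Finset (Fin n) → MvPolynomial (Fin n) (ZX k m n)),
      HasDegree (tensorUnit W X) (tensorUnit W X) 1 h ∧
      ∀ v, IsDeep p (v - rhoInv X (rho k m n ι v) -
          ((tensorUnit W X).D.mulVec (h v) + h ((tensorUnit W X).D.mulVec v))) ∧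
        rho k m n ι (v - rhoInv X (rho k m n ι v) -
          ((tensorUnit W X).D.mulVec (h v) + h ((tensorUnit W X).D.mulVec v))) = 0 := by
  induction p with
  | zero =>
    refine ⟨0, HasDegree.zero, fun v => ⟨fun _ _ h => (Nat.not_lt_zero _ h).elim, ?_⟩⟩
    simp [rho_rhoInv]
  | succ p ih =>
    obtain ⟨h, hdeg, hh⟩ := ih
    set d := (tensorUnit W X).diff (ZX k m n) with hd
    -- Since $d^2$ is a scalar of the base ring, $dh+hd$ commutes with $d$ although $d^2\neq0$;
    -- hence the remainder `r` commutes with $d$.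
    have hd2 : ∀ v, d (d v) = difference W V • v := fun v => by
      rw [hd, Based.diff_apply, Based.diff_apply, Matrix.mulVec_mulVec, tensorUnit_mul_self hX,
        Matrix.smul_mulVec, Matrix.one_mulVec]
      ext1 q
      rw [Pi.smul_apply, Pi.smul_apply, smul_eq_mul, smul_eq_C_mul]
    have hddeg : HasDegree (tensorUnit W X) (tensorUnit W X) 1 d :=
      hasDegree_diff (hasParity_tensorUnit hX)
    let r := LinearMap.id - rhoInv X ∘ₗ rho k m n ι - (d ∘ₗ h + h ∘ₗ d)
    have hr : ∀ v, r v = v - rhoInv X (rho k m n ι v) - (d (h v) + h (d v)) := fun v => rfl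
    have hrd : ∀ v, r (d v) = d (r v) := fun v => by
      have e1 : rhoInv X (rho k m n ι (d v)) = d (rhoInv X (rho k m n ι v)) := by
        rw [hd, Based.diff_apply, rho_tensorUnit, Based.diff_apply, (isMorphism_rhoInv hX).2]
      rw [hr, hr, e1, hd2, map_smul, map_sub, map_sub, map_add, hd2]
      abel
    have hrdeg : HasDegree (tensorUnit W X) (tensorUnit W X) 0 r := by
      refine (HasDegree.id.sub ?_).sub (HasDegree.add ?_ ?_)
      · exact ((isMorphism_rhoInv hX).1.comp (hasDegree_rho X W)).cast (by simp)
      · exact (hddeg.comp hdeg).cast (by decide)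
      · exact (hdeg.comp hddeg).cast (by decide)
    -- With $K$ the contraction, $rd=dr$ makes the new remainder $r-(dK+Kd)r$, which starts one
    -- $\theta$-degree higher.
    refine ⟨h + unitContraction X ∘ₗ r,
      hdeg.add (((hasDegree_unitContraction X W).comp hrdeg).cast (by simp)), fun v => ?_⟩
    have key : v - rhoInv X (rho k m n ι v) -
        ((tensorUnit W X).D.mulVec ((h + unitContraction X ∘ₗ r) v) +
          (h + unitContraction X ∘ₗ r) ((tensorUnit W X).D.mulVec v)) =
        r v - ((tensorUnit W X).D.mulVec (unitContraction X (r v)) +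
          unitContraction X ((tensorUnit W X).D.mulVec (r v))) := by
      change _ - (d _ + _ ) = r v - (d _ + unitContraction X (d (r v)))
      rw [← hrd, hr v]
      simp only [LinearMap.add_apply, LinearMap.comp_apply, map_add]
      change _ - _ - (_ + (h (d v) + unitContraction X (r (d v)))) = _
      rw [hr v]
      abel
    rw [key]
    refine ⟨isDeep_contraction_sub X W (hh v).1 (hh v).2, ?_⟩
    rw [map_sub, map_add, rho_tensorUnit, rho_unitContraction, rho_unitContraction,
      Matrix.mulVec_zero, add_zero, sub_zero]
    exact (hh v).2

theorem rhoInv_rho_homotopic (hX : X.IsFactorisation (difference W V)) :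
    Homotopic (tensorUnit W X) (tensorUnit W X) (rhoInv X ∘ₗ rho k m n ι) LinearMap.id := by
  -- The $\theta$-degrees run from $0$ to $n$, so a remainder vanishing below degree $n+1$ is zero.
  obtain ⟨h, hdeg, hh⟩ := exists_partial_homotopy hX (n + 1)
  refine ⟨h, hdeg, fun v => (sub_eq_zero.1 (_root_.funext fun q => ?_)).symm⟩
  refine (hh v).1 q.1 q.2 (Nat.lt_succ_of_le ?_)
  simpa using Finset.card_le_univ q.2

theorem rho_rhoInv_homotopic (X : Based ι (ZX k m n)) :
    Homotopic X X (rho k m n ι ∘ₗ rhoInv X) LinearMap.id :=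
  ⟨0, HasDegree.zero, fun v => by simp [rho_rhoInv]⟩

end RhoHomotopy

/-! ### Products of functionals and residues -/

section ProdFunctional

variable {A : Type*} [CommRing A] {n : ℕ}

/-- The functional `x^s ↦ ∏ᵢ φᵢ(t^(sᵢ))`. -/
noncomputable def prodFunctional (φ : Fin n → (Polynomial A →ₗ[A] A)) :
    MvPolynomial (Fin n) A →ₗ[A] A :=
  (basisMonomials (Fin n) A).constr A fun s => ∏ i, φ i (Polynomial.X ^ s i)

theorem constr_basisMonomials {B M : Type*} [CommRing B] [AddCommGroup M] [Module B M]
    (f : (Fin n →₀ ℕ) → M) (s : Fin n →₀ ℕ) :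
    (basisMonomials (Fin n) B).constr B f (monomial s 1) = f s := by
  have := (basisMonomials (Fin n) B).constr_basis B f s
  rwa [coe_basisMonomials] at this

theorem prodFunctional_monomial (φ : Fin n → (Polynomial A →ₗ[A] A)) (s : Fin n →₀ ℕ) :
    prodFunctional φ (monomial s 1) = ∏ i, φ i (Polynomial.X ^ s i) :=
  constr_basisMonomials _ s

theorem prodFunctional_one (φ : Fin n → (Polynomial A →ₗ[A] A)) :
    prodFunctional φ 1 = ∏ i, φ i 1 := by
  have := prodFunctional_monomial φ 0
  simpa using this

/-- `g ↦ φ(q g)`. -/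
noncomputable def twist (φ : Polynomial A →ₗ[A] A) (q : Polynomial A) : Polynomial A →ₗ[A] A :=
  φ ∘ₗ LinearMap.mulLeft A q

theorem twist_apply (φ : Polynomial A →ₗ[A] A) (q g : Polynomial A) : twist φ q g = φ (q * g) := rfl

/-- A polynomial in $x_j$ alone affects only the $j$-th factor, which reduces manipulations of
denominators to one variable. -/
theorem prodFunctional_aeval_mul (φ : Fin n → (Polynomial A →ₗ[A] A)) (j : Fin n)
    (q : Polynomial A) (g : MvPolynomial (Fin n) A) :
    prodFunctional φ (Polynomial.aeval (X j) q * g) =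
      prodFunctional (Function.update φ j (twist (φ j) q)) g := by
  suffices h : prodFunctional φ ∘ₗ LinearMap.mulLeft A (Polynomial.aeval (X j) q) =
      prodFunctional (Function.update φ j (twist (φ j) q)) from LinearMap.congr_fun h g
  refine (basisMonomials (Fin n) A).ext fun s => ?_
  rw [coe_basisMonomials, LinearMap.comp_apply, LinearMap.mulLeft_apply, prodFunctional_monomial,
    ← Finset.mul_prod_erase _ _ (Finset.mem_univ j), Function.update_self, twist_apply]
  have h2 : ∏ i ∈ Finset.univ.erase j, Function.update φ j (twist (φ j) q) i (Polynomial.X ^ s i) =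
      ∏ i ∈ Finset.univ.erase j, φ i (Polynomial.X ^ s i) :=
    Finset.prod_congr rfl fun i hi => by rw [Function.update_of_ne (Finset.ne_of_mem_erase hi)]
  rw [h2]
  clear h2
  induction q using Polynomial.induction_on' with
  | add p q hp hq => rw [map_add, add_mul, map_add, hp, hq, add_mul, map_add, add_mul]
  | monomial t c =>
    rw [Polynomial.aeval_monomial, ← Polynomial.C_mul_X_pow_eq_monomial, mul_assoc, mul_assoc,
      ← Algebra.smul_def, map_smul, ← Polynomial.smul_eq_C_mul, map_smul, smul_eq_mul, smul_eq_mul,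
      mul_assoc, X_pow_eq_monomial, monomial_mul, one_mul, prodFunctional_monomial,
      ← Finset.mul_prod_erase _ _ (Finset.mem_univ j), ← pow_add]
    congr 2
    · simp
    · refine Finset.prod_congr rfl fun i hi => ?_
      simp [Finsupp.single_eq_of_ne (Finset.ne_of_mem_erase hi)]

theorem prodFunctional_aeval_mul_eq_zero {φ : Fin n → (Polynomial A →ₗ[A] A)} {j : Fin n}
    {q : Polynomial A} (h : ∀ g, φ j (q * g) = 0) (g : MvPolynomial (Fin n) A) :
    prodFunctional φ (Polynomial.aeval (X j) q * g) = 0 := by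
  have h0 : twist (φ j) q = 0 := LinearMap.ext h
  rw [prodFunctional_aeval_mul, h0]
  suffices h : prodFunctional (Function.update φ j 0) = 0 by rw [h]; rfl
  refine (basisMonomials (Fin n) A).ext fun s => ?_
  rw [coe_basisMonomials, prodFunctional_monomial, Finset.prod_eq_zero (Finset.mem_univ j)]
  · rfl
  · simp

theorem prodFunctional_prod_mul (φ : Fin n → (Polynomial A →ₗ[A] A)) (q : Fin n → Polynomial A)
    (s : Finset (Fin n)) (g : MvPolynomial (Fin n) A) :
    prodFunctional φ ((∏ i ∈ s, Polynomial.aeval (X i) (q i)) * g) =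
      prodFunctional (fun i => if i ∈ s then twist (φ i) (q i) else φ i) g := by
  induction s using Finset.induction_on generalizing g with
  | empty => simp
  | insert a s ha ih =>
    rw [Finset.prod_insert ha, mul_comm (Polynomial.aeval _ _), mul_assoc, ih,
      prodFunctional_aeval_mul]
    congr 2
    ext1 i
    by_cases h : i = a
    · subst h; simp [ha]
    · simp [h]

/-- The residue of `g dt / p(t)` for a monic polynomial `p`. -/
noncomputable def polyResidue (p : Polynomial A) : Polynomial A →ₗ[A] A :=
  Polynomial.lcoeff A (p.natDegree - 1) ∘ₗ Polynomial.modByMonicHom p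

theorem polyResidue_apply (p g : Polynomial A) :
    polyResidue p g = (g.modByMonic p).coeff (p.natDegree - 1) := rfl

theorem sepResidue_eq_prodFunctional (p : Fin n → Polynomial A) :
    sepResidue p = prodFunctional fun i => polyResidue (p i) := rfl

theorem polyResidue_self_mul {p : Polynomial A} (hp : p.Monic) (g : Polynomial A) :
    polyResidue p (p * g) = 0 := by
  rw [polyResidue_apply, (Polynomial.modByMonic_eq_zero_iff_dvd hp).2 (dvd_mul_right p g),
    Polynomial.coeff_zero]

/-- A common factor of numerator and denominator cancels: $(t-a)$ times the remainder of $g$ modulo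
$p$ is the remainder of $(t-a)g$ modulo $(t-a)p$, with the same top coefficient. -/
theorem polyResidue_X_sub_C_mul {p : Polynomial A} [Nontrivial A] (hp : p.Monic) (a : A)
    (g : Polynomial A) :
    polyResidue ((Polynomial.X - Polynomial.C a) * p) ((Polynomial.X - Polynomial.C a) * g) =
      polyResidue p g := by
  have hX := Polynomial.monic_X_sub_C a
  have hmod : ((Polynomial.X - Polynomial.C a) * g).modByMonic ((Polynomial.X - Polynomial.C a) * p)
      = (Polynomial.X - Polynomial.C a) * (g.modByMonic p) := by
    refine (Polynomial.div_modByMonic_unique (g.divByMonic p) _ (hX.mul hp) ⟨?_, ?_⟩).2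
    · conv_rhs => rw [← Polynomial.modByMonic_add_div g p]
      ring
    · rw [mul_comm, hX.degree_mul, mul_comm, hX.degree_mul, Polynomial.degree_X_sub_C]
      exact WithBot.add_lt_add_right (by simp) (Polynomial.degree_modByMonic_lt g hp)
  rw [polyResidue_apply, polyResidue_apply, hmod, hX.natDegree_mul hp, Polynomial.natDegree_X_sub_C,
    Nat.add_sub_cancel_left]
  -- For $p=1$ the index `natDegree - 1` is truncated to 0, and both sides vanish because the
  -- remainder modulo 1 is zero.
  by_cases hd : p.natDegree = 0
  · rw [hp.natDegree_eq_zero.1 hd]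
    simp
  · obtain ⟨d, hd⟩ := Nat.exists_eq_succ_of_ne_zero hd
    rw [hd, sub_mul, Polynomial.coeff_sub, Polynomial.coeff_X_mul, Polynomial.coeff_C_mul,
      Nat.succ_sub_one, Polynomial.coeff_eq_zero_of_degree_lt (n := d + 1), mul_zero, sub_zero]
    refine (Polynomial.degree_modByMonic_lt g hp).trans_le ?_
    rw [Polynomial.degree_eq_natDegree hp.ne_zero, hd]

/-- Modulo $(t-a)p$ the numerator $pg$ equals $g(a)\,p$, whose top coefficient is $g(a)$ as $p$ is
monic. -/
theorem polyResidue_X_sub_C_mul_mul {p : Polynomial A} [Nontrivial A] (hp : p.Monic) (a : A)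
    (g : Polynomial A) :
    polyResidue ((Polynomial.X - Polynomial.C a) * p) (p * g) = g.eval a := by
  have h : p * g = p * Polynomial.C (g.eval a) +
      ((Polynomial.X - Polynomial.C a) * p) * (g.divByMonic (Polynomial.X - Polynomial.C a)) := by
    conv_lhs => rw [← Polynomial.modByMonic_add_div g (Polynomial.X - Polynomial.C a),
      Polynomial.modByMonic_X_sub_C_eq_C_eval]
    ring
  have hX := Polynomial.monic_X_sub_C a
  rw [h, map_add, polyResidue_self_mul (hX.mul hp), add_zero, mul_comm p, ← Polynomial.smul_eq_C_mul,
    map_smul, polyResidue_apply, hX.natDegree_mul hp, Polynomial.natDegree_X_sub_C,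
    Nat.add_sub_cancel_left, (Polynomial.modByMonic_eq_self_iff (hX.mul hp)).2, hp.coeff_natDegree,
    smul_eq_mul, mul_one]
  rw [hp.degree_mul, Polynomial.degree_X_sub_C, Polynomial.degree_eq_natDegree hp.ne_zero]
  exact_mod_cast Nat.lt_one_add_iff.2 le_rfl

theorem sepResidue_map {B : Type*} [CommRing B] [Nontrivial B] (φ : A →+* B)
    {p : Fin n → Polynomial A} (hp : ∀ i, (p i).Monic) (g : MvPolynomial (Fin n) A) :
    sepResidue (fun i => (p i).map φ) (MvPolynomial.map φ g) = φ (sepResidue p g) := by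
  induction g using MvPolynomial.induction_on' with
  | add f g hf hg => rw [map_add, map_add, map_add, map_add, hf, hg]
  | monomial s c =>
    rw [map_monomial, show monomial s (φ c) = φ c • monomial s (1 : B) by rw [smul_monomial]; simp,
      show monomial s c = c • monomial s (1 : A) by rw [smul_monomial]; simp, map_smul, map_smul,
      sepResidue_eq_prodFunctional, sepResidue_eq_prodFunctional, prodFunctional_monomial,
      prodFunctional_monomial, smul_eq_mul, smul_eq_mul, map_mul, map_prod]
    congr 1
    refine Finset.prod_congr rfl fun i _ => ?_
    rw [polyResidue_apply, polyResidue_apply, (hp i).natDegree_map, ← Polynomial.coeff_map,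
      Polynomial.map_modByMonic _ (hp i), Polynomial.map_pow, Polynomial.map_X]

end ProdFunctional

/-! ### The residue symbol kills its denominators and commutes with base change. -/

section Residue

variable {k : Type*} [CommRing k] {n : ℕ} {f : Fin n → MvPolynomial (Fin n) k}

theorem det_mul_eq_of_isSeparation
    {q : (Fin n → Polynomial k) × Matrix (Fin n) (Fin n) (MvPolynomial (Fin n) k)}
    (hq : IsSeparation f q) (j : Fin n) :
    q.2.det * f j = ∑ i, q.2.adjugate j i * Polynomial.aeval (X i) (q.1 i) := by
  have h : (fun i => Polynomial.aeval (X i) (q.1 i)) = q.2.mulVec f := funext hq.2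
  have h2 := congrArg (fun v => q.2.adjugate.mulVec v j) h
  simp only [Matrix.mulVec_mulVec, Matrix.adjugate_mul, Matrix.smul_mulVec, Matrix.one_mulVec,
    Pi.smul_apply, smul_eq_mul] at h2
  rw [← h2]; rfl

/-- By Cramer's rule $\det(C)f_j$ is a combination of the $p_i(x_i)$, and each of these is killed by
the residue in $x_i$. Without a separation the residue is zero by definition. -/
theorem residue_mul_eq_zero (j : Fin n) (g : MvPolynomial (Fin n) k) :
    residue f (f j * g) = 0 := by
  rw [residue]
  split_ifs with h
  · rw [LinearMap.comp_apply, LinearMap.mulLeft_apply, ← mul_assoc,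
      det_mul_eq_of_isSeparation h.choose_spec, Finset.sum_mul, map_sum]
    refine Finset.sum_eq_zero fun i _ => ?_
    rw [mul_comm (Matrix.adjugate _ _ _), mul_assoc, sepResidue_eq_prodFunctional,
      prodFunctional_aeval_mul_eq_zero (polyResidue_self_mul (h.choose_spec.1 i))]
  · rfl

variable (B : Type*) [CommRing B] [Algebra k B]

theorem residueExt_map (g : MvPolynomial (Fin n) k) :
    residueExt B f (MvPolynomial.map (algebraMap k B) g) = algebraMap k B (residue f g) := by
  induction g using MvPolynomial.induction_on' with
  | add f g hf hg => rw [map_add, map_add, map_add, map_add, hf, hg]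
  | monomial s c =>
    rw [map_monomial, show monomial s (algebraMap k B c) = algebraMap k B c • monomial s (1 : B) by
      rw [smul_monomial]; simp, show monomial s c = c • monomial s (1 : k) by
      rw [smul_monomial]; simp, map_smul, map_smul, residueExt, constr_basisMonomials, smul_eq_mul,
      smul_eq_mul, map_mul]

theorem residueExt_mul_eq_zero (j : Fin n) (g : MvPolynomial (Fin n) B) :
    residueExt B f (MvPolynomial.map (algebraMap k B) (f j) * g) = 0 := by
  suffices h : residueExt B f ∘ₗ LinearMap.mulLeft B (MvPolynomial.map (algebraMap k B) (f j)) = 0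
    from LinearMap.congr_fun h g
  refine (basisMonomials (Fin n) B).ext fun s => ?_
  rw [coe_basisMonomials, LinearMap.comp_apply, LinearMap.mulLeft_apply]
  beta_reduce
  rw [show monomial s (1 : B) = MvPolynomial.map (algebraMap k B) (monomial s 1) by simp, ← map_mul,
    residueExt_map, residue_mul_eq_zero, map_zero, LinearMap.zero_apply]

theorem residueExt_eq_zero_of_mem {g : MvPolynomial (Fin n) B}
    (hg : g ∈ Ideal.span (Set.range fun j => MvPolynomial.map (algebraMap k B) (f j))) :
    residueExt B f g = 0 := by
  obtain ⟨c, rfl⟩ := (Ideal.mem_span_range_iff_exists_fun).1 hg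
  rw [map_sum]
  exact Finset.sum_eq_zero fun j _ => by rw [mul_comm, residueExt_mul_eq_zero]

theorem map_residueExt {B' : Type*} [CommRing B'] [Algebra k B'] (φ : B →ₐ[k] B')
    (g : MvPolynomial (Fin n) B) :
    φ (residueExt B f g) = residueExt B' f (MvPolynomial.map (φ : B →+* B') g) := by
  induction g using MvPolynomial.induction_on' with
  | add f g hf hg => rw [map_add, map_add, map_add, map_add, hf, hg]
  | monomial s c =>
    rw [map_monomial, show monomial s ((φ : B →+* B') c) = φ c • monomial s (1 : B') by
      rw [smul_monomial]; simp, show monomial s c = c • monomial s (1 : B) by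
      rw [smul_monomial]; simp, map_smul (residueExt B f), map_smul (residueExt B' f), residueExt,
      residueExt, constr_basisMonomials,
      constr_basisMonomials, smul_eq_mul, smul_eq_mul, map_mul, AlgHom.commutes]

/-- Each $x_i$ is integral over $k$ in the finite quotient; a monic equation for it is an element
$p_i(x_i)$ of the ideal. -/
theorem exists_isSeparation (hf : Module.Finite k (MvPolynomial (Fin n) k ⧸
    Ideal.span (Set.range f))) : ∃ q, IsSeparation f q := by
  have h : ∀ i, ∃ (p : Polynomial k) (c : Fin n → MvPolynomial (Fin n) k), p.Monic ∧
      Polynomial.aeval (X i) p = ∑ j, c j * f j := by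
    intro i
    obtain ⟨p, hp, h0⟩ := Algebra.IsIntegral.isIntegral (R := k)
      (Ideal.Quotient.mkₐ k (Ideal.span (Set.range f)) (X i))
    have h1 : Polynomial.aeval (X i : MvPolynomial (Fin n) k) p ∈ Ideal.span (Set.range f) := by
      rw [← Ideal.Quotient.eq_zero_iff_mem, ← Ideal.Quotient.mkₐ_eq_mk k,
        ← Polynomial.aeval_algHom_apply]
      exact h0
    obtain ⟨c, hc⟩ := (Ideal.mem_span_range_iff_exists_fun).1 h1
    exact ⟨p, c, hp, hc.symm⟩
  choose p c hp hc using h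
  exact ⟨(p, Matrix.of c), hp, hc⟩

/-- The residue symbol over an extension, by the transformation rule. -/
theorem exists_residueExt_eq_sepResidue [Nontrivial B] (hf : Module.Finite k
    (MvPolynomial (Fin n) k ⧸ Ideal.span (Set.range f))) :
    ∃ (p : Fin n → Polynomial B) (M : Matrix (Fin n) (Fin n) (MvPolynomial (Fin n) B)),
      IsSeparation (fun j => MvPolynomial.map (algebraMap k B) (f j)) (p, M) ∧
      ∀ g, residueExt B f g = sepResidue p (M.det * g) := by
  -- By proof irrelevance `h.choose` is the very separation used in the definition of `residue`. Its
  -- base change is taken, so independence of the choice is not needed.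
  have h := exists_isSeparation hf
  refine ⟨fun i => (h.choose.1 i).map (algebraMap k B),
    h.choose.2.map (MvPolynomial.map (algebraMap k B)), ⟨fun i => (h.choose_spec.1 i).map _, ?_⟩, ?_⟩
  · intro i
    have h1 := congrArg (MvPolynomial.map (algebraMap k B)) (h.choose_spec.2 i)
    rw [map_sum] at h1
    simp only [map_mul] at h1
    refine Eq.trans ?_ h1
    rw [Polynomial.aeval_map_algebraMap]
    have := Polynomial.hom_eval₂ (h.choose.1 i) (algebraMap k (MvPolynomial (Fin n) k))
      (MvPolynomial.map (algebraMap k B)) (X i)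
    rw [Polynomial.aeval_def, Polynomial.aeval_def, this, map_X]
    congr 1
    ext a
    simp [IsScalarTower.algebraMap_apply k B (MvPolynomial (Fin n) B)]
  · intro g
    suffices hs : residueExt B f = sepResidue (fun i => (h.choose.1 i).map (algebraMap k B)) ∘ₗ
        LinearMap.mulLeft B (h.choose.2.map (MvPolynomial.map (algebraMap k B))).det from
      LinearMap.congr_fun hs g
    refine (basisMonomials (Fin n) B).ext fun s => ?_
    have hm : monomial s (1 : B) = MvPolynomial.map (algebraMap k B) (monomial s 1) := by simp
    have hd : (h.choose.2.map (MvPolynomial.map (algebraMap k B))).det =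
        MvPolynomial.map (algebraMap k B) h.choose.2.det := by
      rw [RingHom.map_det]; rfl
    rw [coe_basisMonomials, LinearMap.comp_apply, LinearMap.mulLeft_apply]
    beta_reduce
    rw [hm, residueExt_map, hd,
      ← map_mul, sepResidue_map _ h.choose_spec.1, residue, dif_pos h]
    rfl

end Residue

/-! ### Shuffle signs -/

section Shuffle

variable {r : ℕ}

theorem shuffleInv_eq_sum (a : Finset (Fin r)) :
    shuffleInv a = ∑ p ∈ a, (aᶜ.filter (· < p)).card := by
  rw [shuffleInv, Finset.card_filter, Finset.sum_product]
  exact Finset.sum_congr rfl fun p _ => (Finset.card_filter _ _).symm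

/-- Moving $i$ from the complement into $a$ creates the inversions with the $q\notin a$, $q<i$, and
destroys those with the $p\in a$, $p>i$. -/
theorem shuffleInv_insert {a : Finset (Fin r)} {i : Fin r} (hi : i ∉ a) :
    shuffleInv (insert i a) + (a.filter (i < ·)).card =
      shuffleInv a + (aᶜ.filter (· < i)).card := by
  have hc : (insert i a)ᶜ = aᶜ.erase i := by
    ext j; simp
  have hic : i ∈ aᶜ := by simpa using hi
  rw [shuffleInv_eq_sum, shuffleInv_eq_sum, Finset.sum_insert hi, hc, Finset.filter_erase,
    Finset.erase_eq_of_notMem (by simp), Finset.card_filter (fun j => i < j), add_assoc,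
    ← Finset.sum_add_distrib, add_comm]
  congr 1
  refine Finset.sum_congr rfl fun p _ => ?_
  rw [Finset.filter_erase]
  split_ifs with h
  · exact Finset.card_erase_add_one (by simp [hi, h])
  · rw [Finset.erase_eq_of_notMem (by simp [h]), add_zero]

theorem card_filter_lt_add_card_filter_gt {a : Finset (Fin r)} {i : Fin r} (hi : i ∉ a) :
    (a.filter (· < i)).card + (a.filter (i < ·)).card = a.card := by
  rw [← Finset.card_union_of_disjoint]
  · congr 1
    ext j
    simp only [Finset.mem_union, Finset.mem_filter]
    constructor
    · rintro (h | h) <;> exact h.1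
    · intro h
      rcases lt_trichotomy j i with h' | h' | h'
      · exact Or.inl ⟨h, h'⟩
      · exact absurd (h' ▸ h) hi
      · exact Or.inr ⟨h, h'⟩
  · rw [Finset.disjoint_filter]
    exact fun j _ h1 h2 => lt_asymm h1 h2

end Shuffle

/-! ### The coevaluation -/

section SignedDescProd

variable {ι B : Type*} [Fintype ι] [DecidableEq ι] [CommRing B] {r : ℕ}

/-- The products `M_{b_l} ⋯ M_{b₁}` over the complement `b` of `a` with the signs of the
coevaluation. -/
def coevCoeff (par : ι → ZMod 2) (T : Fin r → Matrix ι ι B) (a : Finset (Fin r)) : Matrix ι ι B :=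
  (-1 : B) ^ shuffleInv a • (sgnMat B par ^ (aᶜ.card + 1) * descProd aᶜ T)

variable {par : ι → ZMod 2} {T : Fin r → Matrix ι ι B}

theorem sgnMat_pow_add_two (l : ℕ) : sgnMat B par ^ (l + 2) = sgnMat B par ^ l := by
  rw [pow_add, sq, sgnMat_mul_self, mul_one]

theorem HasParity.sgnMat_pow_mul' {g : ZMod 2} {M : Matrix ι ι B} (hM : HasParity par g M) (l : ℕ) :
    LG.sgnMat B par ^ l * M = sgn B g ^ l • (M * LG.sgnMat B par ^ l) := by
  induction l with
  | zero => simp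
  | succ l ih =>
    rw [pow_succ', Matrix.mul_assoc, ih, Matrix.mul_smul, ← Matrix.mul_assoc,
      hM.sgnMat_mul, Matrix.smul_mul, smul_smul, pow_succ, Matrix.mul_assoc]

theorem coevCoeff_commutator (D D' : Matrix ι ι B) (hD' : HasParity par 1 D')
    (hT : ∀ i, HasParity par 1 (T i)) (a : Finset (Fin r)) :
    D' * coevCoeff par T a * sgnMat B par - coevCoeff par T a * sgnMat B par * D =
      (-((-1 : B) ^ (aᶜ.card + shuffleInv a))) • (sgnMat B par ^ aᶜ.card *
        (descProd aᶜ T * D - (-1 : B) ^ aᶜ.card • (D' * descProd aᶜ T))) := by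
  set l := aᶜ.card
  have hP := HasParity.descProd hT aᶜ
  have h1 : descProd aᶜ T * sgnMat B par = (-1 : B) ^ l • (sgnMat B par * descProd aᶜ T) := by
    rw [hP.mul_sgnMat, sgn_natCast]
  have h2 : sgnMat B par ^ (l + 1) * (sgnMat B par * descProd aᶜ T) =
      sgnMat B par ^ l * descProd aᶜ T := by
    rw [← Matrix.mul_assoc, ← pow_succ, sgnMat_pow_add_two]
  have h3 : D' * sgnMat B par ^ l = (-1 : B) ^ l • (sgnMat B par ^ l * D') := by
    rw [hD'.sgnMat_pow_mul, smul_smul, ← pow_add, ← two_mul, pow_mul]; simp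
  have hsq : ((-1 : B) ^ l) * (-1) ^ l = 1 := by rw [← pow_add, ← two_mul, pow_mul]; simp
  have h4 : coevCoeff par T a * sgnMat B par =
      ((-1 : B) ^ (l + shuffleInv a)) • (sgnMat B par ^ l * descProd aᶜ T) := by
    rw [coevCoeff, Matrix.smul_mul, Matrix.mul_assoc, h1, Matrix.mul_smul, h2, smul_smul, pow_add,
      mul_comm]
  rw [Matrix.mul_assoc, h4, Matrix.mul_smul, ← Matrix.mul_assoc, h3, Matrix.mul_sub,
    Matrix.mul_smul, Matrix.smul_mul, Matrix.smul_mul, smul_sub, smul_smul, smul_smul,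
    Matrix.mul_assoc, Matrix.mul_assoc, neg_smul, neg_mul, neg_smul]
  abel

/-- The coefficient at $\theta_a$ of the statement that the coevaluation commutes with the
differentials. The products run over the complement of $a$, which exchanges deleting and inserting,
so the right-hand side is the transposed differential of the unit. -/
theorem coevCoeff_identity (D : ℕ → Matrix ι ι B) (w u : Fin r → B)
    (hD : HasParity par 1 (D r)) (hT : ∀ i, HasParity par 1 (T i))
    (hw : ∀ i : Fin r, D (i + 1) * T i + T i * D i = (-w i) • (1 : Matrix ι ι B))
    (hu : ∀ i : Fin r, D i - D (i + 1) = u i • T i) (a : Finset (Fin r)) :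
    (-1 : B) ^ r • (D r * coevCoeff par T a * sgnMat B par - coevCoeff par T a * sgnMat B par * D 0) =
      ∑ i, koszulSign B i a • if i ∈ a then u i • coevCoeff par T (a.erase i)
        else w i • coevCoeff par T (insert i a) := by
  rw [coevCoeff_commutator (D 0) (D r) hD hT, descProd_telescope D T _ u hw hu, Matrix.mul_sum,
    Finset.smul_sum, Finset.smul_sum]
  have hca : aᶜ.card + a.card = r := by
    rw [Finset.card_compl_add_card, Fintype.card_fin]
  refine Finset.sum_congr rfl fun i _ => ?_
  rw [Matrix.mul_smul]
  by_cases hi : i ∈ a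
  · have hi' : i ∉ aᶜ := by simpa using hi
    have hcc : (a.erase i)ᶜ = insert i aᶜ := by
      ext j; simp only [Finset.mem_compl, Finset.mem_erase, Finset.mem_insert]; tauto
    have hs := shuffleInv_insert (Finset.notMem_erase i a)
    rw [Finset.insert_erase hi, hcc, Finset.filter_insert, if_neg (lt_irrefl i)] at hs
    have hk := card_filter_lt_add_card_filter_gt (Finset.notMem_erase i a)
    have hc := Finset.card_erase_add_one hi
    rw [if_neg hi', if_pos hi, coevCoeff, hcc, Finset.card_insert_of_notMem hi',
      sgnMat_pow_add_two, Matrix.mul_smul, smul_smul, smul_smul, smul_smul, smul_smul, smul_smul,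
      ← koszulSign_erase i a]
    congr 1
    unfold koszulSign
    -- Parity count from the change `hs` of the shuffle sign, the splitting `hk` of `a.erase i` at
    -- `i`, and $|a|+|a^c|=r$.
    have : (-1 : B) ^ (r + (aᶜ.card + shuffleInv a) + (aᶜ.filter (· < i)).card + 1) =
        (-1) ^ (((a.erase i).filter (· < i)).card + shuffleInv (a.erase i)) := by
      refine neg_one_pow_congr ?_
      simp only [Nat.even_iff]
      omega
    simp only [pow_add, pow_one] at this ⊢
    linear_combination u i * this
  · have hi' : i ∈ aᶜ := by simpa using hi
    have hcc : (insert i a)ᶜ = aᶜ.erase i := by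
      ext j; simp only [Finset.mem_compl, Finset.mem_erase, Finset.mem_insert]; tauto
    have hs := shuffleInv_insert hi
    have hk := card_filter_lt_add_card_filter_gt hi
    rw [if_pos hi', if_neg hi, coevCoeff, hcc, Finset.card_erase_add_one hi',
      Matrix.mul_smul, smul_smul, smul_smul, smul_smul, smul_smul, smul_smul]
    congr 1
    unfold koszulSign
    have : (-1 : B) ^ r * (((-1 : B) ^ (aᶜ.card + shuffleInv a)) *
        (-1) ^ (aᶜ.filter (· < i)).card) =
        (-1) ^ (a.filter (· < i)).card * (-1) ^ shuffleInv (insert i a) := by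
      rw [← pow_add, ← pow_add, ← pow_add]
      refine neg_one_pow_congr ?_
      simp only [Nat.even_iff]
      omega
    linear_combination w i * this

end SignedDescProd

/-! ### The coevaluation is a morphism. -/

section Coev

variable {k : Type*} [CommRing k] {n m : ℕ} {ι : Type*} [Fintype ι] [DecidableEq ι]
  {B : Type*} [CommRing B] [Algebra k B] (X : Based ι (ZX k m n)) {W : MvPolynomial (Fin n) k}
  {V : MvPolynomial (Fin m) k}

theorem daggerAt_mulVec (z : Fin m → B) (x : Fin n → B) (v : ι → B) (j : ι) :
    (daggerAt X z x).D.mulVec v j =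
      -((-1) ^ n * ∑ i, sgn B (X.par i) * v i * evalD X z x i j) := by
  rw [Finset.mul_sum, ← Finset.sum_neg_distrib, Matrix.mulVec, dotProduct]
  refine Finset.sum_congr rfl fun i _ => ?_
  simp only [daggerAt, Based.shift, Based.dual, atPoint, Based.map, Matrix.smul_apply,
    Matrix.of_apply, smul_eq_mul, evalD]
  ring

theorem unitAt_vecMul (x x' : Fin n → B) (f : Finset (Fin n) → B) (b : Finset (Fin n)) :
    Matrix.vecMul f (unitAt W x x').D b = ∑ i, koszulSign B i b *
      if i ∈ b then (x i - x' i) * f (b.erase i)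
      else diffQuot (hybrid x x' i) i (x i) (x' i) W * f (insert i b) := by
  rw [← Matrix.mulVec_transpose, unitAt, Matrix.transpose_sum, Matrix.sum_mulVec, Finset.sum_apply]
  refine Finset.sum_congr rfl fun i _ => ?_
  rw [Matrix.transpose_add, Matrix.transpose_smul, Matrix.transpose_smul, ← contract_eq_transpose,
    contract_eq_transpose, Matrix.transpose_transpose, ← contract_eq_transpose,
    Matrix.add_mulVec, Matrix.smul_mulVec, Matrix.smul_mulVec, Pi.add_apply, Pi.smul_apply,
    Pi.smul_apply, wedge_mulVec, contract_mulVec]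
  split_ifs <;> simp [smul_eq_mul] <;> ring

theorem coevAt_apply (x x' : Fin n → B) (v : Finset (Fin n) → B) (p : ι × ι) :
    coevAt X x x' v p = ∑ a, coevCoeff X.par
      (diffX X MvPolynomial.X (fun j => C (x j)) fun j => C (x' j)) a p.2 p.1 * C (v a) := by
  rw [coevAt, ofMatrix_apply, Matrix.mulVec, dotProduct]
  refine Finset.sum_congr rfl fun a _ => ?_
  rw [Matrix.of_apply, coevCoeff, Matrix.smul_apply, sgnMat_pow_mul_apply, smul_eq_mul, pow_add,
    algebraMap_eq]
  ring

theorem map_unitAt_mulVec {B' : Type*} [CommRing B'] [Algebra k B'] (φ : B →ₐ[k] B')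
    (x x' : Fin n → B) (v : Finset (Fin n) → B) (b : Finset (Fin n)) :
    φ ((unitAt W x x').D.mulVec v b) =
      (unitAt W (fun i => φ (x i)) fun i => φ (x' i)).D.mulVec (fun c => φ (v c)) b := by
  rw [unitAt_mulVec, unitAt_mulVec, map_sum]
  refine Finset.sum_congr rfl fun i _ => ?_
  have hh : (fun j => φ (hybrid x x' i j)) = hybrid (fun i => φ (x i)) (fun i => φ (x' i)) i := by
    ext1 j
    simp only [hybrid]
    split_ifs <;> rfl
  have hk : φ (koszulSign B i b) = koszulSign B' i b := by simp [koszulSign]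
  rw [map_mul, hk]
  split_ifs
  · rw [map_mul, map_diffQuot, hh]
  · rw [map_mul, map_sub]

theorem sum_mul_unitAt_mulVec (x x' : Fin n → B) (M : Finset (Fin n) → Matrix ι ι B)
    (v : Finset (Fin n) → B) (i j : ι) :
    ∑ a, M a j i * (unitAt W x x').D.mulVec v a =
      ∑ a, (∑ c, koszulSign B c a •
        if c ∈ a then (x c - x' c) • M (a.erase c) else
          diffQuot (hybrid x x' c) c (x c) (x' c) W • M (insert c a)) j i * v a := by
  have h := Matrix.dotProduct_mulVec (fun b => M b j i) (unitAt W x x').D v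
  refine h.trans (Finset.sum_congr rfl fun a _ => ?_)
  rw [unitAt_vecMul, Matrix.sum_apply]
  congr 1
  refine Finset.sum_congr rfl fun c _ => ?_
  rw [Matrix.smul_apply, smul_eq_mul]
  split_ifs <;> rfl

/-- Reading the coefficient of $e_i^*\otimes e_j$ as a matrix entry $(j,i)$ turns the tensor
differential into a commutator with $d_X(x')$ on the left and $d_X(x)$ on the right. The factor
$(-1)^n$ comes from the shift in $X^\dagger$. -/
theorem dagger_tensor_mulVec {α : Type*} [Fintype α] (z : Fin m → B) (x x' : Fin n → B)
    (M : α → Matrix ι ι B) (c : α → B) (i j : ι) :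
    ((daggerAt X z x).tensor (atPoint X z x')).D.mulVec
        (fun q => ∑ a, M a q.2 q.1 * c a) (i, j) =
      ∑ a, ((-1 : B) ^ n • (evalD X z x' * M a * sgnMat B X.par -
          M a * sgnMat B X.par * evalD X z x)) j i * c a := by
  rw [tensor_mulVec, daggerAt_mulVec]
  have hpar : (daggerAt X z x).par i = X.par i + n := rfl
  have hs : sgn B (X.par i + n) = sgn B (X.par i) * (-1) ^ n := by rw [sgn_add, sgn_natCast]
  have e1 : ∑ q, sgn B (X.par q) * (∑ a, M a j q * c a) * evalD X z x q i =
      ∑ a, (M a * sgnMat B X.par * evalD X z x) j i * c a := by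
    simp only [Matrix.mul_apply (M := M _ * _), sgnMat, Matrix.mul_diagonal,
      Finset.mul_sum, Finset.sum_mul]
    rw [Finset.sum_comm]
    refine Finset.sum_congr rfl fun a _ => Finset.sum_congr rfl fun q _ => ?_
    ring
  have e2 : (evalD X z x').mulVec (fun q => ∑ a, M a q i * c a) j =
      ∑ a, (evalD X z x' * M a) j i * c a := by
    simp only [Matrix.mul_apply, Matrix.mulVec, dotProduct, Finset.mul_sum, Finset.sum_mul]
    rw [Finset.sum_comm]
    refine Finset.sum_congr rfl fun a _ => Finset.sum_congr rfl fun q _ => ?_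
    ring
  rw [hpar, hs, e1]
  change _ + _ * (evalD X z x').mulVec (fun q => ∑ a, M a q i * c a) j = _
  rw [e2, Finset.mul_sum, Finset.mul_sum, ← Finset.sum_neg_distrib, ← Finset.sum_add_distrib]
  refine Finset.sum_congr rfl fun a _ => ?_
  rw [Matrix.smul_apply, Matrix.sub_apply, sgnMat, Matrix.mul_diagonal, smul_eq_mul]
  ring

variable {X}

theorem isMorphism_coev (hX : X.IsFactorisation (difference W V)) :
    IsMorphism (unit W) (daggerTensor X) (coev X) := by
  constructor
  · refine hasDegree_ofMatrix _ _ _ _ fun p a h => ?_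
    have h1 := (HasParity.descProd (hasParity_diffX hX MvPolynomial.X
      (fun j => (C (leftVar k n j) : MvPolynomial (Fin m) (Env k n)))
      fun j => C (rightVar k n j)) aᶜ) p.2 p.1 (right_ne_zero_of_mul h)
    have hca : (aᶜ.card : ZMod 2) + a.card = n := by
      rw [← Nat.cast_add, Finset.card_compl_add_card, Fintype.card_fin]
    change X.par p.1 + (n : ZMod 2) + X.par p.2 = (a.card : ZMod 2) + 0
    rw [h1, ← hca]
    linear_combination (X.par p.1 + (aᶜ.card : ZMod 2)) * (CharTwo.two_eq_zero (R := ZMod 2))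
  · intro v
    ext1 ⟨i, j⟩
    have hcoev : ∀ v, coev X v = fun q => ∑ a, coevCoeff X.par
        (diffX X MvPolynomial.X (fun j => C (leftVar k n j)) fun j => C (rightVar k n j)) a q.2 q.1 *
          (C (v a) : MvPolynomial (Fin m) (Env k n)) := fun v =>
      _root_.funext fun q => coevAt_apply X (leftVar k n) (rightVar k n) v q
    have hC : ∀ b, (C ((unit W).D.mulVec v b) : MvPolynomial (Fin m) (Env k n)) =
        (unitAt W (fun j => C (leftVar k n j)) fun j => C (rightVar k n j)).D.mulVec
          (fun a => C (v a)) b := fun b =>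
      map_unitAt_mulVec (IsScalarTower.toAlgHom k (Env k n) (MvPolynomial (Fin m) (Env k n)))
        (leftVar k n) (rightVar k n) v b
    rw [hcoev, hcoev, daggerTensor, dagger_tensor_mulVec]
    simp only [hC]
    rw [sum_mul_unitAt_mulVec]
    refine Finset.sum_congr rfl fun a _ => ?_
    have key := coevCoeff_identity (par := X.par) (fun t => evalD X MvPolynomial.X
      (mixed (fun j => (C (leftVar k n j) : MvPolynomial (Fin m) (Env k n)))
        (fun j => C (rightVar k n j)) t))
      _ _ (hasParity_evalD hX _ _) (hasParity_diffX hX _ _ _)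
      (evalD_succ_mul_diffX _ _ _ hX) (evalD_sub_evalD_x _ _ _ X) a
    simp only [mixed_zero, mixed_self] at key
    rw [key]

end Coev

/-! ### The evaluation -/

section EvCoeff

variable {ι B : Type*} [Fintype ι] [DecidableEq ι] [CommRing B] {r : ℕ}

/-- Graded Leibniz rule: each commutator is a scalar in $I$. It is applied to
$\lambda_1,\dots,\lambda_n$ and the ideal of the $\partial_iW$. -/
theorem list_prod_commutator_mem (I : Ideal B) (D : Matrix ι ι B) (l : List (Matrix ι ι B))
    (h : ∀ M ∈ l, ∃ c ∈ I, D * M + M * D = c • (1 : Matrix ι ι B)) (i j : ι) :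
    (D * l.prod - (-1 : B) ^ l.length • (l.prod * D)) i j ∈ I := by
  induction l generalizing i j with
  | nil => simp
  | cons M l ih =>
    obtain ⟨c, hc, hM⟩ := h M (by simp)
    have e : D * (M * l.prod) - (-1 : B) ^ (l.length + 1) • (M * l.prod * D) =
        c • l.prod - M * (D * l.prod - (-1 : B) ^ l.length • (l.prod * D)) := by
      have h1 : D * M = c • (1 : Matrix ι ι B) - M * D := by rw [← hM]; abel
      rw [← Matrix.mul_assoc, h1, Matrix.sub_mul, Matrix.mul_sub, Matrix.mul_smul, pow_succ,
        Matrix.smul_mul, Matrix.one_mul, Matrix.mul_assoc, Matrix.mul_assoc, mul_neg_one, neg_smul]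
      abel
    rw [List.prod_cons, List.length_cons, e, Matrix.sub_apply, Matrix.smul_apply, Matrix.mul_apply]
    exact I.sub_mem (I.mul_mem_right _ hc) (I.sum_mem fun a _ => I.mul_mem_left _
      (ih (fun N hN => h N (by simp [hN])) a j))

/-- The products `M_{b_l} ⋯ M_{b₁} Λ` with the signs of the evaluation, for `Λ` of degree `n`. -/
def evCoeff (par : ι → ZMod 2) (n : ℕ) (T : Fin r → Matrix ι ι B) (L : Matrix ι ι B)
    (b : Finset (Fin r)) : Matrix ι ι B :=
  (-1 : B) ^ b.card • (descProd b T * L * sgnMat B par ^ (n + 1))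

variable {par : ι → ZMod 2} {n : ℕ} {T : Fin r → Matrix ι ι B} {L : Matrix ι ι B}

theorem HasParity.evCoeff (hT : ∀ i, HasParity par 1 (T i)) (hL : HasParity par n L)
    (b : Finset (Fin r)) : HasParity par (b.card + n) (LG.evCoeff par n T L b) := by
  have hS : ∀ l : ℕ, HasParity par 0 (LG.sgnMat B par ^ l) := fun l => by
    induction l with
    | zero => exact HasParity.one
    | succ l ih => exact (ih.mul HasParity.sgnMat).cast (by simp)
  exact HasParity.smul _ ((((HasParity.descProd hT b).mul hL).mul (hS _)).cast (by simp))

/-- Telescoping accounts for the descending product alone. The failure of $D_0$ to commute with `L`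
remains as the last summand and disappears only under the residue. -/
theorem evCoeff_identity (D : ℕ → Matrix ι ι B) (w u : Fin r → B)
    (hD : ∀ t, HasParity par 1 (D t)) (hT : ∀ i, HasParity par 1 (T i)) (hL : HasParity par n L)
    (hw : ∀ i : Fin r, D (i + 1) * T i + T i * D i = w i • (1 : Matrix ι ι B))
    (hu : ∀ i : Fin r, D i - D (i + 1) = u i • T i) (b : Finset (Fin r)) :
    evCoeff par n T L b * D 0 - (-1 : B) ^ n •
        (sgnMat B par * (D r * evCoeff par n T L b) * sgnMat B par) =
      (∑ i, koszulSign B i b • if i ∈ b then w i • evCoeff par n T L (b.erase i)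
        else u i • evCoeff par n T L (insert i b)) +
      (-1 : B) ^ b.card • (descProd b T * (D 0 * L - (-1 : B) ^ n • (L * D 0)) *
        sgnMat B par ^ (n + 1)) := by
  have hsq : ∀ l : ℕ, ((-1 : B) ^ l) * (-1) ^ l = 1 := fun l => by
    rw [← pow_add, ← two_mul, pow_mul]; simp
  have key := descProd_telescope D T w u hw hu b
  have hsum : ∀ i, (koszulSign B i b • if i ∈ b then w i • evCoeff par n T L (b.erase i)
        else u i • evCoeff par n T L (insert i b)) =
      -((-1 : B) ^ b.card • ((koszulSign B i b • if i ∈ b then w i • descProd (b.erase i) T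
        else u i • descProd (insert i b) T) * L * sgnMat B par ^ (n + 1))) := by
    intro i
    split_ifs with hi
    · rw [evCoeff, ← Finset.card_erase_add_one hi]
      simp only [Matrix.smul_mul, smul_smul, ← neg_smul]
      congr 1
      ring
    · rw [evCoeff, Finset.card_insert_of_notMem hi]
      simp only [Matrix.smul_mul, smul_smul, ← neg_smul]
      congr 1
      ring
  have h1 : evCoeff par n T L b * D 0 =
      (-1 : B) ^ (b.card + n + 1) • (descProd b T * (L * D 0) * sgnMat B par ^ (n + 1)) := by
    rw [evCoeff, Matrix.smul_mul, Matrix.mul_assoc, (hD 0).sgnMat_pow_mul, Matrix.mul_smul,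
      smul_smul, add_assoc, pow_add (-1 : B) b.card (n + 1)]
    simp only [Matrix.mul_assoc]
  have h2 : sgnMat B par * (D r * evCoeff par n T L b) * sgnMat B par =
      (-1 : B) ^ (n + 1) • (D r * (descProd b T * L * sgnMat B par ^ (n + 1))) := by
    have hp := ((hD r).mul (HasParity.evCoeff hT hL b)).cast
      (show (1 : ZMod 2) + (b.card + n) = ((b.card + n + 1 : ℕ) : ZMod 2) by push_cast; ring)
    rw [hp.sgnMat_mul_mul_sgnMat, sgn_natCast, evCoeff, Matrix.mul_smul, smul_smul]
    congr 1
    linear_combination (-1) ^ (n + 1) * hsq b.card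
  rw [Finset.sum_congr rfl fun i _ => hsum i, Finset.sum_neg_distrib, ← Finset.smul_sum,
    ← Matrix.sum_mul, ← Matrix.sum_mul, ← key, h1, h2]
  simp only [Matrix.mul_sub, Matrix.sub_mul, Matrix.smul_mul, Matrix.mul_smul, smul_sub, smul_smul,
    Matrix.mul_assoc, hsq]
  have hn : (-1 : B) ^ n * (-1) ^ (n + 1) = -1 := by rw [pow_succ]; linear_combination -(hsq n)
  rw [hn, pow_succ, pow_add]
  module

end EvCoeff

/-! ### The evaluation is a morphism. -/

section Ev

variable {k : Type*} [CommRing k] {n m : ℕ} {ι : Type*} [Fintype ι] [DecidableEq ι]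
  {B : Type*} [CommRing B] [Algebra k B] (X : Based ι (ZX k m n)) {W : MvPolynomial (Fin n) k}
  {V : MvPolynomial (Fin m) k} (lam : Fin n → Matrix ι ι (ZX k m n))

/-- The matrix `λ₁ ⋯ λₙ` with the coordinates `z, x`. -/
noncomputable def lamProd (z : Fin m → B) (x : Fin n → B) : Matrix ι ι B :=
  (List.ofFn lam).prod.map (aeval (Sum.elim z x))

theorem lamProd_eq (z : Fin m → B) (x : Fin n → B) :
    lamProd lam z x = (List.ofFn fun i => (lam i).map (aeval (Sum.elim z x))).prod := by
  have := map_list_prod (RingHom.mapMatrix (m := ι)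
    ((aeval (Sum.elim z x) : ZX k m n →ₐ[k] B) : ZX k m n →+* B)) (List.ofFn lam)
  rw [List.map_ofFn] at this
  exact this

variable {X lam}

theorem nullHomotopy_map (hlam : IsNullHomotopy W X lam) (z : Fin m → B) (x : Fin n → B)
    (i : Fin n) :
    evalD X z x * (lam i).map (aeval (Sum.elim z x)) + (lam i).map (aeval (Sum.elim z x)) *
      evalD X z x = aeval x (pderiv i W) • (1 : Matrix ι ι B) := by
  have h := congrArg (fun M => M.map (aeval (Sum.elim z x) : ZX k m n →ₐ[k] B)) (hlam i).2
  rw [Matrix.map_add _ (map_add _)] at h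
  simp only [Matrix.map_mul] at h
  refine h.trans ?_
  ext a b
  rw [Matrix.map_apply, Matrix.smul_apply, Matrix.smul_apply, smul_eq_mul, smul_eq_mul, map_mul,
    aeval_rename, Sum.elim_comp_inr, Matrix.one_apply, Matrix.one_apply]
  split_ifs <;> simp

theorem hasParity_lamProd (hlam : IsNullHomotopy W X lam) (z : Fin m → B) (x : Fin n → B) :
    HasParity X.par n (lamProd lam z x) := by
  rw [lamProd_eq]
  have := HasParity.list_prod (par := X.par)
    (List.ofFn fun i => (lam i).map (aeval (Sum.elim z x) : ZX k m n →ₐ[k] B)) (by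
      intro M hM
      obtain ⟨i, rfl⟩ := (List.mem_ofFn).1 hM
      exact HasParity.map _ (map_zero _) (hlam i).1)
  simpa using this

variable (lam) in
theorem evAt_apply (W : MvPolynomial (Fin n) k) (X : Based ι (ZX k m n)) (z z' : Fin m → B)
    (v : ι × ι → MvPolynomial (Fin n) B) (b : Finset (Fin m)) :
    evAt W X lam z z' v b = residueExt B (fun i => pderiv i W) (∑ p, evCoeff X.par n
      (diffZ X (fun j => C (z j)) (fun j => C (z' j)) MvPolynomial.X)
      (lamProd lam (fun j => C (z j)) MvPolynomial.X) b p.2 p.1 * v p) := by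
  rw [evAt, LinearMap.pi_apply, LinearMap.sum_apply, map_sum]
  refine Finset.sum_congr rfl fun p _ => ?_
  rw [LinearMap.comp_apply, LinearMap.comp_apply, LinearMap.mulLeft_apply, LinearMap.proj_apply,
    evCoeff, Matrix.smul_apply, mul_sgnMat_pow_apply, smul_eq_mul, pow_add, mul_assoc, lamProd]
  simp only [mul_assoc]

theorem sum_mul_tensor_dagger_mulVec (z z' : Fin m → B) (x : Fin n → B) (E : Matrix ι ι B)
    (v : ι × ι → B) :
    ∑ p, E p.2 p.1 * ((atPoint X z x).tensor (daggerAt X z' x)).D.mulVec v p =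
      ∑ p, (E * evalD X z x - (-1 : B) ^ n •
        (sgnMat B X.par * (evalD X z' x * E) * sgnMat B X.par)) p.2 p.1 * v p := by
  have e1 : ∑ p : ι × ι, E p.2 p.1 * (evalD X z x).mulVec (fun a => v (a, p.2)) p.1 =
      ∑ p : ι × ι, (E * evalD X z x) p.2 p.1 * v p := by
    simp only [Fintype.sum_prod_type, Matrix.mulVec, dotProduct, Matrix.mul_apply, Finset.mul_sum,
      Finset.sum_mul]
    rw [Finset.sum_comm]
    conv_rhs => rw [Finset.sum_comm]
    refine Finset.sum_congr rfl fun j _ => ?_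
    rw [Finset.sum_comm]
    exact Finset.sum_congr rfl fun a _ => Finset.sum_congr rfl fun i _ => by ring
  have e2 : ∑ p : ι × ι, E p.2 p.1 * (sgn B (X.par p.1) *
        ∑ c, sgn B (X.par c) * v (p.1, c) * evalD X z' x c p.2) =
      ∑ p : ι × ι, (sgnMat B X.par * (evalD X z' x * E) * sgnMat B X.par) p.2 p.1 * v p := by
    simp only [sgnMat, Matrix.mul_diagonal, Matrix.diagonal_mul]
    simp only [Fintype.sum_prod_type, Matrix.mul_apply, Finset.mul_sum, Finset.sum_mul]
    refine Finset.sum_congr rfl fun i _ => ?_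
    rw [Finset.sum_comm]
    exact Finset.sum_congr rfl fun c _ => Finset.sum_congr rfl fun j _ => by ring
  have e3 : ∀ p : ι × ι, E p.2 p.1 * ((atPoint X z x).tensor (daggerAt X z' x)).D.mulVec v p =
      E p.2 p.1 * (evalD X z x).mulVec (fun a => v (a, p.2)) p.1 -
        (-1) ^ n * (E p.2 p.1 * (sgn B (X.par p.1) *
        ∑ c, sgn B (X.par c) * v (p.1, c) * evalD X z' x c p.2)) := fun p => by
    rw [show p = (p.1, p.2) from rfl, tensor_mulVec, daggerAt_mulVec]
    change _ * ((evalD X z x).mulVec (fun a => v (a, p.2)) p.1 + sgn B (X.par p.1) * _) = _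
    ring
  rw [Finset.sum_congr rfl fun p _ => e3 p, Finset.sum_sub_distrib, ← Finset.mul_sum, e1, e2,
    Finset.mul_sum, ← Finset.sum_sub_distrib]
  refine Finset.sum_congr rfl fun p _ => ?_
  rw [Matrix.sub_apply, Matrix.smul_apply, smul_eq_mul]
  ring

theorem aeval_X_eq_map_algebraMap (f : MvPolynomial (Fin n) k) :
    aeval (MvPolynomial.X : Fin n → MvPolynomial (Fin n) B) f =
      MvPolynomial.map (algebraMap k B) f := by
  have : aeval (MvPolynomial.X : Fin n → MvPolynomial (Fin n) B) =
      mapAlgHom (σ := Fin n) (Algebra.ofId k B) := by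
    ext j; simp
  rw [this]; rfl

theorem residueExt_sum_commutator_eq_zero (hlam : IsNullHomotopy W X lam) (z : Fin m → B)
    (P Q : Matrix ι ι (MvPolynomial (Fin n) B)) (c : MvPolynomial (Fin n) B)
    (v : ι × ι → MvPolynomial (Fin n) B) :
    residueExt B (fun i => pderiv i W) (∑ p, (c • (P *
      (evalD X (fun j => C (z j)) MvPolynomial.X * lamProd lam (fun j => C (z j)) MvPolynomial.X -
      (-1 : MvPolynomial (Fin n) B) ^ n • (lamProd lam (fun j => C (z j)) MvPolynomial.X *
        evalD X (fun j => C (z j)) MvPolynomial.X)) * Q)) p.2 p.1 * v p) = 0 := by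
  refine residueExt_eq_zero_of_mem B ?_
  set I := Ideal.span (Set.range fun j => MvPolynomial.map (algebraMap k B) (pderiv j W))
  have h := list_prod_commutator_mem I (evalD X (fun j => C (z j)) MvPolynomial.X)
    (List.ofFn fun i => (lam i).map
      (aeval (Sum.elim (fun j => (C (z j) : MvPolynomial (Fin n) B)) MvPolynomial.X))) (by
      intro M hM
      obtain ⟨i, rfl⟩ := (List.mem_ofFn).1 hM
      refine ⟨_, ?_, nullHomotopy_map hlam _ _ i⟩
      rw [aeval_X_eq_map_algebraMap]
      exact Ideal.subset_span ⟨i, rfl⟩)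
  rw [← lamProd_eq, List.length_ofFn] at h
  refine I.sum_mem fun p _ => I.mul_mem_right _ ?_
  rw [Matrix.smul_apply, smul_eq_mul, Matrix.mul_apply]
  refine I.mul_mem_left _ (I.sum_mem fun a _ => I.mul_mem_right _ ?_)
  rw [Matrix.mul_apply]
  exact I.sum_mem fun a _ => I.mul_mem_left _ (h _ _)

theorem isMorphism_ev (hX : X.IsFactorisation (difference W V)) (hlam : IsNullHomotopy W X lam) :
    IsMorphism (tensorDagger X) (unit V) (ev W X lam) := by
  constructor
  · intro e v hv b hb
    rw [ev, evAt_apply] at hb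
    have h0 : ∑ p, evCoeff X.par n (diffZ X (fun j => C (leftVar k m j))
        (fun j => C (rightVar k m j)) MvPolynomial.X)
        (lamProd lam (fun j => C (leftVar k m j)) MvPolynomial.X) b p.2 p.1 * v p ≠ 0 :=
      fun h => hb (by rw [h, map_zero])
    obtain ⟨p, -, hp⟩ := Finset.exists_ne_zero_of_sum_ne_zero h0
    have h1 := HasParity.evCoeff (hasParity_diffZ hX _ _ _) (hasParity_lamProd hlam _ _) b p.2 p.1
      (left_ne_zero_of_mul hp)
    have h2 := hv p (right_ne_zero_of_mul hp)
    change X.par p.1 + (X.par p.2 + (n : ZMod 2)) = e at h2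
    change (b.card : ZMod 2) = e + 0
    rw [← h2, h1]
    linear_combination -(X.par p.1 + n) * (CharTwo.two_eq_zero (R := ZMod 2))
  · intro v
    ext1 b
    have key := evCoeff_identity (par := X.par) (fun t => evalD X
      (mixed (fun j => (C (leftVar k m j) : MvPolynomial (Fin n) (Env k m)))
        (fun j => C (rightVar k m j)) t) MvPolynomial.X)
      _ _ (fun t => hasParity_evalD hX _ _) (hasParity_diffZ hX _ _ _)
      (hasParity_lamProd hlam (fun j => C (leftVar k m j)) MvPolynomial.X)
      (evalD_succ_mul_diffZ _ _ _ hX) (evalD_sub_evalD_z _ _ _ X) b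
    simp only [mixed_zero, mixed_self] at key
    rw [ev, evAt_apply, tensorDagger, sum_mul_tensor_dagger_mulVec, key]
    simp only [Matrix.add_apply, add_mul]
    rw [Finset.sum_add_distrib, map_add, residueExt_sum_commutator_eq_zero hlam, add_zero,
      unit, unitAt_mulVec]
    simp only [Matrix.sum_apply, Finset.sum_mul]
    rw [Finset.sum_comm, map_sum]
    refine Finset.sum_congr rfl fun i _ => ?_
    -- The coefficients of the differential of $\Delta_V$ do not involve the inner variables $x$, so
    -- they can be taken out of the residue by linearity.
    have hk : koszulSign (MvPolynomial (Fin n) (Env k m)) i b = C (koszulSign _ i b) := by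
      simp [koszulSign]
    have hw : diffQuot (hybrid (fun j => (C (leftVar k m j) : MvPolynomial (Fin n) (Env k m)))
        (fun j => C (rightVar k m j)) i) i (C (leftVar k m i)) (C (rightVar k m i)) V =
        C (diffQuot (hybrid (leftVar k m) (rightVar k m) i) i (leftVar k m i) (rightVar k m i) V) := by
      refine Eq.trans ?_ (map_diffQuot (IsScalarTower.toAlgHom k (Env k m)
        (MvPolynomial (Fin n) (Env k m))) (hybrid (leftVar k m) (rightVar k m) i) i _ _ V).symm
      congr 2
      ext1 j
      simp only [hybrid]
      split_ifs <;> rfl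
    split_ifs
    · rw [evAt_apply]
      simp only [Matrix.smul_apply, smul_eq_mul, hk, hw, mul_assoc]
      rw [← Finset.mul_sum, ← smul_eq_C_mul, map_smul, smul_eq_mul, ← Finset.mul_sum,
        ← smul_eq_C_mul, map_smul, smul_eq_mul]
    · rw [evAt_apply]
      simp only [Matrix.smul_apply, smul_eq_mul, hk, ← C_sub, mul_assoc]
      rw [← Finset.mul_sum, ← smul_eq_C_mul, map_smul, smul_eq_mul, ← Finset.mul_sum,
        ← smul_eq_C_mul, map_smul, smul_eq_mul]

end Ev

/-! ### Graded commutators -/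

section SuperAd

variable {ι B : Type*} [Fintype ι] [DecidableEq ι] [CommRing B] {r : ℕ} (par : ι → ZMod 2)

/-- The graded commutator with an odd operator `D`. -/
def superAd (D : Matrix ι ι B) : Matrix ι ι B →ₗ[B] Matrix ι ι B where
  -- Conjugation by the grading operator supplies the Koszul sign on every homogeneous component, so
  -- the commutator is linear on all matrices.
  toFun M := D * M - sgnMat B par * M * sgnMat B par * D
  map_add' M N := by noncomm_ring
  map_smul' c M := by
    simp only [Matrix.mul_smul, Matrix.smul_mul, RingHom.id_apply, smul_sub]

variable {par}

theorem superAd_apply (D M : Matrix ι ι B) :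
    superAd par D M = D * M - sgnMat B par * M * sgnMat B par * D := rfl

theorem superAd_apply_of_hasParity {g : ZMod 2} (D : Matrix ι ι B) {M : Matrix ι ι B}
    (hM : HasParity par g M) : superAd par D M = D * M - sgn B g • (M * D) := by
  rw [superAd_apply, hM.sgnMat_mul_mul_sgnMat, Matrix.smul_mul]

theorem HasParity.superAd {g : ZMod 2} {D M : Matrix ι ι B} (hD : HasParity par 1 D)
    (hM : HasParity par g M) : HasParity par (g + 1) (superAd par D M) := by
  rw [superAd_apply_of_hasParity D hM]
  exact ((hD.mul hM).cast (add_comm _ _)).sub ((hM.mul hD).smul _)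

theorem superAd_sub (D D' M : Matrix ι ι B) :
    superAd par (D - D') M = superAd par D M - superAd par D' M := by
  simp only [superAd_apply]; noncomm_ring

theorem superAd_smul (c : B) (D M : Matrix ι ι B) :
    superAd par (c • D) M = c • superAd par D M := by
  simp only [superAd_apply, Matrix.smul_mul, Matrix.mul_smul, smul_sub]

/-- The double graded commutator with an odd $D$ is the commutator with $D^2$, here a scalar. -/
theorem superAd_superAd {D : Matrix ι ι B} (hD : HasParity par 1 D) {w : B}
    (hw : D * D = w • (1 : Matrix ι ι B)) (M : Matrix ι ι B) :
    superAd par D (superAd par D M) = 0 := by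
  have h1 : sgnMat B par * D = -(D * sgnMat B par) := by
    rw [hD.sgnMat_mul, sgn_one, neg_one_smul]
  have h2 : D * sgnMat B par = -(sgnMat B par * D) := by rw [h1, neg_neg]
  have e1 : sgnMat B par * (D * M) * sgnMat B par * D =
      -(D * (sgnMat B par * M * sgnMat B par * D)) := by
    rw [← Matrix.mul_assoc, h1]; simp only [Matrix.mul_assoc, Matrix.neg_mul]
  have e2 : sgnMat B par * (sgnMat B par * M * sgnMat B par * D) * sgnMat B par * D =
      -(w • M) := by
    simp only [Matrix.mul_assoc, sgnMat_mul_sgnMat_mul]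
    rw [← Matrix.mul_assoc D, h2, Matrix.neg_mul, Matrix.mul_neg, Matrix.mul_assoc _ D D, hw,
      Matrix.mul_neg, sgnMat_mul_sgnMat_mul]
    simp
  rw [superAd_apply, superAd_apply, Matrix.mul_sub, Matrix.mul_sub, Matrix.sub_mul, Matrix.sub_mul,
    e1, e2, ← Matrix.mul_assoc D D M, hw, Matrix.smul_mul, Matrix.one_mul]
  abel

/-- The iterated graded commutator `[T_{t-1}, …, [T₀, L]]`. -/
def iterSuperAd (par : ι → ZMod 2) (T : Fin r → Matrix ι ι B) (L : Matrix ι ι B) :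
    ℕ → Matrix ι ι B
  | 0 => L
  | t + 1 => if h : t < r then superAd par (T ⟨t, h⟩) (iterSuperAd par T L t)
      else iterSuperAd par T L t

theorem ascProd_insert_max {c : Finset (Fin r)} {i : Fin r} (h : ∀ j ∈ c, j < i)
    (M : Fin r → Matrix ι ι B) : ascProd (insert i c) M = ascProd c M * M i := by
  have hi : i ∉ c := fun hi => lt_irrefl _ (h i hi)
  have hs : suffixProd (factors c M) (i + 1) = 1 := by
    have : suffixProd (factors c M) (i + 1) = suffixProd (fun _ => 1) (i + 1) :=
      suffixProd_congr fun j hj => if_neg fun hjc => by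
        have := Fin.lt_def.1 (h j hjc); omega
    rw [this, suffixProd]
    refine List.prod_eq_one fun x hx => ?_
    have := List.mem_of_mem_drop hx
    rw [List.mem_ofFn] at this
    exact this.choose_spec.symm
  have h1 := prod_map_sort_insert c M i
  have h2 := prod_map_sort_erase c M i
  rw [hs, mul_one] at h1 h2
  rw [Finset.erase_eq_of_notMem hi] at h2
  rw [ascProd, ascProd, h1, h2]

theorem descProd_insert_max {c : Finset (Fin r)} {i : Fin r} (h : ∀ j ∈ c, j < i)
    (M : Fin r → Matrix ι ι B) : descProd (insert i c) M = M i * descProd c M := by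
  rw [descProd_eq_transpose, ascProd_insert_max h, Matrix.transpose_mul, Matrix.transpose_transpose,
    ← descProd_eq_transpose]

/-- The number of pairs `q < p` with `p ∈ a`, `q ∈ b`. -/
def inversions (a b : Finset (Fin r)) : ℕ := ((a ×ˢ b).filter fun p => p.2 < p.1).card

theorem inversions_eq_sum (a b : Finset (Fin r)) :
    inversions a b = ∑ p ∈ a, (b.filter (· < p)).card := by
  rw [inversions, Finset.card_filter, Finset.sum_product]
  exact Finset.sum_congr rfl fun p _ => (Finset.card_filter _ _).symm

theorem inversions_insert_left {a b : Finset (Fin r)} {i : Fin r} (ha : i ∉ a)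
    (hb : ∀ j ∈ b, j < i) : inversions (insert i a) b = inversions a b + b.card := by
  rw [inversions_eq_sum, Finset.sum_insert ha, inversions_eq_sum,
    Finset.filter_true_of_mem hb, add_comm]

theorem inversions_insert_right {a b : Finset (Fin r)} {i : Fin r} (ha : ∀ j ∈ a, j < i) :
    inversions a (insert i b) = inversions a b := by
  rw [inversions_eq_sum, inversions_eq_sum]
  refine Finset.sum_congr rfl fun p hp => ?_
  rw [Finset.filter_insert, if_neg (ha p hp).not_gt]

/-- The exponents of the signs in the expansion of an iterated graded commutator. -/
def expansionSign (n : ℕ) (a b : Finset (Fin r)) : ℕ :=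
  inversions a b + a.card.choose 2 + (n + 1) * a.card

/-- Every $T_i$ ends up to the left or to the right of `L`, and $a$ records those on the right. As
later ones land further out, the left product is descending (as in the coevaluation) and the right
one ascending (as in $\rho^{-1}$). -/
theorem iterSuperAd_eq_sum {n : ℕ} {T : Fin r → Matrix ι ι B} {L : Matrix ι ι B}
    (hT : ∀ i, HasParity par 1 (T i)) (hL : HasParity par n L) {t : ℕ} (ht : t ≤ r) :
    iterSuperAd par T L t = ∑ a ∈ (Finset.univ.filter fun j : Fin r => (j : ℕ) < t).powerset,
      (-1 : B) ^ expansionSign n a ((Finset.univ.filter fun j : Fin r => (j : ℕ) < t) \ a) •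
        (descProd ((Finset.univ.filter fun j : Fin r => (j : ℕ) < t) \ a) T * L * ascProd a T) := by
  induction t with
  | zero =>
    simp [iterSuperAd, descProd_empty, ascProd_empty, expansionSign, inversions]
  | succ t ih =>
    have ht' : t < r := ht
    set i : Fin r := ⟨t, ht'⟩
    set c := Finset.univ.filter fun j : Fin r => (j : ℕ) < t with hc
    have hci : ∀ j ∈ c, j < i := fun j hj => (Finset.mem_filter.1 hj).2
    have hic : i ∉ c := fun h => lt_irrefl _ (hci i h)
    have hcc : (Finset.univ.filter fun j : Fin r => (j : ℕ) < t + 1) = insert i c := by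
      ext j
      simp only [hc, Finset.mem_filter, Finset.mem_univ, true_and, Finset.mem_insert, Fin.ext_iff, i]
      omega
    have hcard : c.card = t := by
      have : c = Finset.Iio i := by ext j; simp [hc, i, Fin.lt_def]
      rw [this, Fin.card_Iio]
    rw [hcc, iterSuperAd, dif_pos ht', ih ht'.le, map_sum, Finset.sum_powerset_insert hic,
      ← Finset.sum_add_distrib]
    refine Finset.sum_congr rfl fun a ha => ?_
    have hac := Finset.mem_powerset.1 ha
    have hia : i ∉ a := fun h => hic (hac h)
    have hbi : ∀ j ∈ c \ a, j < i := fun j hj => hci j (Finset.mem_sdiff.1 hj).1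
    have hai : ∀ j ∈ a, j < i := fun j hj => hci j (hac hj)
    have e1 : insert i c \ a = insert i (c \ a) := Finset.insert_sdiff_of_notMem _ hia
    have e2 : insert i c \ insert i a = c \ a := by
      ext j
      simp only [Finset.mem_sdiff, Finset.mem_insert]
      constructor
      · rintro ⟨h1 | h1, h2⟩ <;> tauto
      · rintro ⟨h1, h2⟩
        refine ⟨Or.inr h1, ?_⟩
        rintro (rfl | h)
        · exact hic h1
        · exact h2 h
    have hsum : (c \ a).card + a.card = t := by
      rw [Finset.card_sdiff_add_card_eq_card hac, hcard]
    have hp := ((((HasParity.descProd hT (c \ a)).mul hL).mul (HasParity.ascProd hT a))).cast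
      (show ((c \ a).card : ZMod 2) + n + a.card = ((n + t : ℕ) : ZMod 2) by
        rw [← hsum]; push_cast; ring)
    rw [map_smul, superAd_apply_of_hasParity _ hp, sgn_natCast, e1, e2, descProd_insert_max hbi,
      ascProd_insert_max hai, smul_sub, sub_eq_add_neg, smul_smul, ← neg_smul]
    congr 1
    · rw [expansionSign, expansionSign, inversions_insert_right hai]
      simp only [Matrix.mul_assoc]; rfl
    · rw [Matrix.mul_assoc _ _ (T i)]
      congr 1
      -- Placing $T_i$ on the right costs $-(-1)^{n+t}$ with $t=|c\setminus a|+|a|$. The three parts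
      -- of the exponent grow by $|c\setminus a|$, $|a|$ and $n+1$.
      rw [expansionSign, expansionSign, inversions_insert_left hia hbi,
        Finset.card_insert_of_notMem hia, ← neg_one_mul, ← mul_assoc, ← pow_succ', ← pow_add]
      refine neg_one_pow_congr ?_
      rw [Nat.choose_succ_succ' a.card 1, Nat.choose_one_right]
      simp only [Nat.even_iff, mul_add, mul_one, Nat.reduceAdd]
      omega

end SuperAd

/-! ### Compositions of differences of graded commutators -/

section Word

variable {ι B : Type*} [Fintype ι] [DecidableEq ι] [CommRing B] (par : ι → ZMod 2)
  (D : ℕ → Matrix ι ι B)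

/-- The composition of `[D_t - D_{t+1}, -]` over `t = s, …, s + l - 1`. -/
def adWord (s : ℕ) : ℕ → Matrix ι ι B →ₗ[B] Matrix ι ι B
  | 0 => LinearMap.id
  | l + 1 => superAd par (D (s + l) - D (s + l + 1)) ∘ₗ adWord s l

variable {par D}

theorem adWord_succ_apply (s l : ℕ) (M : Matrix ι ι B) :
    adWord par D s (l + 1) M = adWord par D (s + 1) l (superAd par (D s - D (s + 1)) M) := by
  induction l with
  | zero => rfl
  | succ l ih =>
    rw [adWord, LinearMap.comp_apply, ih, adWord, LinearMap.comp_apply]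
    rw [show s + (l + 1) = s + 1 + l by omega]

/-- As $[D_s,[D_s,M]]=0$, one has $[D_s-D_{s+1},[D_s,M]]=[D_{s+1},-[D_s,M]]$. A commutator thus
moves outwards through the word, its index rising by one at each step. -/
theorem exists_adWord_superAd (hD : ∀ t, HasParity par 1 (D t))
    (hw : ∀ t, ∃ w : B, D t * D t = w • (1 : Matrix ι ι B)) (l s : ℕ) {g : ZMod 2}
    {M : Matrix ι ι B} (hM : HasParity par g M) :
    ∃ G, HasParity par (g + l) G ∧
      adWord par D s l (superAd par (D s) M) = superAd par (D (s + l)) G := by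
  induction l generalizing s g M with
  | zero => exact ⟨M, by simpa using hM, rfl⟩
  | succ l ih =>
    obtain ⟨G, hG, h⟩ := ih (s + 1) ((hD s).superAd hM).neg
    refine ⟨G, hG.cast (by push_cast; ring), ?_⟩
    obtain ⟨w, hw⟩ := hw s
    rw [adWord_succ_apply, superAd_sub, superAd_superAd (hD s) hw, zero_sub, ← map_neg, h,
      show s + (l + 1) = s + 1 + l by omega]

/-- The word contains the commutator with $D_j-D_{j+1}=uT$, from which the scalar is taken out. -/
theorem exists_adWord_eq_smul {T : Matrix ι ι B} {u : B} {j : ℕ} (hu : D j - D (j + 1) = u • T)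
    (l : ℕ) {s : ℕ} (hs : s ≤ j) (hj : j < s + l) (M : Matrix ι ι B) :
    ∃ G, adWord par D s l M = u • G := by
  induction l generalizing s M with
  | zero => omega
  | succ l ih =>
    rw [adWord_succ_apply]
    by_cases h : s = j
    · subst h
      rw [hu, superAd_smul, map_smul]
      exact ⟨_, rfl⟩
    · exact ih (by omega) (by omega) _

theorem prod_smul_iterSuperAd {r : ℕ} {T : Fin r → Matrix ι ι B} {u : Fin r → B}
    (hu : ∀ i : Fin r, D i - D (i + 1) = u i • T i) (L : Matrix ι ι B) {t : ℕ} (ht : t ≤ r) :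
    adWord par D 0 t L =
      (∏ i ∈ Finset.univ.filter fun j : Fin r => (j : ℕ) < t, u i) • iterSuperAd par T L t := by
  induction t with
  | zero => simp [adWord, iterSuperAd]
  | succ t ih =>
    have ht' : t < r := ht
    have hcc : (Finset.univ.filter fun j : Fin r => (j : ℕ) < t + 1) =
        insert ⟨t, ht'⟩ (Finset.univ.filter fun j : Fin r => (j : ℕ) < t) := by
      ext j
      simp only [Finset.mem_filter, Finset.mem_univ, true_and, Finset.mem_insert, Fin.ext_iff]
      omega
    have h := hu ⟨t, ht'⟩
    simp only at h
    rw [adWord, LinearMap.comp_apply, ih ht'.le, zero_add, h, map_smul, superAd_smul, smul_smul,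
      iterSuperAd, dif_pos ht', hcc, Finset.prod_insert (by simp), mul_comm]

end Word

/-! ### Ordered products as a map on the exterior algebra -/

section OrderedProductMap

variable {ι B : Type*} [Fintype ι] [DecidableEq ι] [CommRing B] {n : ℕ} {par : ι → ZMod 2}

/-- `θ_b ↦ λ_{b₁} ⋯ λ_{b_l}`. -/
def ordered (lam : Fin n → Matrix ι ι B) : (Finset (Fin n) → B) →ₗ[B] Matrix ι ι B :=
  ∑ b, (LinearMap.proj b).smulRight (ascProd b lam)

theorem ordered_apply (lam : Fin n → Matrix ι ι B) (v : Finset (Fin n) → B) :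
    ordered lam v = ∑ b, v b • ascProd b lam := by
  rw [ordered, LinearMap.sum_apply]; rfl

theorem ordered_single (lam : Fin n → Matrix ι ι B) (b : Finset (Fin n)) :
    ordered lam (Pi.single b 1) = ascProd b lam := by
  rw [ordered_apply, Finset.sum_eq_single b]
  · simp
  · intro c _ hc; simp [hc]
  · simp

variable {lam : Fin n → Matrix ι ι B} {f : Fin n → B} {D : Matrix ι ι B}

/-- The $\lambda_i$ need not anticommute: only the graded Leibniz rule enters, that is,
`ascProd_telescope` for a constant sequence `D` and `u = 0`. -/
theorem superAd_ordered (hlam : ∀ i, HasParity par 1 (lam i))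
    (hf : ∀ i, D * lam i + lam i * D = f i • (1 : Matrix ι ι B)) (v : Finset (Fin n) → B) :
    superAd par D (ordered lam v) = ordered lam ((koszulDiff f).mulVec v) := by
  have h1 : ∀ c, superAd par D (ascProd c lam) =
      ∑ i, koszulSign B i c • if i ∈ c then f i • ascProd (c.erase i) lam else 0 := by
    intro c
    have := ascProd_telescope (fun _ => D) lam f (fun _ => 0) hf (fun i => by simp) c
    rw [superAd_apply_of_hasParity _ (HasParity.ascProd hlam c), sgn_natCast]
    simpa using this
  ext x y
  rw [ordered_apply, ordered_apply, map_sum, Matrix.sum_apply, Matrix.sum_apply]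
  simp only [map_smul, h1, Matrix.smul_apply, smul_eq_mul]
  have h2 := Matrix.dotProduct_mulVec (fun b => ascProd b lam x y) (koszulDiff f) v
  have h3 : ∀ c, Matrix.vecMul (fun b => ascProd b lam x y) (koszulDiff f) c =
      (∑ i, koszulSign B i c • if i ∈ c then f i • ascProd (c.erase i) lam else 0) x y := by
    intro c
    rw [← Matrix.mulVec_transpose, koszulDiff, Matrix.transpose_sum, Matrix.sum_mulVec,
      Finset.sum_apply, Matrix.sum_apply]
    refine Finset.sum_congr rfl fun i _ => ?_
    rw [Matrix.transpose_smul, contract_eq_transpose, Matrix.transpose_transpose,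
      Matrix.smul_mulVec, Pi.smul_apply, wedge_mulVec, Matrix.smul_apply]
    split_ifs
    · rw [Matrix.smul_apply, smul_eq_mul, smul_eq_mul, smul_eq_mul]; ring
    · simp
  calc _ = Matrix.vecMul (fun b => ascProd b lam x y) (koszulDiff f) ⬝ᵥ v := by
        rw [dotProduct]
        exact Finset.sum_congr rfl fun c _ => by rw [h3, mul_comm]
    _ = _ := by
        rw [← h2, dotProduct]
        exact Finset.sum_congr rfl fun c _ => mul_comm _ _

/-- `v ∧ (-)` for `v = ∑ᵢ cᵢ θᵢ`. -/
def wedgeVec : (Fin n → B) →ₗ[B] Matrix (Finset (Fin n)) (Finset (Fin n)) B :=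
  ∑ i, (LinearMap.proj i).smulRight (wedge B i)

theorem wedgeVec_apply (c : Fin n → B) : wedgeVec c = ∑ i, c i • wedge B i := by
  rw [wedgeVec, LinearMap.sum_apply]; rfl

theorem wedgeVec_mul_self (c : Fin n → B) : wedgeVec c * wedgeVec c = 0 := by
  rw [wedgeVec_apply, sum_mul_sum_of_anticommute]
  · refine Finset.sum_eq_zero fun i _ => ?_
    rw [Matrix.smul_mul, Matrix.mul_smul, wedge_mul_self, smul_zero, smul_zero]
  · intro i j h
    simp only [Matrix.smul_mul, Matrix.mul_smul, smul_smul]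
    rw [mul_comm (c j), ← smul_add, wedge_mul_wedge h, smul_zero]

theorem koszulDiff_mul_wedgeVec (f c : Fin n → B) :
    koszulDiff f * wedgeVec c + wedgeVec c * koszulDiff f =
      (∑ i, c i * f i) • (1 : Matrix (Finset (Fin n)) (Finset (Fin n)) B) := by
  rw [wedgeVec_apply, koszulDiff, Finset.sum_mul_sum, Finset.sum_mul_sum, Finset.sum_comm,
    ← Finset.sum_add_distrib, Finset.sum_smul]
  refine Finset.sum_congr rfl fun i _ => ?_
  rw [← Finset.sum_add_distrib, Finset.sum_eq_single i]
  · simp only [Matrix.smul_mul, Matrix.mul_smul, smul_smul]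
    rw [mul_comm (f i), ← smul_add, add_comm, wedge_mul_contract_self]
  · intro j _ hj
    simp only [Matrix.smul_mul, Matrix.mul_smul, smul_smul]
    rw [mul_comm (f j), ← smul_add, add_comm, wedge_mul_contract hj.symm, smul_zero]
  · simp

/-- `v_t ∧ ⋯ ∧ v_{n-1}` for the rows `vⱼ` of a matrix. -/
def wedgeTail (M : Matrix (Fin n) (Fin n) B) (t : ℕ) : Finset (Fin n) → B :=
  (suffixProd (fun j => wedgeVec (M j)) t).mulVec (Pi.single ∅ 1)

variable (M : Matrix (Fin n) (Fin n) B)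

theorem wedgeTail_self : wedgeTail M n = Pi.single ∅ 1 := by
  rw [wedgeTail, suffixProd_self, Matrix.one_mulVec]

theorem wedgeTail_eq (i : Fin n) : wedgeTail M i = (wedgeVec (M i)).mulVec (wedgeTail M (i + 1)) := by
  rw [wedgeTail, suffixProd_eq_mul, wedgeTail, Matrix.mulVec_mulVec]

theorem wedgeVec_mulVec (c : Fin n → B) (v : Finset (Fin n) → B) (b : Finset (Fin n)) :
    (wedgeVec c).mulVec v b =
      ∑ i, if i ∈ b then c i * (koszulSign B i b * v (b.erase i)) else 0 := by
  rw [wedgeVec_apply, Matrix.sum_mulVec, Finset.sum_apply]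
  refine Finset.sum_congr rfl fun i _ => ?_
  rw [Matrix.smul_mulVec, Pi.smul_apply, wedge_mulVec]
  split_ifs <;> simp

theorem wedgeTail_one_eq {t : ℕ} (ht : t ≤ n) : wedgeTail (1 : Matrix (Fin n) (Fin n) B) t =
    Pi.single (Finset.univ.filter fun j : Fin n => t ≤ (j : ℕ)) 1 := by
  induction ht using Nat.decreasingInduction with
  | self =>
    rw [wedgeTail_self, Finset.filter_false_of_mem fun j _ => by have := j.2; omega]
  | of_succ t ht ih =>
    have h := wedgeTail_eq (1 : Matrix (Fin n) (Fin n) B) ⟨t, ht⟩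
    simp only at h
    rw [h, ih]
    set c := Finset.univ.filter fun j : Fin n => t + 1 ≤ j with hc
    have hi : (⟨t, ht⟩ : Fin n) ∉ c := by simp [hc]
    have hcc : (Finset.univ.filter fun j : Fin n => t ≤ (j : ℕ)) = insert ⟨t, ht⟩ c := by
      ext j
      simp only [hc, Finset.mem_filter, Finset.mem_univ, true_and, Finset.mem_insert, Fin.ext_iff]
      omega
    rw [hcc]
    ext1 b
    rw [wedgeVec_mulVec, Finset.sum_eq_single ⟨t, ht⟩]
    · rw [Matrix.one_apply_eq, one_mul]
      by_cases hb : b = insert ⟨t, ht⟩ c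
      · subst hb
        rw [if_pos (Finset.mem_insert_self _ _), Finset.erase_insert hi, Pi.single_eq_same,
          Pi.single_eq_same, mul_one, koszulSign_of_lt]
        intro j hj
        rcases Finset.mem_insert.1 hj with rfl | hj
        · exact le_rfl
        · have := (Finset.mem_filter.1 hj).2
          exact Fin.le_def.2 (by simp only; omega)
      · rw [Pi.single_eq_of_ne hb]
        split_ifs with hib
        · rw [Pi.single_eq_of_ne, mul_zero]
          intro h'
          exact hb (by rw [← h', Finset.insert_erase hib])
        · rfl
    · intro j _ hj
      rw [Matrix.one_apply_ne hj.symm, zero_mul, ite_self]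
    · simp

/-- Each coefficient is an alternating function of the rows, hence the determinant times its value
at the identity matrix, given by `wedgeTail_one_eq`. Alternation comes from mapping the exterior
algebra to the operators $v\wedge(-)$. -/
theorem wedgeTail_zero : wedgeTail M 0 = M.det • Pi.single Finset.univ 1 := by
  ext1 b
  let φ : Matrix (Finset (Fin n)) (Finset (Fin n)) B →ₗ[B] B :=
    { toFun := fun N => N.mulVec (Pi.single ∅ 1) b
      map_add' := fun N N' => by rw [Matrix.add_mulVec, Pi.add_apply]
      map_smul' := fun c N => by rw [Matrix.smul_mulVec]; rfl }
  let F : ExteriorAlgebra B (Fin n → B) →ₐ[B] Matrix (Finset (Fin n)) (Finset (Fin n)) B :=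
    ExteriorAlgebra.lift B ⟨wedgeVec, wedgeVec_mul_self⟩
  let G : (Fin n → B) [⋀^Fin n]→ₗ[B] B :=
    (φ ∘ₗ F.toLinearMap).compAlternatingMap (ExteriorAlgebra.ιMulti B n)
  have hG : ∀ N : Matrix (Fin n) (Fin n) B, G N = wedgeTail N 0 b := by
    intro N
    have : F (ExteriorAlgebra.ιMulti B n N) = suffixProd (fun j => wedgeVec (N j)) 0 := by
      refine (congrArg F (ExteriorAlgebra.ιMulti_apply (R := B) (fun j => N j))).trans ?_
      rw [map_list_prod, List.map_ofFn, suffixProd_zero]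
      congr 2
      ext1 j
      simp [F]
    change φ (F (ExteriorAlgebra.ιMulti B n N)) = _
    rw [this]
    rfl
  have h := DFunLike.congr_fun (AlternatingMap.eq_smul_basis_det (Pi.basisFun B (Fin n)) G) M
  have h1 : G (Pi.basisFun B (Fin n)) = wedgeTail (1 : Matrix (Fin n) (Fin n) B) 0 b := by
    rw [← hG]
    congr 1
    ext i j
    simp [Matrix.one_apply, Pi.single_apply, eq_comm]
  refine (hG M).symm.trans (h.trans ?_)
  change G _ * (Pi.basisFun B (Fin n)).det _ = _
  rw [h1, Pi.basisFun_det, wedgeTail_one_eq (Nat.zero_le n), mul_comm]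
  have hs : (Finset.univ.filter fun j : Fin n => 0 ≤ (j : ℕ)) = Finset.univ := by simp
  simp only [hs]
  rfl

theorem card_of_wedgeTail_ne_zero {t : ℕ} (ht : t ≤ n) {b : Finset (Fin n)}
    (hb : wedgeTail M t b ≠ 0) : (b.card : ZMod 2) = n + t := by
  induction ht using Nat.decreasingInduction generalizing b with
  | self =>
    rw [wedgeTail_self] at hb
    have : b = ∅ := by
      by_contra h
      exact hb (Pi.single_eq_of_ne h _)
    subst this
    rw [CharTwo.add_self_eq_zero]; simp
  | of_succ t ht ih =>
    have h := wedgeTail_eq M ⟨t, ht⟩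
    simp only at h
    rw [h, wedgeVec_mulVec] at hb
    obtain ⟨i, -, hi⟩ := Finset.exists_ne_zero_of_sum_ne_zero hb
    split_ifs at hi with hib
    · have := ih (right_ne_zero_of_mul (right_ne_zero_of_mul hi))
      rw [← Finset.card_erase_add_one hib]
      push_cast at this ⊢
      rw [this]
      linear_combination (CharTwo.two_eq_zero (R := ZMod 2))
    · exact (hi rfl).elim

theorem hasParity_ordered_wedgeTail (hlam : ∀ i, HasParity par 1 (lam i)) {t : ℕ} (ht : t ≤ n) :
    HasParity par (n + t) (ordered lam (wedgeTail M t)) := by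
  rw [ordered_apply]
  refine HasParity.sum _ _ fun b _ => ?_
  by_cases hb : wedgeTail M t b = 0
  · rw [hb, zero_smul]; exact HasParity.zero
  · exact ((HasParity.ascProd hlam b).smul _).cast (card_of_wedgeTail_ne_zero M ht hb)

variable {M} {q : Fin n → B}

/-- The Koszul differential is an antiderivation taking the row $v_j$ to $\sum_kM_{jk}f_k=q_j$. -/
theorem exists_koszulDiff_wedgeTail (hq : ∀ i, q i = ∑ j, M i j * f j) {t : ℕ} (ht : t ≤ n) :
    ∃ η : Fin n → Finset (Fin n) → B, (koszulDiff f).mulVec (wedgeTail M t) =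
      ∑ j ∈ Finset.univ.filter (fun j : Fin n => t ≤ (j : ℕ)), q j • η j := by
  induction ht using Nat.decreasingInduction with
  | self =>
    refine ⟨0, ?_⟩
    rw [wedgeTail_self]
    ext1 b
    rw [koszulDiff_mulVec, Finset.sum_eq_zero]
    · simp
    · intro i _
      split_ifs
      · rfl
      · rw [Pi.single_eq_of_ne (Finset.insert_ne_empty i b), mul_zero]
  | of_succ t ht ih =>
    obtain ⟨η, hη⟩ := ih
    refine ⟨fun j => if (j : ℕ) = t then wedgeTail M (t + 1) else
      -(wedgeVec (M ⟨t, ht⟩)).mulVec (η j), ?_⟩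
    have h := wedgeTail_eq M ⟨t, ht⟩
    have h2 := koszulDiff_mul_wedgeVec f (M ⟨t, ht⟩)
    simp only at h
    rw [← hq] at h2
    rw [h, Matrix.mulVec_mulVec, eq_sub_of_add_eq h2, Matrix.sub_mulVec, ← Matrix.mulVec_mulVec, hη,
      Matrix.smul_mulVec, Matrix.one_mulVec]
    have hcc : (Finset.univ.filter fun j : Fin n => t ≤ (j : ℕ)) =
        insert ⟨t, ht⟩ (Finset.univ.filter fun j : Fin n => t + 1 ≤ (j : ℕ)) := by
      ext j
      simp only [Finset.mem_filter, Finset.mem_univ, true_and, Finset.mem_insert, Fin.ext_iff]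
      omega
    rw [hcc, Finset.sum_insert (by simp)]
    beta_reduce
    rw [if_pos rfl, sub_eq_add_neg, Matrix.mulVec_sum,
      ← Finset.sum_neg_distrib]
    congr 1
    refine Finset.sum_congr rfl fun j hj => ?_
    rw [if_neg (by have := (Finset.mem_filter.1 hj).2; omega), smul_neg, Matrix.mulVec_smul]

/-- Only the coefficient of $q_i$ has to be explicit: the multiples of $q_j$ with $j>i$ are killed
later by the residue. -/
theorem exists_koszulDiff_wedgeTail_eq_add (hq : ∀ i, q i = ∑ j, M i j * f j) (i : Fin n) :
    ∃ η : Fin n → Finset (Fin n) → B, (koszulDiff f).mulVec (wedgeTail M i) =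
      q i • wedgeTail M (i + 1) +
        ∑ j ∈ Finset.univ.filter (fun j : Fin n => (i : ℕ) + 1 ≤ (j : ℕ)), q j • η j := by
  obtain ⟨η, hη⟩ := exists_koszulDiff_wedgeTail (f := f) hq (t := i + 1) i.2
  refine ⟨fun j => -(wedgeVec (M i)).mulVec (η j), ?_⟩
  have h2 := koszulDiff_mul_wedgeVec f (M i)
  rw [← hq] at h2
  rw [wedgeTail_eq, Matrix.mulVec_mulVec, eq_sub_of_add_eq h2, Matrix.sub_mulVec,
    ← Matrix.mulVec_mulVec, hη, Matrix.smul_mulVec, Matrix.one_mulVec, sub_eq_add_neg,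
    Matrix.mulVec_sum, ← Finset.sum_neg_distrib]
  congr 1
  refine Finset.sum_congr rfl fun j _ => ?_
  rw [smul_neg, Matrix.mulVec_smul]

end OrderedProductMap

/-! ### The homotopy for a product of residues -/

section HybridFunctional

variable {A : Type*} [CommRing A] {n : ℕ} (p : Fin n → Polynomial A) (a : Fin n → A)

/-- The product functional which evaluates the variables `j < r` at `a j`, and takes the residue
with denominator `(t - a j) p j(t)` in the other ones. -/
noncomputable def hybridFunctional (r : ℕ) : MvPolynomial (Fin n) A →ₗ[A] A :=
  prodFunctional fun j => if (j : ℕ) < r then Polynomial.leval (a j)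
    else polyResidue ((Polynomial.X - Polynomial.C (a j)) * p j)

theorem aeval_X_sub_C (j : Fin n) :
    Polynomial.aeval (X j : MvPolynomial (Fin n) A) (Polynomial.X - Polynomial.C (a j)) =
      X j - C (a j) := by
  rw [map_sub, Polynomial.aeval_X, Polynomial.aeval_C]; rfl

variable {p}

theorem hybridFunctional_of_lt {r : ℕ} {j : Fin n} (h : (j : ℕ) < r) (g : MvPolynomial (Fin n) A) :
    hybridFunctional p a r ((X j - C (a j)) * g) = 0 := by
  rw [← aeval_X_sub_C, hybridFunctional, prodFunctional_aeval_mul_eq_zero]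
  intro g
  rw [if_pos h, Polynomial.leval_apply, Polynomial.eval_mul]
  simp

theorem hybridFunctional_of_le (hp : ∀ j, (p j).Monic) {r : ℕ} {j : Fin n} (h : r ≤ (j : ℕ))
    (g : MvPolynomial (Fin n) A) :
    hybridFunctional p a r (Polynomial.aeval (X j) (p j) * ((X j - C (a j)) * g)) = 0 := by
  rw [← aeval_X_sub_C, ← mul_assoc, ← map_mul, mul_comm (p j), hybridFunctional,
    prodFunctional_aeval_mul_eq_zero]
  intro g
  rw [if_neg (by omega), polyResidue_self_mul ((Polynomial.monic_X_sub_C _).mul (hp j))]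

variable [Nontrivial A]

/-- Cancelling $p_r$ leaves the denominator $t-a_r$, and the residue with that denominator is
evaluation at $a_r$. -/
theorem hybridFunctional_succ (hp : ∀ j, (p j).Monic) (r : Fin n) (g : MvPolynomial (Fin n) A) :
    hybridFunctional p a r (Polynomial.aeval (X r) (p r) * g) = hybridFunctional p a (r + 1) g := by
  rw [hybridFunctional, prodFunctional_aeval_mul, hybridFunctional]
  congr 2
  ext1 j
  by_cases h : j = r
  · subst h
    rw [Function.update_self, if_neg (lt_irrefl _), if_pos (Nat.lt_succ_self _)]
    exact LinearMap.ext fun g => polyResidue_X_sub_C_mul_mul (hp j) (a j) g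
  · have h' : (j : ℕ) ≠ r := fun e => h (Fin.ext e)
    rw [Function.update_of_ne h]
    by_cases h2 : (j : ℕ) < r
    · rw [if_pos h2, if_pos (by omega)]
    · rw [if_neg h2, if_neg (by omega)]

theorem hybridFunctional_one : hybridFunctional p a n 1 = 1 := by
  rw [hybridFunctional, prodFunctional_one]
  refine Finset.prod_eq_one fun j _ => ?_
  rw [if_pos j.2]; simp

/-- The factors $x_j-a_j$ cancel between numerator and denominators. Read backwards, this introduces
the factors that turn the $T_j$ into differences $D_j-D_{j+1}$. -/
theorem hybridFunctional_zero (hp : ∀ j, (p j).Monic) (g : MvPolynomial (Fin n) A) :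
    hybridFunctional p a 0 ((∏ j, (X j - C (a j))) * g) = sepResidue p g := by
  simp_rw [← aeval_X_sub_C a]
  rw [hybridFunctional, prodFunctional_prod_mul, sepResidue_eq_prodFunctional]
  congr 2
  ext1 j
  rw [if_pos (Finset.mem_univ j), if_neg (Nat.not_lt_zero _)]
  exact LinearMap.ext fun g => polyResidue_X_sub_C_mul (hp j) (a j) g

end HybridFunctional

/-! ### Induction turning the residues into evaluations, one variable at a time. -/

section Homotopy

variable {A ι : Type*} [CommRing A] [Fintype ι] [DecidableEq ι] {n : ℕ}

theorem mapMatrix_map_C_mul (Φ : MvPolynomial (Fin n) A →ₗ[A] A) (N : Matrix ι ι A)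
    (G : Matrix ι ι (MvPolynomial (Fin n) A)) :
    Φ.mapMatrix (N.map C * G) = N * Φ.mapMatrix G := by
  ext i j
  simp only [LinearMap.mapMatrix_apply, Matrix.map_apply, Matrix.mul_apply, map_sum, ← smul_eq_C_mul,
    map_smul, smul_eq_mul]

theorem mapMatrix_mul_map_C (Φ : MvPolynomial (Fin n) A →ₗ[A] A) (N : Matrix ι ι A)
    (G : Matrix ι ι (MvPolynomial (Fin n) A)) :
    Φ.mapMatrix (G * N.map C) = Φ.mapMatrix G * N := by
  ext i j
  simp only [LinearMap.mapMatrix_apply, Matrix.map_apply, Matrix.mul_apply, map_sum, mul_comm _ (C _),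
    ← smul_eq_C_mul, map_smul, smul_eq_mul]
  exact Finset.sum_congr rfl fun _ _ => mul_comm _ _

theorem mapMatrix_smul_congr {Φ Ψ : MvPolynomial (Fin n) A →ₗ[A] A} {c : MvPolynomial (Fin n) A}
    (h : ∀ g, Φ (c * g) = Ψ g) (G : Matrix ι ι (MvPolynomial (Fin n) A)) :
    Φ.mapMatrix (c • G) = Ψ.mapMatrix G := by
  ext i j; exact h _

theorem mapMatrix_smul_eq_zero {Φ : MvPolynomial (Fin n) A →ₗ[A] A} {c : MvPolynomial (Fin n) A}
    (h : ∀ g, Φ (c * g) = 0) (G : Matrix ι ι (MvPolynomial (Fin n) A)) :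
    Φ.mapMatrix (c • G) = 0 := by
  ext i j; exact h _

variable [Nontrivial A] {par : ι → ZMod 2} {D : ℕ → Matrix ι ι (MvPolynomial (Fin n) A)}
  {D' : Matrix ι ι A} {T lam : Fin n → Matrix ι ι (MvPolynomial (Fin n) A)}
  {a : Fin n → A} {f : Fin n → MvPolynomial (Fin n) A} {p : Fin n → Polynomial A}
  {M : Matrix (Fin n) (Fin n) (MvPolynomial (Fin n) A)}

/-- The heart of the Zorro identity. In the stage indexed by `r`, the first `r` variables have been
evaluated, the commutators `r, …, n - 1` remain, and they act on the image of $v_r\wedge\dots\wedge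
v_{n-1}$. At `r = n` only the identity is left; each step back to a smaller `r` adds a
null-homotopic term. -/
theorem exists_mapMatrix_adWord_ordered (hD : ∀ t, HasParity par 1 (D t))
    (hw : ∀ t, ∃ w : MvPolynomial (Fin n) A, D t * D t = w • (1 : Matrix ι ι _)) (hn : D n = D'.map C)
    (hT : ∀ i : Fin n, D i - D (i + 1) = (X i - C (a i)) • T i)
    (hlam : ∀ i, HasParity par 1 (lam i))
    (hf : ∀ i, D 0 * lam i + lam i * D 0 = f i • (1 : Matrix ι ι _))
    (hM : IsSeparation f (p, M)) (l r : ℕ) (hr : r + l = n) :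
    ∃ H : Matrix ι ι A, HasParity par 1 H ∧
      (hybridFunctional p a r).mapMatrix (adWord par D r l (ordered lam (wedgeTail M r))) =
        1 + D' * H + H * D' := by
  induction l generalizing r with
  | zero =>
    obtain rfl : r = n := by omega
    refine ⟨0, HasParity.zero, ?_⟩
    change (hybridFunctional p a r).mapMatrix (ordered lam (wedgeTail M r)) = _
    rw [wedgeTail_self, ordered_single, ascProd_empty, mul_zero, zero_mul, add_zero, add_zero]
    ext i j
    rw [LinearMap.mapMatrix_apply, Matrix.map_apply, Matrix.one_apply, Matrix.one_apply]
    split_ifs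
    · exact hybridFunctional_one a
    · exact map_zero _
  | succ l ih =>
    have hrn : r < n := by omega
    set Φ := hybridFunctional p a r with hΦ
    set F := ordered lam (wedgeTail M r) with hF
    obtain ⟨H, hH, hH2⟩ := ih (r + 1) (by omega)
    obtain ⟨G, hG, hG2⟩ := exists_adWord_superAd hD hw l (r + 1)
      (hasParity_ordered_wedgeTail M hlam hrn.le)
    have hG1 : HasParity par 1 G := by
      refine hG.cast ?_
      rw [← hr]
      push_cast
      linear_combination ((r : ZMod 2) + l) * (CharTwo.two_eq_zero (R := ZMod 2))
    -- The commutator with `D (r + 1)` comes out as one with `D n`. The latter is constant in the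
    -- variables integrated out, so it passes through `Φ` and gives a boundary.
    have hsecond : Φ.mapMatrix (adWord par D (r + 1) l (superAd par (D (r + 1)) F)) =
        D' * Φ.mapMatrix G + Φ.mapMatrix G * D' := by
      rw [hF, hG2, show r + 1 + l = n by omega, hn, superAd_apply_of_hasParity _ hG1, sgn_one,
        neg_one_smul, sub_neg_eq_add, map_add, mapMatrix_map_C_mul, mapMatrix_mul_map_C]
    -- $D_0-D_r$ is a combination of the $x_j-a_j$ with $j<r$, and `Φ` evaluates these variables at
    -- $a_j$.
    have hD0 : ∀ s ≤ r, Φ.mapMatrix (adWord par D (r + 1) l (superAd par (D s) F)) =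
        Φ.mapMatrix (adWord par D (r + 1) l (superAd par (D 0) F)) := by
      intro s hs
      induction s with
      | zero => rfl
      | succ s ihs =>
        have h : D (s + 1) = D s - ((X ⟨s, by omega⟩ : MvPolynomial (Fin n) A) -
            C (a ⟨s, by omega⟩)) • T ⟨s, by omega⟩ := by
          rw [← hT (⟨s, by omega⟩ : Fin n)]; simp
        rw [h, superAd_sub, map_sub, map_sub, ihs (by omega), superAd_smul, map_smul,
          mapMatrix_smul_eq_zero (hybridFunctional_of_lt a hs), sub_zero]
    obtain ⟨η, hη⟩ := exists_koszulDiff_wedgeTail_eq_add (f := f) hM.2 ⟨r, hrn⟩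
    simp only at hη
    have hfirst : Φ.mapMatrix (adWord par D (r + 1) l (superAd par (D 0) F)) =
        1 + D' * H + H * D' := by
      rw [hF, superAd_ordered hlam hf, hη, map_add, map_add, map_add, map_smul, map_smul,
        mapMatrix_smul_congr (hybridFunctional_succ a hM.1 ⟨r, hrn⟩), hH2, map_sum, map_sum, map_sum,
        Finset.sum_eq_zero, add_zero]
      intro j hj
      have hj := (Finset.mem_filter.1 hj).2
      -- For $j>r$ the remaining word still contains the $j$-th commutator and supplies $x_j-a_j$;
      -- with $p_j$ this is the full denominator in $x_j$, so the residue vanishes.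
      obtain ⟨N, hN⟩ := exists_adWord_eq_smul (par := par) (hT j) l (s := r + 1) hj
        (by have := j.2; omega) (ordered lam (η j))
      rw [map_smul, map_smul, hN, smul_smul]
      refine mapMatrix_smul_eq_zero (fun g => ?_) N
      rw [mul_assoc]
      exact hybridFunctional_of_le a hM.1 (by omega) g
    refine ⟨H - Φ.mapMatrix G, hH.sub (hG1.map Φ (map_zero Φ)), ?_⟩
    rw [adWord_succ_apply, superAd_sub, map_sub, map_sub, hD0 r le_rfl, hfirst, hsecond]
    noncomm_ring

theorem exists_homotopy_iterSuperAd (hD : ∀ t, HasParity par 1 (D t))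
    (hw : ∀ t, ∃ w : MvPolynomial (Fin n) A, D t * D t = w • (1 : Matrix ι ι _)) (hn : D n = D'.map C)
    (hT : ∀ i : Fin n, D i - D (i + 1) = (X i - C (a i)) • T i)
    (hlam : ∀ i, HasParity par 1 (lam i))
    (hf : ∀ i, D 0 * lam i + lam i * D 0 = f i • (1 : Matrix ι ι _))
    (hM : IsSeparation f (p, M)) :
    ∃ H : Matrix ι ι A, HasParity par 1 H ∧
      D' * H + H * D' = 1 - Matrix.of fun i j =>
        sepResidue p (M.det * iterSuperAd par T (ascProd Finset.univ lam) n i j) := by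
  obtain ⟨H, hH, h⟩ := exists_mapMatrix_adWord_ordered hD hw hn hT hlam hf hM n 0 (by omega)
  refine ⟨-H, hH.neg, ?_⟩
  -- At stage 0 the wedge of all rows gives the determinant, and the word gives $\prod_i(x_i-a_i)$
  -- times the iterated commutator with the $T_i$.
  rw [wedgeTail_zero, map_smul, ordered_single, map_smul, prod_smul_iterSuperAd hT _ le_rfl,
    Finset.filter_true_of_mem fun j _ => j.2] at h
  rw [mul_neg, neg_mul, ← neg_add, eq_sub_iff_add_eq, ← sub_eq_neg_add, sub_eq_iff_eq_add,
    ← add_assoc, ← h]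
  ext i j
  rw [LinearMap.mapMatrix_apply, Matrix.map_apply, Matrix.smul_apply, Matrix.smul_apply, smul_eq_mul,
    smul_eq_mul, mul_left_comm, hybridFunctional_zero a hM.1]
  rfl

end Homotopy

/-! ### The Zorro map -/

section Expansion

variable {ι B : Type*} [Fintype ι] [DecidableEq ι] [CommRing B] {n r : ℕ} {par : ι → ZMod 2}
  {T : Fin n → Matrix ι ι B} {L : Matrix ι ι B}

theorem HasParity.sgnMat_pow_mul_comm {M : Matrix ι ι B} (hM : HasParity par 0 M) (l : ℕ) :
    LG.sgnMat B par ^ l * M = M * LG.sgnMat B par ^ l := by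
  rw [hM.sgnMat_pow_mul', sgn_zero, one_pow, one_smul]

theorem sgnMat_pow_two_mul (l : ℕ) : sgnMat B par ^ (2 * l) = 1 := by
  rw [pow_mul, sq, sgnMat_mul_self, one_pow]

/-- The matrix product is even, so the grading operators of the three maps can be collected. Their
exponents add up to $(|a^c|+1)+(n+1)+|a|=2(n+1)$ and they cancel, leaving exactly `expansionSign`.
-/
theorem coevCoeff_mul_evCoeff_mul_signedAscProd (hT : ∀ i, HasParity par 1 (T i))
    (hL : HasParity par n L) (U : Fin r → Matrix ι ι B) (a : Finset (Fin n)) :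
    coevCoeff par T a * evCoeff par n U L ∅ * signedAscProd par T a =
      (-1 : B) ^ expansionSign n a aᶜ • (descProd aᶜ T * L * ascProd a T) := by
  have hA := HasParity.ascProd hT a
  have hcard : aᶜ.card + a.card = n := by
    rw [add_comm, Finset.card_add_card_compl, Fintype.card_fin]
  have hP : HasParity par 0 (descProd aᶜ T * L * ascProd a T) := by
    refine (((HasParity.descProd hT aᶜ).mul hL).mul hA).cast ?_
    have h2 : ((aᶜ.card : ℕ) : ZMod 2) + (a.card : ZMod 2) = n := by
      rw [← Nat.cast_add, hcard]
    linear_combination h2 + (n : ZMod 2) * (CharTwo.two_eq_zero (R := ZMod 2))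
  have hS : sgnMat B par ^ (n + 1) * ascProd a T =
      (-1 : B) ^ ((n + 1) * a.card) • (ascProd a T * sgnMat B par ^ (n + 1)) := by
    rw [hA.sgnMat_pow_mul', sgn_natCast, ← pow_mul, mul_comm a.card]
  rw [coevCoeff, evCoeff, signedAscProd, descProd_empty, Matrix.one_mul, Finset.card_empty, pow_zero,
    one_smul, Matrix.smul_mul, Matrix.smul_mul, Matrix.mul_smul, smul_smul]
  have hSS : sgnMat B par ^ (aᶜ.card + 1) * (sgnMat B par ^ (n + 1) * sgnMat B par ^ a.card) = 1 := by
    rw [← pow_add, ← pow_add, show aᶜ.card + 1 + (n + 1 + a.card) = 2 * (n + 1) by omega,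
      sgnMat_pow_two_mul]
  have h : sgnMat B par ^ (aᶜ.card + 1) * descProd aᶜ T * (L * sgnMat B par ^ (n + 1)) *
      (ascProd a T * sgnMat B par ^ a.card) =
      sgnMat B par ^ (aᶜ.card + 1) * (descProd aᶜ T * L * (sgnMat B par ^ (n + 1) * ascProd a T)) *
        sgnMat B par ^ a.card := by
    simp only [Matrix.mul_assoc]
  rw [h, hS, Matrix.mul_smul, Matrix.mul_smul, Matrix.smul_mul, smul_smul,
    ← Matrix.mul_assoc (descProd aᶜ T * L), ← Matrix.mul_assoc (sgnMat B par ^ (aᶜ.card + 1)),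
    hP.sgnMat_pow_mul_comm, Matrix.mul_assoc, Matrix.mul_assoc, hSS, Matrix.mul_one, ← pow_add,
    ← pow_add]
  rfl

theorem sum_coevCoeff_mul_evCoeff_mul_signedAscProd (hT : ∀ i, HasParity par 1 (T i))
    (hL : HasParity par n L) (U : Fin r → Matrix ι ι B) :
    ∑ a, coevCoeff par T a * evCoeff par n U L ∅ * signedAscProd par T a =
      iterSuperAd par T L n := by
  rw [iterSuperAd_eq_sum hT hL le_rfl, Finset.filter_true_of_mem fun j _ => j.2,
    Finset.powerset_univ]
  refine Finset.sum_congr rfl fun a _ => ?_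
  rw [coevCoeff_mul_evCoeff_mul_signedAscProd hT hL U, Finset.compl_eq_univ_sdiff]

end Expansion

/-! ### Compatibility of the coefficients with substitution of variables. -/

section BaseChange

variable {k : Type*} [CommRing k] {n m : ℕ} {ι : Type*} [Fintype ι] [DecidableEq ι]
  {B B' : Type*} [CommRing B] [Algebra k B] [CommRing B'] [Algebra k B'] (φ : B →ₐ[k] B')

theorem map_descProd {r : ℕ} {B B' : Type*} [CommRing B] [CommRing B'] (φ : B →+* B')
    (b : Finset (Fin r)) (T : Fin r → Matrix ι ι B) :
    (descProd b T).map φ = descProd b fun i => (T i).map φ := by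
  have := map_list_prod (RingHom.mapMatrix (m := ι) φ) (b.sort.reverse.map T)
  rw [List.map_map] at this
  exact this

theorem map_coevCoeff_apply {r : ℕ} {B B' : Type*} [CommRing B] [CommRing B'] (φ : B →+* B')
    (par : ι → ZMod 2) (T : Fin r → Matrix ι ι B) (a : Finset (Fin r)) (i j : ι) :
    φ (coevCoeff par T a i j) = coevCoeff par (fun i => (T i).map φ) a i j := by
  rw [coevCoeff, coevCoeff, Matrix.smul_apply, Matrix.smul_apply, sgnMat_pow_mul_apply,
    sgnMat_pow_mul_apply, ← map_descProd]
  simp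

theorem map_diffX (X : Based ι (ZX k m n)) (z : Fin m → B) (x x' : Fin n → B) (i : Fin n) :
    (diffX X z x x' i).map φ =
      diffX X (fun j => φ (z j)) (fun j => φ (x j)) (fun j => φ (x' j)) i := by
  ext a b
  simp only [diffX, Matrix.map_apply, map_diffQuot]
  congr 2
  ext (j | j)
  · rfl
  · simp only [Sum.elim_inr, hybrid]
    split_ifs <;> rfl

theorem map_lamProd (lam : Fin n → Matrix ι ι (ZX k m n)) (z : Fin m → B) (x : Fin n → B) :
    (lamProd lam z x).map φ = lamProd lam (fun j => φ (z j)) (fun j => φ (x j)) := by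
  ext a b
  simp only [lamProd, Matrix.map_apply]
  have : φ.comp (aeval (Sum.elim z x) : ZX k m n →ₐ[k] B) =
      aeval (Sum.elim (fun j => φ (z j)) fun j => φ (x j)) := by
    ext (j | j) <;> simp
  exact DFunLike.congr_fun this _

/-- For $b=\emptyset$ the descending product is empty, so the families `T` and `T'` are arbitrary
and unrelated. -/
theorem map_evCoeff_empty_apply {r r' : ℕ} {B B' : Type*} [CommRing B] [CommRing B'] (φ : B →+* B')
    (par : ι → ZMod 2) (T : Fin r → Matrix ι ι B) (T' : Fin r' → Matrix ι ι B') (L : Matrix ι ι B)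
    (i j : ι) : φ (evCoeff par n T L ∅ i j) = evCoeff par n T' (L.map φ) ∅ i j := by
  simp only [evCoeff, descProd_empty, Matrix.one_mul, Finset.card_empty, pow_zero, one_smul,
    mul_sgnMat_pow_apply, Matrix.map_apply]
  simp

theorem aeval_coevCoeff_diffX (X : Based ι (ZX k m n)) (c : Fin m → B) (x x' : Fin n → B)
    (a : Finset (Fin n)) (i j : ι) :
    aeval c (coevCoeff X.par
      (diffX X MvPolynomial.X (fun j => (C (x j) : MvPolynomial (Fin m) B)) fun j => C (x' j)) a i j) =
      coevCoeff X.par (diffX X c x x') a i j := by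
  have h := map_coevCoeff_apply (aeval c : MvPolynomial (Fin m) B →ₐ[B] B).toRingHom X.par
    (diffX X MvPolynomial.X (fun j => (C (x j) : MvPolynomial (Fin m) B)) fun j => C (x' j)) a i j
  have h2 : (fun i => (diffX X MvPolynomial.X (fun j => (C (x j) : MvPolynomial (Fin m) B))
      (fun j => C (x' j)) i).map (aeval c : MvPolynomial (Fin m) B →ₐ[B] B).toRingHom) =
      diffX X c x x' := by
    ext1 b
    refine (map_diffX ((aeval c : MvPolynomial (Fin m) B →ₐ[B] B).restrictScalars k) X _ _ _ b).trans ?_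
    congr 1
    · ext1 j; simp
    · ext1 j; simp
    · ext1 j; simp
  rw [h2] at h
  exact h

theorem map_evCoeff_lamProd {r r' : ℕ} (par : ι → ZMod 2) (lam : Fin n → Matrix ι ι (ZX k m n))
    (T : Fin r → Matrix ι ι (MvPolynomial (Fin n) B))
    (T' : Fin r' → Matrix ι ι (MvPolynomial (Fin n) B')) (z : Fin m → B) (i j : ι) :
    MvPolynomial.map (φ : B →+* B')
      (evCoeff par n T (lamProd lam (fun j => C (z j)) MvPolynomial.X) ∅ i j) =
      evCoeff par n T' (lamProd lam (fun j => C (φ (z j))) MvPolynomial.X) ∅ i j := by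
  have h := map_evCoeff_empty_apply (n := n) (MvPolynomial.map (φ : B →+* B')) par T T'
    (lamProd lam (fun j => C (z j)) MvPolynomial.X) i j
  have h2 : (lamProd lam (fun j => C (z j)) MvPolynomial.X).map (MvPolynomial.map (φ : B →+* B')) =
      lamProd lam (fun j => C (φ (z j))) MvPolynomial.X := by
    refine (map_lamProd (mapAlgHom (σ := Fin n) φ) lam _ _).trans ?_
    congr 1
    · ext1 j; simp
    · ext1 j; simp
  rw [h2] at h
  exact h

end BaseChange

/-! ### The Zorro map as a residue, and its homotopy to the identity. -/

section Zorro

variable {k : Type*} [CommRing k] {n m : ℕ} {ι : Type*} [Fintype ι] [DecidableEq ι]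

theorem map_aeval_commAlgEquiv {A : Type*} [CommRing A] (c : Fin m → A)
    (g : MvPolynomial (Fin m) (MvPolynomial (Fin n) A)) :
    MvPolynomial.map (aeval c : MvPolynomial (Fin m) A →ₐ[A] A).toRingHom
      (commAlgEquiv A (Fin m) (Fin n) g) =
      aeval (fun j => (C (c j) : MvPolynomial (Fin n) A)) g := by
  induction g using MvPolynomial.induction_on with
  | add p q hp hq => rw [map_add, map_add, map_add, hp, hq]
  | mul_X p i hp => rw [map_mul, map_mul, map_mul, hp]; simp
  | C p =>
    induction p using MvPolynomial.induction_on with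
    | add p q hp hq => rw [map_add, map_add, map_add, map_add, hp, hq]
    | mul_X p i hp => rw [map_mul, map_mul, map_mul, map_mul, hp]; simp
    | C a => simp

variable (W : MvPolynomial (Fin n) k) (X : Based ι (ZX k m n)) (lam : Fin n → Matrix ι ι (ZX k m n))

/-- The matrix over `k[z, x'][x]` whose residue is the Zorro map. -/
noncomputable def zorroKernel : Matrix ι ι (MvPolynomial (Fin n) (ZX k m n)) :=
  ∑ a, coevCoeff X.par (diffX X (fun j => C (zVar k m n j)) MvPolynomial.X
      fun j => C (xVar k m n j)) a *
    evCoeff X.par n (fun i : Fin 0 => i.elim0)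
      (lamProd lam (fun j => C (zVar k m n j)) MvPolynomial.X) ∅ * rhoInvCoeff X a

/-- The residue commutes with base change, so the substitution $z'=z$ made by $\lambda$ can be
carried out under the residue sign, where it acts on the coefficients of the three maps. -/
theorem zorro_apply (v : ι → ZX k m n) (i : ι) :
    zorro W X lam v i = residueExt (ZX k m n) (fun i => pderiv i W)
      ((zorroKernel X lam).mulVec (fun j => C (v j)) i) := by
  have h1 : zorro W X lam v i = aeval (zVar k m n) (evAt W X lam (fun j => C (zVar k m n j))
      MvPolynomial.X (fun p => commAlgEquiv (ZX k m n) (Fin m) (Fin n)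
        (coevAt X MvPolynomial.X (fun j => C (xVar k m n j)) (fun a => rhoInv X v (p.1, a))
          (p.2, i))) ∅) := rfl
  rw [h1, evAt_apply]
  have h2 := map_residueExt (MvPolynomial (Fin m) (ZX k m n)) (f := fun i => pderiv i W)
    ((aeval (zVar k m n) : MvPolynomial (Fin m) (ZX k m n) →ₐ[ZX k m n] ZX k m n).restrictScalars k)
  refine (h2 _).trans (congrArg _ ?_)
  rw [map_sum, Fintype.sum_prod_type]
  have h3 : ∀ p q, MvPolynomial.map
      (((aeval (zVar k m n) : MvPolynomial (Fin m) (ZX k m n) →ₐ[ZX k m n] ZX k m n).restrictScalars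
        k : MvPolynomial (Fin m) (ZX k m n) →ₐ[k] ZX k m n) : MvPolynomial (Fin m) (ZX k m n) →+* _)
      (commAlgEquiv (ZX k m n) (Fin m) (Fin n)
        (coevAt X MvPolynomial.X (fun j => C (xVar k m n j)) (fun a => rhoInv X v (p, a)) (q, i))) =
      ∑ a, coevCoeff X.par (diffX X (fun j => C (zVar k m n j)) MvPolynomial.X
        fun j => C (xVar k m n j)) a i q * (rhoInvCoeff X a).mulVec (fun j => C (v j)) p := by
    intro p q
    refine (map_aeval_commAlgEquiv _ _).trans ?_
    rw [coevAt_apply, map_sum]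
    refine Finset.sum_congr rfl fun a _ => ?_
    rw [map_mul, aeval_C, rhoInv_apply]
    exact congrArg₂ (· * ·) (aeval_coevCoeff_diffX X _ _ _ a i q) rfl
  have h4 : ∀ p q, MvPolynomial.map
      (((aeval (zVar k m n) : MvPolynomial (Fin m) (ZX k m n) →ₐ[ZX k m n] ZX k m n).restrictScalars
        k : MvPolynomial (Fin m) (ZX k m n) →ₐ[k] ZX k m n) : MvPolynomial (Fin m) (ZX k m n) →+* _)
      (evCoeff X.par n (diffZ X (fun j => C (C (zVar k m n j))) (fun j => C (MvPolynomial.X j))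
        MvPolynomial.X) (lamProd lam (fun j => C (C (zVar k m n j))) MvPolynomial.X) ∅ q p) =
      evCoeff X.par n (fun i : Fin 0 => i.elim0)
        (lamProd lam (fun j => C (zVar k m n j)) MvPolynomial.X) ∅ q p := by
    intro p q
    refine (map_evCoeff_lamProd _ X.par lam _ (fun i : Fin 0 => i.elim0) _ q p).trans ?_
    simp
  simp only [map_mul, h3, h4]
  simp only [zorroKernel, Matrix.sum_mulVec, Finset.sum_apply, ← Matrix.mulVec_mulVec]
  simp only [Matrix.mulVec, dotProduct, Finset.mul_sum]
  rw [Finset.sum_comm, Finset.sum_congr rfl fun q _ => Finset.sum_comm, Finset.sum_comm]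
  refine Finset.sum_congr rfl fun a _ => Finset.sum_congr rfl fun q _ => Finset.sum_congr rfl
    fun p _ => Finset.sum_congr rfl fun j _ => ?_
  rw [mul_left_comm]

variable {W X lam} {V : MvPolynomial (Fin m) k}

theorem zorroKernel_eq (hX : X.IsFactorisation (difference W V)) (hlam : IsNullHomotopy W X lam) :
    zorroKernel X lam = iterSuperAd X.par (diffX X (fun j => C (zVar k m n j)) MvPolynomial.X
      fun j => C (xVar k m n j)) (ascProd Finset.univ fun i =>
        (lam i).map (aeval (Sum.elim (fun j => C (zVar k m n j)) MvPolynomial.X))) n := by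
  rw [ascProd_univ, ← lamProd_eq]
  exact sum_coevCoeff_mul_evCoeff_mul_signedAscProd (hasParity_diffX hX _ _ _)
    (hasParity_lamProd hlam _ _) _

theorem exists_homotopy_residueExt_zorroKernel [Nontrivial (ZX k m n)] (hW : IsPotential W)
    (hX : X.IsFactorisation (difference W V)) (hlam : IsNullHomotopy W X lam) :
    ∃ H : Matrix ι ι (ZX k m n), HasParity X.par 1 H ∧ X.D * H + H * X.D =
      1 - (zorroKernel X lam).map (residueExt (ZX k m n) fun i => pderiv i W) := by
  obtain ⟨p, M, hM, hres⟩ := exists_residueExt_eq_sepResidue (ZX k m n) hW.finite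
  have hD : evalD X (fun j => C (zVar k m n j)) (mixed MvPolynomial.X (fun j => C (xVar k m n j)) n) =
      X.D.map (C : ZX k m n → MvPolynomial (Fin n) (ZX k m n)) := by
    rw [mixed_self]
    ext1 i j
    exact aeval_elim_C_C (A := MvPolynomial (Fin n) (ZX k m n)) (X.D i j)
  have hf : ∀ i, evalD X (fun j => C (zVar k m n j)) (mixed MvPolynomial.X
      (fun j => C (xVar k m n j)) 0) * (lam i).map (aeval (Sum.elim (fun j => C (zVar k m n j))
        MvPolynomial.X)) + (lam i).map (aeval (Sum.elim (fun j => C (zVar k m n j))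
        MvPolynomial.X)) * evalD X (fun j => C (zVar k m n j)) (mixed MvPolynomial.X
      (fun j => C (xVar k m n j)) 0) = MvPolynomial.map (algebraMap k (ZX k m n)) (pderiv i W) •
        (1 : Matrix ι ι (MvPolynomial (Fin n) (ZX k m n))) := by
    intro i
    rw [mixed_zero, nullHomotopy_map hlam, aeval_X_eq_map_algebraMap]
  have hl : ∀ i, HasParity X.par 1 ((lam i).map (aeval (Sum.elim (fun j => C (zVar k m n j))
      MvPolynomial.X) : ZX k m n →ₐ[k] MvPolynomial (Fin n) (ZX k m n))) :=
    fun i => HasParity.map _ (map_zero _) (hlam i).1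
  obtain ⟨H, hH, h⟩ := exists_homotopy_iterSuperAd (par := X.par)
    (D := fun t => evalD X (fun j => C (zVar k m n j))
      (mixed MvPolynomial.X (fun j => C (xVar k m n j)) t)) (fun t => hasParity_evalD hX _ _)
    (fun t => ⟨_, evalD_mul_evalD hX _ _⟩) hD (fun i => evalD_sub_evalD_x _ _ _ X i) hl hf hM
  refine ⟨H, hH, h.trans ?_⟩
  rw [zorroKernel_eq hX hlam]
  refine congrArg (1 - ·) (Matrix.ext fun i j => ?_)
  rw [Matrix.of_apply, Matrix.map_apply, hres]

theorem zorro_homotopic (hW : IsPotential W) (hX : X.IsFactorisation (difference W V))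
    (hlam : IsNullHomotopy W X lam) : Homotopic X X (zorro W X lam) LinearMap.id := by
  -- The degree computations with monic polynomials require $1\neq0$; over the zero ring all maps
  -- agree.
  rcases subsingleton_or_nontrivial (ZX k m n) with hs | hs
  · exact ⟨0, fun _ _ _ _ h => (h (Subsingleton.elim _ _)).elim, fun _ => Subsingleton.elim _ _⟩
  obtain ⟨H, hH, h⟩ := exists_homotopy_residueExt_zorroKernel hW hX hlam
  refine ⟨H.mulVecLin, ?_, ?_⟩
  · intro e v hv j hj
    obtain ⟨i, -, hi⟩ := Finset.exists_ne_zero_of_sum_ne_zero hj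
    rw [hH j i (left_ne_zero_of_mul hi), hv i (right_ne_zero_of_mul hi)]
  · intro v
    have hz : zorro W X lam v =
        ((zorroKernel X lam).map (residueExt (ZX k m n) fun i => pderiv i W)).mulVec v := by
      ext1 i
      rw [zorro_apply, Matrix.mulVec, Matrix.mulVec, dotProduct, dotProduct, map_sum]
      refine Finset.sum_congr rfl fun j _ => ?_
      rw [mul_comm, ← smul_eq_C_mul, map_smul, smul_eq_mul, mul_comm]
      rfl
    rw [hz, Matrix.mulVecLin_apply, Matrix.mulVecLin_apply, Matrix.mulVec_mulVec,
      Matrix.mulVec_mulVec, ← Matrix.add_mulVec, h, Matrix.sub_mulVec, Matrix.one_mulVec]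
    rfl

end Zorro

end LG

theorem proposition6p8 {k : Type*} [CommRing k] {n m : ℕ}
    (W : MvPolynomial (Fin n) k) (V : MvPolynomial (Fin m) k)
    (hW : LG.IsPotential W) (hV : LG.IsPotential V)
    {ι : Type*} [Fintype ι] [DecidableEq ι]
    (X : LG.Based ι (LG.ZX k m n)) (hX : X.IsFactorisation (LG.difference W V))
    (lam : Fin n → Matrix ι ι (LG.ZX k m n)) (hlam : LG.IsNullHomotopy W X lam) :
    (LG.IsMorphism X (LG.tensorUnit W X) (LG.rhoInv X) ∧
      LG.Homotopic X X (LG.rho k m n ι ∘ₗ LG.rhoInv X) LinearMap.id ∧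
      LG.Homotopic (LG.tensorUnit W X) (LG.tensorUnit W X)
        (LG.rhoInv X ∘ₗ LG.rho k m n ι) LinearMap.id) ∧
    LG.IsMorphism (LG.unit W) (LG.daggerTensor X) (LG.coev X) ∧
    LG.IsMorphism (LG.tensorDagger X) (LG.unit V) (LG.ev W X lam) ∧
    LG.Homotopic X X (LG.zorro W X lam) LinearMap.id :=
  ⟨⟨LG.isMorphism_rhoInv hX, LG.rho_rhoInv_homotopic X, LG.rhoInv_rho_homotopic hX⟩,
    LG.isMorphism_coev hX, LG.isMorphism_ev hX hlam, LG.zorro_homotopic hW hX hlam⟩
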